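/- For $1<p<\infty$ let $$K_p=\left\{\begin{pmatrix}\lambda&0\\0&\lambda^{p-1}\end{pmatrix}R:\ \lambda\ge 0,\ R\in SO(2)\right\}\subset\mathbb R^{2\times 2}.$$ A \emph{regular domain} $\Omega\subset\mathbb R^2$ is a nonempty, open, bounded, connected set whose boundary has Lebesgue measure zero. A map $u\in W^{1,1}(\Omega;\mathbb R^2)$ is \emph{piecewise affine} if, up to a null set, $\Omega$ is an at most countable disjoint union of regular domains on each of which $u$ agrees with an affine map. For a matrix $X$, $|X|$ is the Euclidean (Frobenius) norm; row $i$ of $\nabla u$ is the (weak) gradient of $u_i$; and $\|f\|_{C^\alpha(\overline\Omega)}=\sup_{\overline\Omega}|f|+\sup_{x\ne y}|f(x)-f(y)|/|x-y|^\alpha$. \textbf{Theorem.} For every $1<p<2$ there exist $\bar q_p\in(1,p)$ and $M>1$, depending only on $p$, with the following property. For all $A\in\mathbb R^{2\times 2}$, $b\in\mathbb R^2$, $\alpha,\delta\in(0,1)$ and every regular domain $\Omega\subset\mathbb R^2$ there exists a piecewise affine map $u\in W^{1,1}(\Omega;\mathbb R^2)\cap C^\alpha(\overline\Omega;\mathbb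 R^2)$ such that (i) $u(x)=Ax+b$ for $x\in\partial\Omega$; (ii) $\|u-(Ax+b)\|_{C^\alpha(\overline\Omega)}<\delta$; (iii) $\nabla u(x)\in K_p$ for almost every $x\in\Omega$; (iv) for every $t>1+|A|$, $$M^{-1}\bigl(1+|A|^{(p-1)\bar q_p}\bigr)t^{-\bar q_p}\ \le\ \frac{|\{x\in\Omega:|\nabla u(x)|>t\}|}{|\Omega|}\ \le\ M\bigl(1+|A|^{\frac{\bar q_p}{p-1}}\bigr)t^{-\bar q_p};$$ (v) $u\in W^{1,q}(\Omega;\mathbb R^2)$ for every $1\le q<\bar q_p$, but $\int_\Omega|\nabla u|^{\bar q_p}\,dx=\infty$; (vi) the first component $v=u_1$ is a very weak solution of the $p$-Laplace equation: $|\nabla v|^{p-2}\nabla v$ (understood as $0$ where $\nabla v=0$) is locally integrable in $\Omega$ and $\operatorname{div}\bigl(|\nabla v|^{p-2}\nabla v\bigr)=0$ in $\Omega$ in the sense of distributions, while $\int_\Omega|\nabla v|^{\bar q_p}\,dx=\infty$. -/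

import Mathlib

open MeasureTheory Set
open scoped ENNReal NNReal ContDiff Matrix Matrix.Norms.Frobenius

/- Throughout, `‖X‖` for a matrix `X` is the Frobenius (Euclidean) norm. -/

namespace PLaplace

/-- The Euclidean plane. -/
abbrev Plane : Type := EuclideanSpace ℝ (Fin 2)

/-- Real `2 × 2` matrices. -/
abbrev Mat : Type := Matrix (Fin 2) (Fin 2) ℝ

/-- A regular domain: open, bounded, connected (in particular nonempty), with Lebesgue-null
boundary. -/
structure IsRegularDomain (Ω : Set Plane) : Prop where
  isOpen : IsOpen Ω
  isBounded : Bornology.IsBounded Ω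
  isConnected : IsConnected Ω
  volume_frontier : volume (frontier Ω) = 0

/-- The affine map `x ↦ A x + b`. -/
noncomputable def affineMap (A : Mat) (b : Plane) (x : Plane) : Plane :=
  Matrix.toEuclideanLin A x + b

/-- The set of matrices `diag(l, l ^ (p - 1)) R` with `l ≥ 0` and `R ∈ SO(2)`. -/
def K (p : ℝ) : Set Mat :=
  {X | ∃ l : ℝ, 0 ≤ l ∧ ∃ R ∈ Matrix.specialOrthogonalGroup (Fin 2) ℝ,
    X = !![l, 0; 0, l ^ (p - 1)] * R}

/-- Smooth compactly supported test functions in `Ω`. -/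
structure IsTestFunction (Ω : Set Plane) (φ : Plane → ℝ) : Prop where
  contDiff : ContDiff ℝ ∞ φ
  hasCompactSupport : HasCompactSupport φ
  tsupport_subset : tsupport φ ⊆ Ω

/-- The locally integrable function `g` is the weak partial derivative `∂_j f` in `Ω` of the
locally integrable function `f`. -/
structure HasWeakPartial (Ω : Set Plane) (f : Plane → ℝ) (j : Fin 2) (g : Plane → ℝ) : Prop where
  locallyIntegrableOn_fun : LocallyIntegrableOn f Ω volume
  locallyIntegrableOn_deriv : LocallyIntegrableOn g Ω volume
  integral_eq : ∀ φ : Plane → ℝ, IsTestFunction Ω φ →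
    ∫ x in Ω, f x * fderiv ℝ φ x (EuclideanSpace.single j 1) = - ∫ x in Ω, g x * φ x

/-- `G` is the weak gradient of the map `u` in `Ω`; row `i` of `G x` is the gradient of the
`i`-th component of `u`. -/
def IsWeakGradient (Ω : Set Plane) (u : Plane → Plane) (G : Plane → Mat) : Prop :=
  ∀ i j : Fin 2, HasWeakPartial Ω (fun x => u x i) j (fun x => G x i j)

/-- The Sobolev space `W^{1,q}(Ω)` of maps into the plane. -/
def MemW1 (q : ℝ≥0∞) (Ω : Set Plane) (u : Plane → Plane) : Prop :=
  MemLp u q (volume.restrict Ω) ∧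
    ∃ G : Plane → Mat, IsWeakGradient Ω u G ∧ MemLp G q (volume.restrict Ω)

/-- The norm of `C^α(S)`: supremum norm plus Hölder seminorm (`∞` if the map is not in
`C^α(S)`). -/
noncomputable def holderNormOn (α : ℝ≥0) (S : Set Plane) (f : Plane → Plane) : ℝ≥0∞ :=
  (⨆ x ∈ S, ‖f x‖ₑ) + eHolderNorm α (S.domRestrict f)

/-- `u` is piecewise affine in `Ω`: up to a null set, `Ω` is a countable disjoint union of regular
domains on each of which `u` is affine. -/
def IsPiecewiseAffine (Ω : Set Plane) (u : Plane → Plane) : Prop :=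
  ∃ F : Set (Set Plane), F.Countable ∧ F.PairwiseDisjoint id ∧
    (∀ V ∈ F, IsRegularDomain V ∧ V ⊆ Ω) ∧ volume (Ω \ ⋃₀ F) = 0 ∧
    ∀ V ∈ F, ∃ (A : Mat) (b : Plane), ∀ x ∈ V, u x = affineMap A b x

/-- `v` is a distributional solution in `Ω` of `div (|∇v| ^ (p - 2) ∇v) = 0`, where `∇v` is the
weak gradient of `v` and the flux is required to be locally integrable. -/
def IsVeryWeakPLaplaceSolution (p : ℝ) (Ω : Set Plane) (v : Plane → ℝ) : Prop :=
  ∃ g : Plane → Plane, (∀ j : Fin 2, HasWeakPartial Ω v j (fun x => g x j)) ∧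
    LocallyIntegrableOn (fun x => ‖g x‖ ^ (p - 2) • g x) Ω volume ∧
    ∀ φ : Plane → ℝ, IsTestFunction Ω φ →
      ∫ x in Ω, fderiv ℝ φ x (‖g x‖ ^ (p - 2) • g x) = 0

end PLaplace

/-!
The map is the limit of a staircase of convex integration. Start from the affine map and, on every
piece of the current map on which the gradient `C` is still active, perturb one component by a tent:
a packing of the piece by pyramids whose three facet gradients `ξ j` surround the origin, so that
row `i` of `C` becomes `row C i + ξ j` on a proportion of the area that is prescribed by the
barycentric coordinates of the origin. The `ξ j` can be arranged so that one of the new gradients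
lies in `K p`, where it is never modified again, while the other two have a longer row and are again
of the kind needed for the next step. Small pyramids keep the total perturbation small in every
Hölder norm.

Two consecutive steps, one for each row, take the scale `ρ` of the active gradients to `2 * ρ` and
keep the proportion `β₁ * β₂ = 2 ^ (-q)` of the area active; hence the gradients of size `2 ^ m`
occupy a proportion of order `2 ^ (-q * m)`, which is the two-sided tail estimate. With
`R = 2 ^ (p - 1)` and `c = s ^ (p - 1)`, where `s * ρ` is the length of the first row when it is
first put into `K p`, the two steps are possible as soon as `β₁ > (1 + s) / (2 + s)` and
`β₂ > (c + R) / (R * (1 + c))`. The product of these thresholds exceeds `1 / (2 * R)`, so `q < p`;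
because `p < 2`, a small `s` is much smaller than `c`, which brings the product below `1 / 2` and
allows `q > 1`.

If `G ∈ K p`, then `‖g‖ ^ (p - 2) • g` for the first row `g` of `G` is, up to sign, the second row
turned by a right angle. A rotated gradient is divergence free, so the first component solves the
`p`-Laplace equation.
-/

namespace PLaplace

open Metric Filter Topology
open scoped RealInnerProductSpace

/-! ### Tents over packings by simplices -/

section Gluing

variable {X ι E : Type*} {W : ι → Set X} {f : ι → X → E}

theorem finsum_apply_eq_of_mem [AddCommMonoid E] (hW : Pairwise fun i j => Disjoint (W i) (W j))
    (hf : ∀ i, ∀ x ∉ W i, f i x = 0) {i : ι} {x : X} (hx : x ∈ W i) : ∑ᶠ j, f j x = f i x :=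
  finsum_eq_single _ i fun j hj => hf j x (disjoint_left.1 (hW hj.symm) hx)

theorem finsum_apply_eq_zero_of_notMem [AddCommMonoid E] (hf : ∀ i, ∀ x ∉ W i, f i x = 0) {x : X}
    (hx : ∀ i, x ∉ W i) : ∑ᶠ j, f j x = 0 :=
  finsum_eq_zero_of_forall_eq_zero fun j => hf j x (hx j)

theorem lipschitzWith_finsum_of_disjoint [PseudoMetricSpace X] [SeminormedAddCommGroup E]
    (hW : Pairwise fun i j => Disjoint (W i) (W j)) (hf : ∀ i, ∀ x ∉ W i, f i x = 0) {L : ℝ≥0}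
    (hL : ∀ i, LipschitzWith L (f i)) : LipschitzWith (2 * L) fun x => ∑ᶠ i, f i x := by
  have norm_le_or_mem (x y : X) :
      ‖∑ᶠ i, f i x‖ ≤ L * dist x y ∨ ∃ i, x ∈ W i ∧ y ∈ W i := by
    by_cases hx : ∃ i, x ∈ W i
    · obtain ⟨i, hi⟩ := hx
      by_cases hy : y ∈ W i
      · exact .inr ⟨i, hi, hy⟩
      · left
        simpa only [finsum_apply_eq_of_mem hW hf hi, hf i y hy, dist_zero_right] using
          (hL i).dist_le_mul x y
    · left
      rw [finsum_apply_eq_zero_of_notMem hf (not_exists.1 hx), norm_zero]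
      positivity
  refine LipschitzWith.of_dist_le_mul fun x y => ?_
  have two_mul_eq : ((2 * L : ℝ≥0) : ℝ) * dist x y = L * dist x y + L * dist y x := by
    rw [dist_comm y x]
    push_cast
    ring
  have dist_le_of_mem : (∃ i, x ∈ W i ∧ y ∈ W i) →
      dist (∑ᶠ i, f i x) (∑ᶠ i, f i y) ≤ L * dist x y + L * dist y x := by
    rintro ⟨i, hx, hy⟩
    rw [finsum_apply_eq_of_mem hW hf hx, finsum_apply_eq_of_mem hW hf hy]
    exact ((hL i).dist_le_mul x y).trans (le_add_of_nonneg_right (by positivity))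
  rw [two_mul_eq]
  rcases norm_le_or_mem x y, norm_le_or_mem y x with ⟨hx | hxy, hy | hyx⟩
  · exact (dist_le_norm_add_norm _ _).trans (add_le_add hx hy)
  · exact dist_le_of_mem (hyx.imp fun _ => And.symm)
  · exact dist_le_of_mem hxy
  · exact dist_le_of_mem hxy

end Gluing

section Pyramid

variable {ι E : Type*} [NormedAddCommGroup E] [InnerProductSpace ℝ E]

/-- The smallest inner product of `y` with a member of the family `ξ`. Its graph is a concave cone
whose faces have the gradients `ξ j`. -/
noncomputable def minInner (ξ : ι → E) (y : E) : ℝ := ⨅ j, ⟪ξ j, y⟫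

/-- The family `ξ` contains the origin in the interior of its convex hull; equivalently, and this is
the form used as definition, no closed half-space through the origin contains it. -/
def Surrounds (ξ : ι → E) : Prop := ∀ y : E, y ≠ 0 → ∃ j, ⟪ξ j, y⟫ < 0

/-- The closed simplex of height `ε` with centre `y` and inner facet normals `ξ j`. -/
def simplex (ξ : ι → E) (y : E) (ε : ℝ) : Set E := {x | ∀ j, -ε ≤ ⟪ξ j, x - y⟫}

/-- The part of `simplex ξ y ε` above which the pyramid over it has gradient `ξ j`. -/
def sector (ξ : ι → E) (y : E) (ε : ℝ) (j : ι) : Set E :=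
  {x | -ε < ⟪ξ j, x - y⟫ ∧ ∀ i, i ≠ j → ⟪ξ j, x - y⟫ < ⟪ξ i, x - y⟫}

/-- The function whose graph is the pyramid with base `simplex ξ y ε` and apex at height `ε` above
`y`, extended by zero. -/
noncomputable def pyramid (ξ : ι → E) (y : E) (ε : ℝ) (x : E) : ℝ :=
  max 0 (ε + minInner ξ (x - y))

variable {ξ : ι → E} {y : E} {ε : ℝ} {j : ι} {x : E}

theorem minInner_smul {r : ℝ} (hr : 0 ≤ r) (y : E) :
    minInner ξ (r • y) = r * minInner ξ y := by
  simp only [minInner, inner_smul_right, Real.mul_iInf_of_nonneg hr]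

theorem pyramid_nonneg : 0 ≤ pyramid ξ y ε x := le_max_left _ _

theorem sector_subset_simplex : sector ξ y ε j ⊆ simplex ξ y ε := fun x hx i => by
  rcases eq_or_ne i j with rfl | hij
  · exact hx.1.le
  · exact (hx.1.trans (hx.2 i hij)).le

theorem disjoint_sector {i : ι} (h : i ≠ j) : Disjoint (sector ξ y ε i) (sector ξ y ε j) :=
  disjoint_left.2 fun _ hi hj => lt_asymm (hi.2 j h.symm) (hj.2 i h)

theorem isClosed_simplex : IsClosed (simplex ξ y ε) := by
  simp only [simplex, ofPred_forall]
  exact isClosed_iInter fun j => isClosed_le continuous_const (by fun_prop)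

theorem sector_eq_inter_halfSpace : sector ξ y ε j =
    {x | ⟪ξ j, y⟫ - ε < ⟪ξ j, x⟫} ∩
      ⋂ i, ⋂ (_ : i ≠ j), {x | ⟪ξ j - ξ i, x⟫ < ⟪ξ j - ξ i, y⟫} := by
  ext x
  simp only [sector, mem_inter_iff, mem_iInter, mem_ofPred_eq, inner_sub_left, inner_sub_right]
  refine and_congr (by constructor <;> intro h <;> linarith) (forall₂_congr fun i _ => ?_)
  constructor <;> intro h <;> linarith

theorem convex_sector : Convex ℝ (sector ξ y ε j) := by
  rw [sector_eq_inter_halfSpace]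
  exact (convex_halfSpace_gt (innerₛₗ ℝ (ξ j)).isLinear _).inter <|
    convex_iInter₂ fun i _ => convex_halfSpace_lt (innerₛₗ ℝ (ξ j - ξ i)).isLinear _

theorem closedBall_subset_simplex {L : ℝ≥0} (hL : ∀ j, ‖ξ j‖ ≤ L) (y : E) (ε : ℝ) :
    closedBall y (ε / (L + 1)) ⊆ simplex ξ y ε := by
  intro x hx j
  rw [mem_closedBall, dist_eq_norm, le_div_iff₀ (by positivity)] at hx
  have h₁ := neg_le_of_abs_le (abs_real_inner_le_norm (ξ j) (x - y))
  have h₂ : ‖ξ j‖ * ‖x - y‖ ≤ L * ‖x - y‖ := by gcongr; exact hL j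
  linarith [norm_nonneg (x - y)]

theorem simplex_subset_closedBall [Nonempty ι] {c : ℝ} (hc : 0 < c)
    (h : ∀ y, minInner ξ y ≤ -(c * ‖y‖)) (y : E) (ε : ℝ) :
    simplex ξ y ε ⊆ closedBall y (ε / c) := by
  intro x hx
  rw [mem_closedBall, dist_eq_norm, le_div_iff₀ hc]
  linarith [h (x - y), show -ε ≤ minInner ξ (x - y) from le_ciInf hx]

variable [Finite ι]

theorem isOpen_sector : IsOpen (sector ξ y ε j) := by
  rw [sector_eq_inter_halfSpace]
  exact (isOpen_lt continuous_const (by fun_prop)).inter <| isOpen_iInter_of_finite fun i =>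
    isOpen_iInter_of_finite fun _ => isOpen_lt (by fun_prop) continuous_const

theorem minInner_le (ξ : ι → E) (j : ι) (y : E) : minInner ξ y ≤ ⟪ξ j, y⟫ :=
  ciInf_le (finite_range _).bddBelow j

theorem pyramid_eq_zero_of_notMem (hx : x ∉ simplex ξ y ε) : pyramid ξ y ε x = 0 := by
  simp only [simplex, mem_ofPred_eq, not_forall, not_le] at hx
  obtain ⟨j, hj⟩ := hx
  exact max_eq_left (by linarith [minInner_le ξ j (x - y)])

variable [Nonempty ι]

theorem exists_inner_eq_minInner (ξ : ι → E) (y : E) : ∃ j, ⟪ξ j, y⟫ = minInner ξ y :=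
  exists_eq_ciInf_of_finite

theorem pyramid_eq_of_mem_sector (hx : x ∈ sector ξ y ε j) :
    pyramid ξ y ε x = ⟪ξ j, x⟫ + (ε - ⟪ξ j, y⟫) := by
  have minInner_eq : minInner ξ (x - y) = ⟪ξ j, x - y⟫ := by
    refine (minInner_le ξ j _).antisymm (le_ciInf fun i => ?_)
    rcases eq_or_ne i j with rfl | hij
    · rfl
    · exact (hx.2 i hij).le
  rw [pyramid, minInner_eq, max_eq_right (by linarith [hx.1]), inner_sub_right]
  ring

theorem lipschitzWith_minInner {L : ℝ≥0} (hL : ∀ j, ‖ξ j‖ ≤ L) : LipschitzWith L (minInner ξ) := by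
  refine LipschitzWith.of_le_add_mul L fun x y => ?_
  obtain ⟨j, hj⟩ := exists_inner_eq_minInner ξ y
  calc minInner ξ x ≤ ⟪ξ j, x⟫ := minInner_le ξ j x
    _ = minInner ξ y + ⟪ξ j, x - y⟫ := by rw [inner_sub_right, hj]; ring
    _ ≤ minInner ξ y + ‖ξ j‖ * ‖x - y‖ := by gcongr; exact real_inner_le_norm _ _
    _ ≤ minInner ξ y + L * dist x y := by rw [dist_eq_norm]; gcongr; exact hL j

theorem lipschitzWith_pyramid {L : ℝ≥0} (hL : ∀ j, ‖ξ j‖ ≤ L) (y : E) (ε : ℝ) :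
    LipschitzWith L (pyramid ξ y ε) := by
  have h : LipschitzWith L fun x => ε + minInner ξ (x - y) := .of_dist_le_mul fun x z => by
    simpa only [dist_add_left, dist_sub_right] using
      (lipschitzWith_minInner hL).dist_le_mul (x - y) (z - y)
  exact h.const_max 0

theorem Surrounds.minInner_nonpos (hξ : Surrounds ξ) (y : E) : minInner ξ y ≤ 0 := by
  rcases eq_or_ne y 0 with rfl | hy
  · simp only [minInner, inner_zero_right, ciInf_const, le_refl]
  · obtain ⟨j, hj⟩ := hξ y hy
    exact (minInner_le ξ j y).trans hj.le

theorem Surrounds.pyramid_le (hξ : Surrounds ξ) (hε : 0 ≤ ε) : pyramid ξ y ε x ≤ ε :=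
  max_le hε (by linarith [hξ.minInner_nonpos (x - y)])

variable [FiniteDimensional ℝ E]

theorem Surrounds.exists_minInner_le (hξ : Surrounds ξ) :
    ∃ c : ℝ, 0 < c ∧ ∀ y, minInner ξ y ≤ -(c * ‖y‖) := by
  rcases subsingleton_or_nontrivial E with _ | _
  · exact ⟨1, one_pos, fun y => by simpa [Subsingleton.elim y 0] using hξ.minInner_nonpos 0⟩
  obtain ⟨L, hL⟩ := (finite_range fun j => ‖ξ j‖₊).bddAbove
  have hcont : Continuous (minInner ξ) :=
    (lipschitzWith_minInner fun j => hL (mem_range_self j)).continuous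
  obtain ⟨y₀, hy₀, hmax⟩ := (isCompact_sphere (0 : E) 1).exists_isMaxOn
    (NormedSpace.sphere_nonempty.2 zero_le_one) hcont.continuousOn
  have hneg : minInner ξ y₀ < 0 := by
    obtain ⟨j, hj⟩ := hξ y₀ (ne_zero_of_mem_unit_sphere ⟨y₀, hy₀⟩)
    exact (minInner_le ξ j y₀).trans_lt hj
  refine ⟨-minInner ξ y₀, neg_pos.2 hneg, fun y => ?_⟩
  rcases eq_or_ne y 0 with rfl | hy
  · simpa using hξ.minInner_nonpos 0
  have hy' : 0 < ‖y‖ := norm_pos_iff.2 hy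
  have hle : minInner ξ (‖y‖⁻¹ • y) ≤ minInner ξ y₀ := hmax <| by
    rw [mem_sphere_zero_iff_norm, norm_smul, norm_inv, norm_norm, inv_mul_cancel₀ hy'.ne']
  rw [minInner_smul (by positivity), inv_mul_le_iff₀ hy'] at hle
  linarith

end Pyramid

section Packing

variable {ι E : Type*} [NormedAddCommGroup E] [InnerProductSpace ℝ E] [FiniteDimensional ℝ E]
  [MeasurableSpace E] [BorelSpace E] {μ : Measure E} [μ.IsAddHaarMeasure] {ξ : ι → E}

theorem measure_setOf_inner_eq {n : E} (hn : n ≠ 0) (c : ℝ) : μ {x : E | ⟪n, x⟫ = c} = 0 := by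
  let H : AffineSubspace ℝ E := AffineSubspace.mk' ((c / ‖n‖ ^ 2) • n) (ℝ ∙ n)ᗮ
  have mem_H (x : E) : x ∈ H ↔ ⟪n, x⟫ = c := by
    rw [AffineSubspace.mem_mk', vsub_eq_sub, Submodule.mem_orthogonal_singleton_iff_inner_right,
      inner_sub_right, inner_smul_right, real_inner_self_eq_norm_sq,
      div_mul_cancel₀ _ (pow_ne_zero 2 (norm_ne_zero_iff.2 hn)), sub_eq_zero]
  have hH : H ≠ ⊤ := fun h => by
    have h₀ : ⟪n, 0⟫ = c := (mem_H 0).1 (h ▸ AffineSubspace.mem_top ℝ E _)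
    have h₁ : ⟪n, n⟫ = c := (mem_H n).1 (h ▸ AffineSubspace.mem_top ℝ E _)
    rw [← h₀, inner_zero_right] at h₁
    exact hn (inner_self_eq_zero.1 h₁)
  have coe_H : (H : Set E) = {x | ⟪n, x⟫ = c} := Set.ext mem_H
  exact coe_H ▸ Measure.addHaar_affineSubspace μ H hH

theorem measure_simplex_diff_iUnion_sector [Finite ι] [Nonempty ι] (hξ : Function.Injective ξ)
    {y : E} {ε : ℝ} (hε : 0 < ε) : μ (simplex ξ y ε \ ⋃ j, sector ξ y ε j) = 0 := by
  have hsub : simplex ξ y ε \ ⋃ j, sector ξ y ε j ⊆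
      (⋃ i, ⋃ j, ⋃ (_ : i ≠ j), {x | ⟪ξ i - ξ j, x⟫ = ⟪ξ i - ξ j, y⟫}) ∪
        ⋃ j, ⋃ (_ : ξ j ≠ 0), {x | ⟪ξ j, x⟫ = ⟪ξ j, y⟫ - ε} := by
    rintro x ⟨hx, hxs⟩
    by_contra hcon
    simp only [mem_union, mem_iUnion, mem_ofPred_eq, exists_prop, not_or, not_exists, not_and,
      inner_sub_left] at hcon
    obtain ⟨hdiff, hface⟩ := hcon
    obtain ⟨j, hj⟩ := exists_inner_eq_minInner ξ (x - y)
    refine hxs (mem_iUnion.2 ⟨j, (hx j).lt_of_ne fun h => ?_, fun i hi =>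
      (hj.trans_le (minInner_le ξ i _)).lt_of_ne fun h => ?_⟩)
    · refine hface j (fun h0 => ?_) (by rw [inner_sub_right] at h; linarith)
      rw [h0, inner_zero_left] at h
      linarith
    · rw [inner_sub_right, inner_sub_right] at h
      exact hdiff i j hi (by linarith)
  refine measure_mono_null hsub ?_
  simp only [measure_union_null_iff, measure_iUnion_null_iff]
  exact ⟨fun i j hij => measure_setOf_inner_eq (sub_ne_zero.2 (hξ.ne hij)) _,
    fun j hj => measure_setOf_inner_eq hj _⟩

/-- The simplices of centre `a.1` and height `a.2 ≤ η`, for `a ∈ s`, form a disjoint packing of `V`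
that exhausts it up to a null set. -/
structure IsPyramidPacking (μ : Measure E) (ξ : ι → E) (V : Set E) (η : ℝ) (s : Set (E × ℝ)) :
    Prop where
  countable : s.Countable
  disjoint : s.PairwiseDisjoint fun a => simplex ξ a.1 a.2
  height_pos : ∀ a ∈ s, 0 < a.2
  height_le : ∀ a ∈ s, a.2 ≤ η
  simplex_subset : ∀ a ∈ s, simplex ξ a.1 a.2 ⊆ V
  measure_diff : μ (V \ ⋃ a ∈ s, simplex ξ a.1 a.2) = 0

theorem measure_closedBall_div_le {r c d : ℝ} (hr : 0 ≤ r) (hc : 0 < c) (hd : 0 < d) (x : E) :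
    μ (closedBall x (3 * (r / c))) ≤
      ((3 * d / c) ^ Module.finrank ℝ E).toNNReal * μ (closedBall x (r / d)) := by
  rw [show 3 * (r / c) = 3 * d / c * (r / d) by field_simp,
    Measure.addHaar_closedBall_mul μ x (by positivity) (by positivity),
    Measure.addHaar_closedBall_center μ x, ENNReal.ofReal]

theorem Surrounds.exists_isPyramidPacking [Finite ι] [Nonempty ι] (hξ : Surrounds ξ) {V : Set E}
    (hV : IsOpen V) {η : ℝ} (hη : 0 < η) : ∃ s, IsPyramidPacking μ ξ V η s := by
  obtain ⟨c, hc, hcle⟩ := hξ.exists_minInner_le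
  obtain ⟨L, hL⟩ := (finite_range fun j => ‖ξ j‖₊).bddAbove
  have hball := closedBall_subset_simplex (L := L) fun j => hL (mem_range_self j)
  have hsimplex := simplex_subset_closedBall hc hcle
  let t : Set (E × ℝ) := {a | 0 < a.2 ∧ a.2 ≤ η ∧ simplex ξ a.1 a.2 ⊆ V}
  have hinterior : ∀ a ∈ t, (interior (simplex ξ a.1 a.2)).Nonempty := fun a ha =>
    ⟨a.1, interior_mono (hball a.1 a.2) (ball_subset_interior_closedBall
      (mem_ball_self (div_pos ha.1 (by positivity))))⟩
  have hsmall : ∀ x ∈ V, ∀ δ > 0, ∃ a ∈ t, a.2 / c ≤ δ ∧ a.1 = x := by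
    intro x hx δ hδ
    obtain ⟨r, hr, hrV⟩ := nhds_basis_closedBall.mem_iff.1 (hV.mem_nhds hx)
    have hle : min η (min (c * δ) (c * r)) ≤ c * δ := (min_le_right _ _).trans (min_le_left _ _)
    have hle' : min η (min (c * δ) (c * r)) ≤ c * r := (min_le_right _ _).trans (min_le_right _ _)
    refine ⟨(x, min η (min (c * δ) (c * r))), ⟨by positivity, min_le_left _ _, ?_⟩, ?_, rfl⟩
    · refine (hsimplex _ _).trans ((closedBall_subset_closedBall ?_).trans hrV)
      rwa [div_le_iff₀' hc]
    · rwa [div_le_iff₀' hc]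
  obtain ⟨s, hst, hsc, hsd, hs⟩ := Vitali.exists_disjoint_covering_ae μ V t
    ((3 * (L + 1) / c) ^ Module.finrank ℝ E).toNNReal (fun a => a.2 / c) (fun a => a.1)
    (fun a => simplex ξ a.1 a.2) (fun a _ => hsimplex a.1 a.2)
    (fun a ha => (measure_closedBall_div_le ha.1.le hc (by positivity) a.1).trans
      (mul_le_mul_right (measure_mono (hball a.1 a.2)) _))
    hinterior (fun _ _ => isClosed_simplex) hsmall
  exact ⟨s, hsc, hsd, fun a ha => (hst ha).1, fun a ha => (hst ha).2.1, fun a ha => (hst ha).2.2,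
    hs⟩

end Packing

section Tent

variable {ι E : Type*} [NormedAddCommGroup E] [InnerProductSpace ℝ E] {ξ : ι → E}
  {s : Set (E × ℝ)} {V : Set E} {η : ℝ}

/-- The sum of the pyramids of centre `a.1` and height `a.2`, for `a ∈ s`. -/
noncomputable def tent (ξ : ι → E) (s : Set (E × ℝ)) (x : E) : ℝ :=
  ∑ᶠ a : s, pyramid ξ a.1.1 a.1.2 x

/-- The nonempty sets on which `tent ξ s` is affine with gradient `ξ j`. -/
def facets (ξ : ι → E) (s : Set (E × ℝ)) (j : ι) : Set (Set E) :=
  (fun a => sector ξ a.1 a.2 j) '' s \ {∅}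

theorem sUnion_facets (ξ : ι → E) (s : Set (E × ℝ)) (j : ι) :
    ⋃₀ facets ξ s j = ⋃ a ∈ s, sector ξ a.1 a.2 j := by
  rw [facets, sUnion_sdiff_singleton_empty, sUnion_image]

theorem isOpen_sUnion_facets [Finite ι] (ξ : ι → E) (s : Set (E × ℝ)) (j : ι) :
    IsOpen (⋃₀ facets ξ s j) := by
  rw [sUnion_facets]
  exact isOpen_biUnion fun _ _ => isOpen_sector

theorem tent_nonneg (ξ : ι → E) (s : Set (E × ℝ)) (x : E) : 0 ≤ tent ξ s x :=
  finsum_nonneg fun _ => pyramid_nonneg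

namespace IsPyramidPacking

variable [MeasurableSpace E] {μ : Measure E}

theorem simplex_disjoint (h : IsPyramidPacking μ ξ V η s) :
    Pairwise fun a b : s => Disjoint (simplex ξ a.1.1 a.1.2) (simplex ξ b.1.1 b.1.2) :=
  fun a b hab => h.disjoint a.2 b.2 (Subtype.coe_ne_coe.2 hab)

theorem facets_subset (h : IsPyramidPacking μ ξ V η s) (j : ι) : ⋃₀ facets ξ s j ⊆ V := by
  rw [sUnion_facets]
  exact iUnion₂_subset fun a ha => sector_subset_simplex.trans (h.simplex_subset a ha)

theorem countable_facets (h : IsPyramidPacking μ ξ V η s) (j : ι) : (facets ξ s j).Countable :=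
  (h.countable.image _).mono sdiff_subset

theorem pairwiseDisjoint_facets (h : IsPyramidPacking μ ξ V η s) (j : ι) :
    (facets ξ s j).PairwiseDisjoint id := by
  rintro _ ⟨⟨a, ha, rfl⟩, -⟩ _ ⟨⟨b, hb, rfl⟩, -⟩ hab
  exact (h.disjoint ha hb fun e => hab (e ▸ rfl)).mono sector_subset_simplex sector_subset_simplex

theorem disjoint_sUnion_facets (h : IsPyramidPacking μ ξ V η s) {i j : ι} (hij : i ≠ j) :
    Disjoint (⋃₀ facets ξ s i) (⋃₀ facets ξ s j) := by
  simp only [sUnion_facets, disjoint_left, mem_iUnion₂]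
  rintro x ⟨a, ha, hxa⟩ ⟨b, hb, hxb⟩
  obtain rfl : a = b := h.disjoint.elim_set ha hb x (sector_subset_simplex hxa)
    (sector_subset_simplex hxb)
  exact disjoint_left.1 (disjoint_sector hij) hxa hxb

variable [Finite ι]

theorem tent_eq_pyramid (h : IsPyramidPacking μ ξ V η s) {a : E × ℝ} (ha : a ∈ s) {x : E}
    (hx : x ∈ simplex ξ a.1 a.2) : tent ξ s x = pyramid ξ a.1 a.2 x :=
  finsum_apply_eq_of_mem (i := (⟨a, ha⟩ : s)) h.simplex_disjoint
    (fun _ _ => pyramid_eq_zero_of_notMem) hx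

theorem tent_eq_zero (h : IsPyramidPacking μ ξ V η s) {x : E} (hx : x ∉ V) : tent ξ s x = 0 :=
  finsum_apply_eq_zero_of_notMem (W := fun a : s => simplex ξ a.1.1 a.1.2)
    (fun _ _ => pyramid_eq_zero_of_notMem) fun a ha => hx (h.simplex_subset a a.2 ha)

variable [Nonempty ι]

theorem lipschitzWith_tent (h : IsPyramidPacking μ ξ V η s) {L : ℝ≥0} (hL : ∀ j, ‖ξ j‖ ≤ L) :
    LipschitzWith (2 * L) (tent ξ s) :=
  lipschitzWith_finsum_of_disjoint h.simplex_disjoint (fun _ _ => pyramid_eq_zero_of_notMem)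
    fun _ => lipschitzWith_pyramid hL _ _

theorem abs_tent_le (h : IsPyramidPacking μ ξ V η s) (hξ : Surrounds ξ) (hη : 0 ≤ η) (x : E) :
    |tent ξ s x| ≤ η := by
  rw [abs_of_nonneg (tent_nonneg ξ s x)]
  by_cases hx : ∃ a : s, x ∈ simplex ξ a.1.1 a.1.2
  · obtain ⟨a, hxa⟩ := hx
    rw [h.tent_eq_pyramid a.2 hxa]
    exact (hξ.pyramid_le (h.height_pos a a.2).le).trans (h.height_le a a.2)
  · rwa [tent, finsum_apply_eq_zero_of_notMem (fun _ _ => pyramid_eq_zero_of_notMem)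
      (not_exists.1 hx)]

theorem exists_tent_eq_inner_add (h : IsPyramidPacking μ ξ V η s) {j : ι} {U : Set E}
    (hU : U ∈ facets ξ s j) : ∃ b : ℝ, ∀ x ∈ U, tent ξ s x = ⟪ξ j, x⟫ + b := by
  obtain ⟨⟨a, ha, rfl⟩, -⟩ := hU
  exact ⟨_, fun x hx => (h.tent_eq_pyramid ha (sector_subset_simplex hx)).trans
    (pyramid_eq_of_mem_sector hx)⟩

variable [FiniteDimensional ℝ E] [BorelSpace E] [μ.IsAddHaarMeasure]

theorem measure_diff_iUnion_facets (h : IsPyramidPacking μ ξ V η s) (hξ : Function.Injective ξ) :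
    μ (V \ ⋃ j, ⋃₀ facets ξ s j) = 0 := by
  have hsub : V \ ⋃ j, ⋃₀ facets ξ s j ⊆ (V \ ⋃ a ∈ s, simplex ξ a.1 a.2) ∪
      ⋃ a ∈ s, simplex ξ a.1 a.2 \ ⋃ j, sector ξ a.1 a.2 j := by
    rintro x ⟨hxV, hx⟩
    simp only [sUnion_facets, mem_iUnion, not_exists] at hx
    by_cases hxs : x ∈ ⋃ a ∈ s, simplex ξ a.1 a.2
    · obtain ⟨a, ha, hxa⟩ := mem_iUnion₂.1 hxs
      exact .inr (mem_iUnion₂.2 ⟨a, ha, hxa, by simpa using fun j => hx j a ha⟩)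
    · exact .inl ⟨hxV, hxs⟩
  refine measure_mono_null hsub (measure_union_null h.measure_diff ?_)
  exact (measure_biUnion_null_iff h.countable).2 fun a ha =>
    measure_simplex_diff_iUnion_sector hξ (h.height_pos a ha)

end IsPyramidPacking

end Tent

section LineDeriv

variable {E : Type*} [NormedAddCommGroup E] [InnerProductSpace ℝ E]

theorem lineDeriv_eq_inner_of_eqOn {U : Set E} (hU : IsOpen U) {f : E → ℝ} {ξ : E} {b : ℝ}
    (h : ∀ x ∈ U, f x = ⟪ξ, x⟫ + b) {x : E} (hx : x ∈ U) (v : E) :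
    lineDeriv ℝ f x v = ⟪ξ, v⟫ := by
  have hf : f =ᶠ[𝓝 x] fun y => ⟪ξ, y⟫ + b := by
    filter_upwards [hU.mem_nhds hx] with y hy using h y hy
  have hderiv : HasFDerivAt (fun y => ⟪ξ, y⟫ + b) (innerSL ℝ ξ) x :=
    (innerSL ℝ ξ).hasFDerivAt.add_const b
  rw [hf.lineDeriv_eq, (hderiv.hasLineDerivAt v).lineDeriv, innerSL_apply_apply]

theorem lineDeriv_eq_zero_of_forall_le {f : E → ℝ} {x : E} (h : ∀ y, f x ≤ f y) (v : E) :
    lineDeriv ℝ f x v = 0 :=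
  IsLocalMin.deriv_eq_zero (Eventually.of_forall fun t => by simpa using h (x + t • v))

variable [FiniteDimensional ℝ E] [MeasurableSpace E] [BorelSpace E] {μ : Measure E}
  [μ.IsAddHaarMeasure]

theorem integral_lineDeriv_eq_zero {f : E → ℝ} {L : ℝ≥0} (hf : LipschitzWith L f)
    (hc : HasCompactSupport f) (v : E) : ∫ x, lineDeriv ℝ f x v ∂μ = 0 := by
  have h := LipschitzWith.integral_lineDeriv_mul_eq (μ := μ) (f := fun _ : E => (1 : ℝ))
    (LipschitzWith.const (1 : ℝ)) hf hc (-v)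
  have hconst (x w : E) : lineDeriv ℝ (fun _ : E => (1 : ℝ)) x w = 0 := by simp [lineDeriv]
  simpa only [hconst, zero_mul, integral_zero, neg_neg, mul_one] using h.symm

end LineDeriv

section Area

variable {ι E : Type*} [Fintype ι] [Nonempty ι] [NormedAddCommGroup E] [InnerProductSpace ℝ E]
  [FiniteDimensional ℝ E] [MeasurableSpace E] [BorelSpace E] {μ : Measure E} [μ.IsAddHaarMeasure]
  {ξ : ι → E} {s : Set (E × ℝ)} {V : Set E} {η : ℝ}

namespace IsPyramidPacking

theorem lineDeriv_tent_ae_eq (h : IsPyramidPacking μ ξ V η s) (hξ : Function.Injective ξ) (ν : E) :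
    (fun x => lineDeriv ℝ (tent ξ s) x ν) =ᵐ[μ] fun x =>
      ∑ j, (⋃₀ facets ξ s j).indicator (fun _ => ⟪ξ j, ν⟫) x := by
  filter_upwards [compl_mem_ae_iff.2 (h.measure_diff_iUnion_facets hξ)] with x hx
  by_cases hxV : x ∈ V
  · have hxU : x ∈ ⋃ j, ⋃₀ facets ξ s j := by_contra fun hn => hx ⟨hxV, hn⟩
    obtain ⟨j, U, hU, hxU⟩ := mem_iUnion.1 hxU
    have hopen : IsOpen U := by
      obtain ⟨⟨a, -, rfl⟩, -⟩ := hU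
      exact isOpen_sector
    obtain ⟨b, hb⟩ := h.exists_tent_eq_inner_add hU
    have hj : x ∈ ⋃₀ facets ξ s j := ⟨U, hU, hxU⟩
    rw [lineDeriv_eq_inner_of_eqOn hopen hb hxU, Finset.sum_eq_single j, indicator_of_mem hj]
    · exact fun i _ hij =>
        indicator_of_notMem (disjoint_right.1 (h.disjoint_sUnion_facets hij) hj) _
    · exact fun hn => (hn (Finset.mem_univ j)).elim
  · rw [lineDeriv_eq_zero_of_forall_le fun y => (h.tent_eq_zero hxV).trans_le (tent_nonneg ξ s y)]
    exact (Finset.sum_eq_zero fun j _ =>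
      indicator_of_notMem (fun hx => hxV (h.facets_subset j hx)) _).symm

/-- The tent is compactly supported, so its gradient has mean zero. -/
theorem sum_inner_mul_measureReal_facets (h : IsPyramidPacking μ ξ V η s)
    (hξ : Function.Injective ξ) (hV : Bornology.IsBounded V) (ν : E) :
    ∑ j, ⟪ξ j, ν⟫ * μ.real (⋃₀ facets ξ s j) = 0 := by
  obtain ⟨L, hL⟩ := (finite_range fun j => ‖ξ j‖₊).bddAbove
  have hsupp : HasCompactSupport (tent ξ s) :=
    .of_support_subset_isCompact hV.isCompact_closure fun x hx =>
      subset_closure (by_contra fun hxV => hx (h.tent_eq_zero hxV))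
  have hmeas (j : ι) : MeasurableSet (⋃₀ facets ξ s j) := (isOpen_sUnion_facets ξ s j).measurableSet
  have hInt (j : ι) : Integrable ((⋃₀ facets ξ s j).indicator fun _ => ⟪ξ j, ν⟫) μ :=
    (integrable_indicator_iff (hmeas j)).2 <| integrableOn_const <|
      measure_ne_top_of_subset (h.facets_subset j) hV.measure_lt_top.ne
  have hzero := integral_lineDeriv_eq_zero (μ := μ)
    (h.lipschitzWith_tent (L := L) fun j => hL (mem_range_self j)) hsupp ν
  rw [integral_congr_ae (h.lineDeriv_tent_ae_eq hξ ν), integral_finsetSum _ fun j _ => hInt j]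
    at hzero
  simpa only [integral_indicator_const _ (hmeas _), smul_eq_mul, mul_comm] using hzero

theorem sum_measureReal_facets (h : IsPyramidPacking μ ξ V η s) (hξ : Function.Injective ξ)
    (hV : Bornology.IsBounded V) : ∑ j, μ.real (⋃₀ facets ξ s j) = μ.real V := by
  have hfin (j : ι) : μ (⋃₀ facets ξ s j) ≠ ⊤ :=
    measure_ne_top_of_subset (h.facets_subset j) hV.measure_lt_top.ne
  have hmeas (j : ι) : MeasurableSet (⋃₀ facets ξ s j) := (isOpen_sUnion_facets ξ s j).measurableSet
  rw [← measureReal_biUnion_finset (fun i _ j _ hij => h.disjoint_sUnion_facets hij)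
    (fun j _ => hmeas j) (fun j _ => hfin j)]
  simp only [Finset.mem_univ, iUnion_true]
  refine measureReal_congr (ae_eq_set.2 ⟨?_, h.measure_diff_iUnion_facets hξ⟩)
  rw [sdiff_eq_empty.2 (iUnion_subset h.facets_subset), measure_empty]

end IsPyramidPacking

end Area

/-! ### Subdivisions and refinements -/

section PieceFamilies

/-- A countable disjoint family of regular domains. -/
structure IsPieceFamily (P : Set (Set Plane)) : Prop where
  countable : P.Countable
  disjoint : P.PairwiseDisjoint id
  regular : ∀ V ∈ P, IsRegularDomain V

theorem isRegularDomain_of_convex {U : Set Plane} (hopen : IsOpen U)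
    (hbounded : Bornology.IsBounded U) (hconvex : Convex ℝ U) (hne : U.Nonempty) :
    IsRegularDomain U :=
  ⟨hopen, hbounded, ⟨hne, hconvex.isPreconnected⟩, hconvex.addHaar_frontier _⟩

namespace IsPieceFamily

theorem isOpen_sUnion {P : Set (Set Plane)} (hP : IsPieceFamily P) : IsOpen (⋃₀ P) :=
  _root_.isOpen_sUnion fun V hV => (hP.regular V hV).isOpen

theorem measurableSet_sUnion {P : Set (Set Plane)} (hP : IsPieceFamily P) :
    MeasurableSet (⋃₀ P) := hP.isOpen_sUnion.measurableSet

protected theorem empty : IsPieceFamily ∅ :=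
  ⟨countable_empty, pairwiseDisjoint_empty, fun _ h => h.elim⟩

protected theorem singleton {V : Set Plane} (hV : IsRegularDomain V) : IsPieceFamily {V} :=
  ⟨countable_singleton V, pairwiseDisjoint_singleton V id, fun _ h => h ▸ hV⟩

protected theorem union {P Q : Set (Set Plane)} (hP : IsPieceFamily P) (hQ : IsPieceFamily Q)
    (h : Disjoint (⋃₀ P) (⋃₀ Q)) : IsPieceFamily (P ∪ Q) where
  countable := hP.countable.union hQ.countable
  disjoint := hP.disjoint.union hQ.disjoint fun _ hU _ hV _ =>
    h.mono (subset_sUnion_of_mem hU) (subset_sUnion_of_mem hV)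
  regular V hV := hV.elim (hP.regular V) (hQ.regular V)

protected theorem iUnion {ι : Type*} [Countable ι] {Q : ι → Set (Set Plane)}
    (hQ : ∀ i, IsPieceFamily (Q i)) (hd : Pairwise fun i j => Disjoint (⋃₀ Q i) (⋃₀ Q j)) :
    IsPieceFamily (⋃ i, Q i) where
  countable := countable_iUnion fun i => (hQ i).countable
  disjoint := by
    intro U hU V hV hUV
    obtain ⟨i, hi⟩ := mem_iUnion.1 hU
    obtain ⟨j, hj⟩ := mem_iUnion.1 hV
    rcases eq_or_ne i j with rfl | hij
    · exact (hQ i).disjoint hi hj hUV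
    · exact (hd hij).mono (subset_sUnion_of_mem hi) (subset_sUnion_of_mem hj)
  regular U hU := by
    obtain ⟨i, hi⟩ := mem_iUnion.1 hU
    exact (hQ i).regular U hi

end IsPieceFamily

theorem IsPyramidPacking.isPieceFamily_facets {ι : Type*} [Finite ι] {ξ : ι → Plane}
    {s : Set (Plane × ℝ)} {V : Set Plane} {η : ℝ} (h : IsPyramidPacking volume ξ V η s)
    (hV : Bornology.IsBounded V) (j : ι) : IsPieceFamily (facets ξ s j) where
  countable := h.countable_facets j
  disjoint := h.pairwiseDisjoint_facets j
  regular U hU := by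
    have hUV : U ⊆ V := (subset_sUnion_of_mem hU).trans (h.facets_subset j)
    obtain ⟨⟨a, -, rfl⟩, hne⟩ := hU
    exact isRegularDomain_of_convex isOpen_sector (hV.subset hUV) convex_sector
      (nonempty_iff_ne_empty.2 hne)

end PieceFamilies

section Subdivision

/-- Up to a null set, `Ω` is divided into the pieces of `Q`, on which the construction is finished,
and those of `P`, which remain active and occupy the fraction `β` of the area. -/
structure IsSubdivision (β : ℝ) (Ω : Set Plane) (Q P : Set (Set Plane)) : Prop where
  done : IsPieceFamily Q
  active : IsPieceFamily P
  disjoint : Disjoint (⋃₀ Q) (⋃₀ P)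
  done_subset : ⋃₀ Q ⊆ Ω
  active_subset : ⋃₀ P ⊆ Ω
  volume_diff : volume (Ω \ (⋃₀ Q ∪ ⋃₀ P)) = 0
  volume_active : volume (⋃₀ P) = ENNReal.ofReal β * volume Ω

namespace IsSubdivision

variable {β : ℝ} {Ω : Set Plane} {Q P : Set (Set Plane)}

theorem volume_union (h : IsSubdivision β Ω Q P) : volume (⋃₀ Q ∪ ⋃₀ P) = volume Ω := by
  refine measure_congr (ae_eq_set.2 ⟨?_, h.volume_diff⟩)
  rw [sdiff_eq_empty.2 (union_subset h.done_subset h.active_subset), measure_empty]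

theorem volume_done (h : IsSubdivision β Ω Q P) (hβ : 0 ≤ β) (hΩ : volume Ω ≠ ⊤) :
    volume (⋃₀ Q) = ENNReal.ofReal (1 - β) * volume Ω := by
  have hadd : volume (⋃₀ Q) + ENNReal.ofReal β * volume Ω = volume Ω := by
    rw [← h.volume_active, ← measure_union h.disjoint h.active.measurableSet_sUnion,
      h.volume_union]
  rw [ENNReal.eq_sub_of_add_eq (ENNReal.mul_ne_top ENNReal.ofReal_ne_top hΩ) hadd,
    ENNReal.ofReal_sub _ hβ, ENNReal.ofReal_one, ENNReal.sub_mul fun _ _ => hΩ, one_mul]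

theorem activate (h : IsSubdivision β Ω Q P) : IsSubdivision 1 Ω ∅ (Q ∪ P) where
  done := .empty
  active := h.done.union h.active h.disjoint
  disjoint := by simp only [sUnion_empty, empty_disjoint]
  done_subset := by simp only [sUnion_empty, empty_subset]
  active_subset := by rw [sUnion_union]; exact union_subset h.done_subset h.active_subset
  volume_diff := by rw [sUnion_empty, empty_union, sUnion_union, h.volume_diff]
  volume_active := by rw [sUnion_union, h.volume_union, ENNReal.ofReal_one, one_mul]

protected theorem iUnion {ι : Type*} [Countable ι] {W : ι → Set Plane}
    {Q P : ι → Set (Set Plane)} (hW : Pairwise fun i j => Disjoint (W i) (W j))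
    (hmeas : ∀ i, MeasurableSet (W i)) (h : ∀ i, IsSubdivision β (W i) (Q i) (P i)) :
    IsSubdivision β (⋃ i, W i) (⋃ i, Q i) (⋃ i, P i) where
  done := .iUnion (fun i => (h i).done) fun i j hij =>
    (hW hij).mono (h i).done_subset (h j).done_subset
  active := .iUnion (fun i => (h i).active) fun i j hij =>
    (hW hij).mono (h i).active_subset (h j).active_subset
  disjoint := by
    simp only [sUnion_iUnion, disjoint_iUnion_left, disjoint_iUnion_right]
    intro i j
    rcases eq_or_ne j i with rfl | hij
    · exact (h j).disjoint
    · exact (hW hij).mono (h j).done_subset (h i).active_subset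
  done_subset := by
    rw [sUnion_iUnion]
    exact iUnion_mono fun i => (h i).done_subset
  active_subset := by
    rw [sUnion_iUnion]
    exact iUnion_mono fun i => (h i).active_subset
  volume_diff := by
    refine measure_mono_null ?_ (measure_iUnion_null fun i => (h i).volume_diff)
    rw [sUnion_iUnion, sUnion_iUnion, ← iUnion_union_distrib, iUnion_sdiff]
    exact iUnion_mono fun i => sdiff_subset_sdiff_right (subset_iUnion_of_subset i subset_rfl)
  volume_active := by
    rw [sUnion_iUnion, measure_iUnion hW hmeas, ← ENNReal.tsum_mul_left,
      measure_iUnion (fun i j hij => (hW hij).mono (h i).active_subset (h j).active_subset)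
        fun i => (h i).active.measurableSet_sUnion]
    exact tsum_congr fun i => (h i).volume_active

end IsSubdivision

/-- The vectors `ξ j` surround the origin and have length at most `L`, and the barycentric
coordinates of the origin with respect to them give the vectors `ξ j` with `j ≠ j₀` the total weight
`β`; the latter is tested on a vector `ν` whose products with the `ξ j`, `j ≠ j₀`, all agree. -/
structure IsSplitting {ι : Type*} (β : ℝ) (L : ℝ≥0) (ξ : ι → Plane) (j₀ : ι) (ν : Plane) :
    Prop where
  surrounds : Surrounds ξ
  injective : Function.Injective ξ
  norm_le : ∀ j, ‖ξ j‖ ≤ L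
  inner_eq : ⟪ξ j₀, ν⟫ = -β
  inner_eq_of_ne : ∀ j, j ≠ j₀ → ⟪ξ j, ν⟫ = 1 - β

variable {ι : Type*} [Finite ι] {β : ℝ} {L : ℝ≥0} {ξ : ι → Plane} {j₀ : ι} {ν : Plane}
  {s : Set (Plane × ℝ)} {V : Set Plane} {η : ℝ}

theorem IsSplitting.measureReal_facets (hξ : IsSplitting β L ξ j₀ ν)
    (h : IsPyramidPacking volume ξ V η s) (hV : Bornology.IsBounded V) :
    volume.real (⋃₀ facets ξ s j₀) = (1 - β) * volume.real V := by
  have := Fintype.ofFinite ι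
  have : Nonempty ι := ⟨j₀⟩
  classical
  have hmean := h.sum_inner_mul_measureReal_facets hξ.injective hV ν
  have htotal := h.sum_measureReal_facets hξ.injective hV
  rw [← Finset.add_sum_erase _ _ (Finset.mem_univ j₀)] at hmean htotal
  rw [Finset.sum_congr rfl fun j hj => by rw [hξ.inner_eq_of_ne j (Finset.ne_of_mem_erase hj)],
    ← Finset.mul_sum, hξ.inner_eq] at hmean
  rw [← htotal]
  linarith

theorem IsSplitting.isSubdivision (hξ : IsSplitting β L ξ j₀ ν)
    (h : IsPyramidPacking volume ξ V η s) (hV : Bornology.IsBounded V) :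
    IsSubdivision β V (facets ξ s j₀) (⋃ j : {j // j ≠ j₀}, facets ξ s j) := by
  have : Nonempty ι := ⟨j₀⟩
  have hdone := h.isPieceFamily_facets hV j₀
  have hactive : IsPieceFamily (⋃ j : {j // j ≠ j₀}, facets ξ s j) :=
    .iUnion (fun j => h.isPieceFamily_facets hV j) fun i j hij =>
      h.disjoint_sUnion_facets (Subtype.coe_ne_coe.2 hij)
  have hdisj : Disjoint (⋃₀ facets ξ s j₀) (⋃₀ ⋃ j : {j // j ≠ j₀}, facets ξ s j) := by
    rw [sUnion_iUnion, disjoint_iUnion_right]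
    exact fun j => h.disjoint_sUnion_facets j.2.symm
  have hsubset : ⋃₀ (⋃ j : {j // j ≠ j₀}, facets ξ s j) ⊆ V := by
    rw [sUnion_iUnion]
    exact iUnion_subset fun j => h.facets_subset j
  have hdiff : volume (V \ (⋃₀ facets ξ s j₀ ∪ ⋃₀ ⋃ j : {j // j ≠ j₀}, facets ξ s j)) = 0 := by
    refine measure_mono_null (sdiff_subset_sdiff_right (iUnion_subset fun j => ?_))
      (h.measure_diff_iUnion_facets hξ.injective)
    rcases eq_or_ne j j₀ with rfl | hj
    · exact subset_union_left
    · rw [sUnion_iUnion]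
      exact (subset_iUnion (fun j : {j // j ≠ j₀} => ⋃₀ facets ξ s j) ⟨j, hj⟩).trans
        subset_union_right
  refine ⟨hdone, hactive, hdisj, h.facets_subset j₀, hsubset, hdiff, ?_⟩
  have hVfin : volume V ≠ ⊤ := hV.measure_lt_top.ne
  have hfin {U : Set Plane} (hU : U ⊆ V) : volume U ≠ ⊤ := measure_ne_top_of_subset hU hVfin
  have hadd := measureReal_union hdisj hactive.measurableSet_sUnion
    (hfin (h.facets_subset j₀)) (hfin hsubset)
  rw [measureReal_congr (ae_eq_set.2 ⟨by rw [sdiff_eq_empty.2 (union_subset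
    (h.facets_subset j₀) hsubset), measure_empty], hdiff⟩ : _ =ᵐ[volume] V),
    hξ.measureReal_facets h hV] at hadd
  rw [← ofReal_measureReal (hfin hsubset), ← ofReal_measureReal hVfin,
    ← ENNReal.ofReal_mul' measureReal_nonneg]
  exact congrArg _ (by linarith)

end Subdivision

section Refinement

/-- The `i`-th row of a matrix, as a vector of the Euclidean plane. -/
def row (C : Mat) (i : Fin 2) : Plane := WithLp.toLp 2 (C i)

/-- The matrix obtained from `C` by replacing its `i`-th row. -/
def setRow (C : Mat) (i : Fin 2) (z : Plane) : Mat := C.updateRow i (WithLp.ofLp z)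

@[simp] theorem row_apply (C : Mat) (i j : Fin 2) : row C i j = C i j := rfl

@[simp] theorem row_setRow_self (C : Mat) (i : Fin 2) (z : Plane) : row (setRow C i z) i = z := by
  simp [row, setRow]

theorem row_setRow_of_ne (C : Mat) {i k : Fin 2} (h : k ≠ i) (z : Plane) :
    row (setRow C i z) k = row C k := by
  simp [row, setRow, Matrix.updateRow_ne h]

theorem norm_sq_eq_row (A : Mat) : ‖A‖ ^ 2 = ‖row A 0‖ ^ 2 + ‖row A 1‖ ^ 2 := by
  rw [Matrix.frobenius_norm_def, ← Real.sqrt_eq_rpow, Real.sq_sqrt (by positivity),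
    EuclideanSpace.norm_sq_eq, EuclideanSpace.norm_sq_eq]
  simp

theorem norm_row_le (A : Mat) (i : Fin 2) : ‖row A i‖ ≤ ‖A‖ := by
  refine (sq_le_sq₀ (norm_nonneg _) (norm_nonneg _)).1 ?_
  rw [norm_sq_eq_row]
  fin_cases i
  · exact le_add_of_nonneg_right (sq_nonneg _)
  · exact le_add_of_nonneg_left (sq_nonneg _)

theorem affineMap_apply (A : Mat) (b x : Plane) (k : Fin 2) :
    affineMap A b x k = ⟪row A k, x⟫ + b k := by
  fin_cases k <;> simp [affineMap, Matrix.toLpLin_apply, row, PiLp.inner_apply, mul_comm]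

theorem affineMap_setRow_add (C : Mat) (i : Fin 2) (ξ b : Plane) (c : ℝ) (x : Plane) :
    affineMap (setRow C i (row C i + ξ)) (b + c • EuclideanSpace.single i (1 : ℝ)) x =
      affineMap C b x + (⟪ξ, x⟫ + c) • EuclideanSpace.single i (1 : ℝ) := by
  ext k
  rw [PiLp.add_apply, affineMap_apply, affineMap_apply]
  rcases eq_or_ne k i with rfl | h
  · simp [inner_add_left]
    ring
  · rw [row_setRow_of_ne _ h]
    simp [h]

/-- The map `u` is affine on each member of `P`, with gradient in `S`. -/
def AffineOnPieces (u : Plane → Plane) (P : Set (Set Plane)) (S : Set Mat) : Prop :=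
  ∀ V ∈ P, ∃ A ∈ S, ∃ b : Plane, ∀ x ∈ V, u x = affineMap A b x

theorem AffineOnPieces.union {u : Plane → Plane} {P Q : Set (Set Plane)} {S : Set Mat}
    (hP : AffineOnPieces u P S) (hQ : AffineOnPieces u Q S) : AffineOnPieces u (P ∪ Q) S :=
  fun V hV => hV.elim (hP V) (hQ V)

theorem AffineOnPieces.congr {u v : Plane → Plane} {P : Set (Set Plane)} {S : Set Mat}
    (hu : AffineOnPieces u P S) (huv : ∀ x ∈ ⋃₀ P, v x = u x) : AffineOnPieces v P S := by
  intro V hV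
  obtain ⟨A, hA, b, hb⟩ := hu V hV
  exact ⟨A, hA, b, fun x hx => (huv x ⟨V, hV, hx⟩).trans (hb x hx)⟩

theorem AffineOnPieces.iUnion {ι : Sort*} {u : Plane → Plane} {P : ι → Set (Set Plane)}
    {S : Set Mat} (h : ∀ i, AffineOnPieces u (P i) S) : AffineOnPieces u (⋃ i, P i) S := by
  intro V hV
  obtain ⟨i, hi⟩ := mem_iUnion.1 hV
  exact h i V hi

/-- The map `u'` is obtained from `u` by a perturbation inside `Ω` of size at most `η` and Lipschitz
constant at most `L`, after which it is affine on the pieces of a subdivision of `Ω`, with gradients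
in `T` on the finished pieces and in `S` on the active ones. -/
structure IsRefinement (β : ℝ) (L : ℝ≥0) (T S : Set Mat) (η : ℝ) (u u' : Plane → Plane)
    (Ω : Set Plane) (Q P : Set (Set Plane)) : Prop extends IsSubdivision β Ω Q P where
  affine_done : AffineOnPieces u' Q T
  affine_active : AffineOnPieces u' P S
  lipschitz : LipschitzWith L (u' - u)
  norm_sub_le : ∀ x, ‖u' x - u x‖ ≤ η
  eq_of_notMem : ∀ x, x ∉ Ω → u' x = u x

/-- Some row of `C` can be perturbed by three vectors surrounding the origin so that the first
resulting matrix lies in `T` and the other two, of total weight `β`, lie in `S`. -/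
def Splits (β : ℝ) (L : ℝ≥0) (C : Mat) (T S : Set Mat) : Prop :=
  ∃ (i : Fin 2) (ξ : Fin 3 → Plane) (ν : Plane), IsSplitting β L ξ 0 ν ∧
    setRow C i (row C i + ξ 0) ∈ T ∧ ∀ j, j ≠ 0 → setRow C i (row C i + ξ j) ∈ S

/-- Every matrix of `R` splits, either with weight `κ` on `S` and the rest on `T`, or entirely into
matrices of `S`, in which case nothing is finished and `κ = 1`. -/
def StepRule (κ : ℝ) (L : ℝ≥0) (R T S : Set Mat) : Prop :=
  (∀ C ∈ R, Splits κ L C T S) ∨ (κ = 1 ∧ ∃ β, ∀ C ∈ R, Splits β L C S S)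

theorem Splits.exists_isRefinement {β : ℝ} {L : ℝ≥0} {C : Mat} {T S : Set Mat}
    (h : Splits β L C T S) {V : Set Plane} (hV : IsRegularDomain V) {u : Plane → Plane} {b : Plane}
    (hu : ∀ x ∈ V, u x = affineMap C b x) {η : ℝ} (hη : 0 < η) :
    ∃ u' Q P, IsRefinement β (2 * L) T S η u u' V Q P := by
  obtain ⟨i, ξ, ν, hξ, hT, hS⟩ := h
  obtain ⟨s, hs⟩ := hξ.surrounds.exists_isPyramidPacking (μ := volume) hV.isOpen hη
  let e : Plane := EuclideanSpace.single i 1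
  have norm_smul_e (r : ℝ) : ‖r • e‖ = |r| := by
    rw [norm_smul, PiLp.norm_single, norm_one, mul_one, Real.norm_eq_abs]
  have affine_facets {j : Fin 3} {M : Set Mat} (hM : setRow C i (row C i + ξ j) ∈ M) :
      AffineOnPieces (fun x => u x + tent ξ s x • e) (facets ξ s j) M := by
    intro U hU
    obtain ⟨c, hc⟩ := hs.exists_tent_eq_inner_add hU
    refine ⟨_, hM, b + c • e, fun x hx => ?_⟩
    rw [affineMap_setRow_add, ← hc x hx, ← hu x (hs.facets_subset j ⟨U, hU, hx⟩)]
  refine ⟨fun x => u x + tent ξ s x • e, _, _, hξ.isSubdivision hs hV.isBounded, affine_facets hT,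
    .iUnion fun j => affine_facets (hS j j.2), .of_dist_le_mul fun x y => ?_, fun x => ?_,
    fun x hx => ?_⟩
  · simp only [Pi.sub_apply, add_sub_cancel_left]
    rw [dist_eq_norm, ← sub_smul, norm_smul_e, ← Real.dist_eq]
    exact (hs.lipschitzWith_tent hξ.norm_le).dist_le_mul x y
  · rw [add_sub_cancel_left, norm_smul_e]
    exact hs.abs_tent_le hξ.surrounds hη.le x
  · rw [hs.tent_eq_zero hx, zero_smul, add_zero]

namespace IsRefinement

variable {β : ℝ} {L : ℝ≥0} {T S : Set Mat} {η : ℝ} {u : Plane → Plane}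

theorem activate {u' : Plane → Plane} {Ω : Set Plane} {Q P : Set (Set Plane)} {T' : Set Mat}
    (h : IsRefinement β L S S η u u' Ω Q P) : IsRefinement 1 L T' S η u u' Ω ∅ (Q ∪ P) where
  __ := h
  toIsSubdivision := h.toIsSubdivision.activate
  affine_done _ hV := hV.elim
  affine_active := h.affine_done.union h.affine_active

theorem glue {ι : Type*} [Countable ι] {W : ι → Set Plane} {u' : ι → Plane → Plane}
    {Q P : ι → Set (Set Plane)} (hη : 0 ≤ η) (hW : Pairwise fun i j => Disjoint (W i) (W j))
    (hmeas : ∀ i, MeasurableSet (W i))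
    (h : ∀ i, IsRefinement β L T S η u (u' i) (W i) (Q i) (P i)) :
    IsRefinement β (2 * L) T S η u (fun x => u x + ∑ᶠ i, (u' i x - u x)) (⋃ i, W i) (⋃ i, Q i)
      (⋃ i, P i) := by
  have hzero : ∀ i, ∀ x ∉ W i, u' i x - u x = 0 := fun i x hx =>
    sub_eq_zero.2 ((h i).eq_of_notMem x hx)
  have hmem {i : ι} {x : Plane} (hx : x ∈ W i) : u x + ∑ᶠ i, (u' i x - u x) = u' i x := by
    rw [finsum_apply_eq_of_mem (f := fun i x => u' i x - u x) hW hzero hx, add_sub_cancel]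
  have hnotMem {x : Plane} (hx : ∀ i, x ∉ W i) : ∑ᶠ i, (u' i x - u x) = 0 :=
    finsum_apply_eq_zero_of_notMem (f := fun i x => u' i x - u x) hzero hx
  refine ⟨.iUnion hW hmeas fun i => (h i).toIsSubdivision,
    .iUnion fun i => (h i).affine_done.congr fun x hx => hmem ((h i).done_subset hx),
    .iUnion fun i => (h i).affine_active.congr fun x hx => hmem ((h i).active_subset hx),
    ?_, fun x => ?_, fun x hx => ?_⟩
  · have heq : (fun x => u x + ∑ᶠ i, (u' i x - u x)) - u = fun x => ∑ᶠ i, (u' i x - u x) :=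
      funext fun x => add_sub_cancel_left _ _
    rw [heq]
    exact lipschitzWith_finsum_of_disjoint (f := fun i x => u' i x - u x) hW hzero
      fun i => (h i).lipschitz
  · rw [add_sub_cancel_left]
    by_cases hx : ∃ i, x ∈ W i
    · obtain ⟨i, hi⟩ := hx
      rw [finsum_apply_eq_of_mem (f := fun i x => u' i x - u x) hW hzero hi]
      exact (h i).norm_sub_le x
    · rwa [hnotMem (not_exists.1 hx), norm_zero]
  · rw [hnotMem fun i hi => hx (mem_iUnion_of_mem i hi), add_zero]

end IsRefinement

theorem StepRule.exists_isRefinement_piece {κ : ℝ} {L : ℝ≥0} {R T S : Set Mat}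
    (hR : StepRule κ L R T S) {V : Set Plane} (hV : IsRegularDomain V) {u : Plane → Plane} {C : Mat}
    (hC : C ∈ R) {b : Plane} (hu : ∀ x ∈ V, u x = affineMap C b x) {η : ℝ} (hη : 0 < η) :
    ∃ u' Q P, IsRefinement κ (2 * L) T S η u u' V Q P := by
  rcases hR with hR | ⟨rfl, β, hR⟩
  · exact (hR C hC).exists_isRefinement hV hu hη
  · obtain ⟨u', Q, P, h⟩ := (hR C hC).exists_isRefinement hV hu hη
    exact ⟨u', ∅, Q ∪ P, h.activate⟩

theorem StepRule.exists_isRefinement {κ : ℝ} {L : ℝ≥0} {R T S : Set Mat} (hR : StepRule κ L R T S)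
    {P : Set (Set Plane)} (hP : IsPieceFamily P) {u : Plane → Plane} (hu : AffineOnPieces u P R)
    {η : ℝ} (hη : 0 < η) :
    ∃ u' Q P', IsRefinement κ (4 * L) T S η u u' (⋃₀ P) Q P' := by
  have hpiece (V : P) : ∃ u' Q P', IsRefinement κ (2 * L) T S η u u' V Q P' := by
    obtain ⟨C, hC, b, hb⟩ := hu V V.2
    exact hR.exists_isRefinement_piece (hP.regular V V.2) hC hb hη
  choose u' Q P' h using hpiece
  have : Countable P := hP.countable.to_subtype
  have hglue := IsRefinement.glue (W := fun V : P => (V : Set Plane)) hη.le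
    (fun V W hVW => hP.disjoint V.2 W.2 (Subtype.coe_ne_coe.2 hVW))
    (fun V => (hP.regular V V.2).isOpen.measurableSet) h
  rw [← sUnion_eq_iUnion, show 2 * (2 * L) = 4 * L by ring] at hglue
  exact ⟨_, _, _, hglue⟩

end Refinement

/-! ### Staircases and their limits -/

section TelescopingLimits

variable {X E : Type*} [NormedAddCommGroup E]

/-- The limit of a sequence of maps, as a telescoping series. -/
noncomputable def limitMap (u : ℕ → X → E) (x : X) : E := u 0 x + ∑' n, (u (n + 1) x - u n x)

theorem norm_sub_zero_le {u : ℕ → X → E} {η : ℕ → ℝ} (hη : Summable η)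
    (hu : ∀ n x, ‖u (n + 1) x - u n x‖ ≤ η n) (n : ℕ) (x : X) : ‖u n x - u 0 x‖ ≤ ∑' n, η n := by
  rw [← Finset.sum_range_sub (fun n => u n x)]
  exact (norm_sum_le_of_le _ fun i _ => hu i x).trans
    (hη.sum_le_tsum _ fun i _ => (norm_nonneg _).trans (hu i x))

theorem norm_limitMap_sub_zero_le {u : ℕ → X → E} {η : ℕ → ℝ} (hη : Summable η)
    (hu : ∀ n x, ‖u (n + 1) x - u n x‖ ≤ η n) (x : X) : ‖limitMap u x - u 0 x‖ ≤ ∑' n, η n := by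
  rw [limitMap, add_sub_cancel_left]
  exact tsum_of_norm_bounded hη.hasSum fun n => hu n x

theorem holderWith_tsum [PseudoEMetricSpace X] {f : ℕ → X → E} (hf : ∀ x, Summable fun n => f n x)
    {α δ : ℝ≥0} {θ : ℕ → ℝ≥0} (hθ : HasSum θ δ) (h : ∀ n, HolderWith (θ n) α (f n)) :
    HolderWith δ α fun x => ∑' n, f n x := by
  intro x y
  rw [edist_eq_enorm_sub, ← (hf x).tsum_sub (hf y), ← hθ.tsum_eq, ENNReal.coe_tsum hθ.summable,
    ← ENNReal.tsum_mul_right]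
  refine enorm_tsum_le_tsum_enorm.trans (ENNReal.tsum_le_tsum fun n => ?_)
  rw [← edist_eq_enorm_sub]
  exact h n x y

theorem continuous_limitMap [TopologicalSpace X] [CompleteSpace E] {u : ℕ → X → E} {η : ℕ → ℝ}
    (hη : Summable η) (hu : ∀ n x, ‖u (n + 1) x - u n x‖ ≤ η n) (hc : ∀ n, Continuous (u n)) :
    Continuous (limitMap u) :=
  (hc 0).add (continuous_tsum (fun n => (hc (n + 1)).sub (hc n)) hη hu)

theorem tendsto_limitMap {u : ℕ → X → E} {x : X} (h : Summable fun n => u (n + 1) x - u n x) :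
    Tendsto (fun n => u n x) atTop (𝓝 (limitMap u x)) := by
  refine (h.hasSum.tendsto_sum_nat.const_add (u 0 x)).congr fun n => ?_
  rw [Finset.sum_range_sub (fun n => u n x), add_sub_cancel]

theorem exists_pos_forall_holderWith [PseudoEMetricSpace X] (L : ℝ≥0) {α : ℝ≥0} (hα : α < 1)
    {η : ℝ≥0} (hη : 0 < η) :
    ∃ ε : ℝ≥0, 0 < ε ∧ ε ≤ η ∧ ∀ φ : X → E, LipschitzWith L φ → (∀ x, ‖φ x‖₊ ≤ ε) →
      HolderWith η α φ := by
  have hα' : 0 < 1 - α := tsub_pos_of_lt hα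
  have hlim : Tendsto (fun ε : ℝ≥0 => (2 * ε) ^ ((1 - α : ℝ≥0) : ℝ) * L ^ (α : ℝ)) (𝓝 0) (𝓝 0) := by
    have hcont : Continuous fun ε : ℝ≥0 => (2 * ε) ^ ((1 - α : ℝ≥0) : ℝ) * L ^ (α : ℝ) :=
      ((NNReal.continuous_rpow_const (1 - α).coe_nonneg).comp
        (continuous_const.mul continuous_id)).mul continuous_const
    simpa [(NNReal.coe_pos.2 hα').ne'] using hcont.tendsto 0
  have hsmall := (hlim.eventually_le_const hη).filter_mono (nhdsWithin_le_nhds (s := Ioi 0))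
  obtain ⟨ε, hεη, hε0, hε⟩ := (hsmall.and (Ioc_mem_nhdsGT hη)).exists
  refine ⟨ε, hε0, hε, fun φ hφ hb => ?_⟩
  have hφ₀ : HolderWith (2 * ε) 0 φ := fun x y => by
    rw [NNReal.coe_zero, ENNReal.rpow_zero, mul_one, edist_nndist, nndist_eq_nnnorm, two_mul]
    exact ENNReal.coe_le_coe.2 ((nnnorm_sub_le _ _).trans (add_le_add (hb x) (hb y)))
  have hφ₁ : HolderWith L 1 φ := holderWith_one.2 hφ
  simpa using (hφ₀.interpolate hφ₁ (tsub_add_cancel_of_le hα.le)).mono hεη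

end TelescopingLimits

section WeakPartials

theorem tendsto_integral_mul_of_dominated {X : Type*} [MeasurableSpace X] {μ : Measure X}
    {f : ℕ → X → ℝ} {f₀ F ψ : X → ℝ} {M : ℝ} (hf : ∀ n, AEStronglyMeasurable (f n) μ)
    (hF : Integrable F μ) (hle : ∀ n, ∀ᵐ x ∂μ, ‖f n x‖ ≤ F x)
    (hlim : ∀ᵐ x ∂μ, Tendsto (fun n => f n x) atTop (𝓝 (f₀ x))) (hψ : AEStronglyMeasurable ψ μ)
    (hM : ∀ x, ‖ψ x‖ ≤ M) :
    Tendsto (fun n => ∫ x, f n x * ψ x ∂μ) atTop (𝓝 (∫ x, f₀ x * ψ x ∂μ)) := by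
  refine tendsto_integral_of_dominated_convergence (fun x => F x * M) (fun n => (hf n).mul hψ)
    (hF.mul_const M) (fun n => ?_) ?_
  · filter_upwards [hle n] with x hx
    rw [norm_mul]
    gcongr
    exacts [(norm_nonneg _).trans hx, hM x]
  · filter_upwards [hlim] with x hx using hx.mul_const _

theorem integrable_of_tendsto_of_dominated {X : Type*} [MeasurableSpace X] {μ : Measure X}
    {f : ℕ → X → ℝ} {f₀ F : X → ℝ} (hf : ∀ n, AEStronglyMeasurable (f n) μ)
    (hF : Integrable F μ) (hle : ∀ n, ∀ᵐ x ∂μ, ‖f n x‖ ≤ F x)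
    (hlim : ∀ᵐ x ∂μ, Tendsto (fun n => f n x) atTop (𝓝 (f₀ x))) : Integrable f₀ μ := by
  refine hF.mono' (aestronglyMeasurable_of_tendsto_ae _ hf hlim) ?_
  filter_upwards [hlim, ae_all_iff.2 hle] with x hx hx' using le_of_tendsto' hx.norm hx'

namespace IsTestFunction

variable {Ω : Set Plane} {φ : Plane → ℝ}

theorem continuous_fderiv_apply (hφ : IsTestFunction Ω φ) (v : Plane) :
    Continuous fun x => fderiv ℝ φ x v :=
  (hφ.contDiff.continuous_fderiv (by simp)).clm_apply continuous_const

theorem eq_zero_of_notMem (hφ : IsTestFunction Ω φ) {x : Plane} (hx : x ∉ Ω) : φ x = 0 :=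
  image_eq_zero_of_notMem_tsupport fun h => hx (hφ.tsupport_subset h)

theorem fderiv_eq_zero_of_notMem (hφ : IsTestFunction Ω φ) {x : Plane} (hx : x ∉ Ω) :
    fderiv ℝ φ x = 0 :=
  image_eq_zero_of_notMem_tsupport fun h =>
    hx (hφ.tsupport_subset (tsupport_fderiv_subset ℝ h))

theorem exists_norm_le (hφ : IsTestFunction Ω φ) : ∃ M, ∀ x, ‖φ x‖ ≤ M :=
  hφ.hasCompactSupport.exists_bound_of_continuous hφ.contDiff.continuous

theorem exists_norm_fderiv_apply_le (hφ : IsTestFunction Ω φ) (v : Plane) :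
    ∃ M, ∀ x, ‖fderiv ℝ φ x v‖ ≤ M :=
  (hφ.hasCompactSupport.fderiv_apply (𝕜 := ℝ) v).exists_bound_of_continuous
    (hφ.continuous_fderiv_apply v)

end IsTestFunction

theorem HasWeakPartial.of_tendsto_of_dominated {Ω : Set Plane} {j : Fin 2} {f g : ℕ → Plane → ℝ}
    {f₀ g₀ F G : Plane → ℝ} (h : ∀ n, HasWeakPartial Ω (f n) j (g n))
    (hF : IntegrableOn F Ω) (hG : IntegrableOn G Ω)
    (hfF : ∀ n, ∀ᵐ x ∂volume.restrict Ω, ‖f n x‖ ≤ F x)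
    (hgG : ∀ n, ∀ᵐ x ∂volume.restrict Ω, ‖g n x‖ ≤ G x)
    (hf : ∀ᵐ x ∂volume.restrict Ω, Tendsto (fun n => f n x) atTop (𝓝 (f₀ x)))
    (hg : ∀ᵐ x ∂volume.restrict Ω, Tendsto (fun n => g n x) atTop (𝓝 (g₀ x))) :
    HasWeakPartial Ω f₀ j g₀ := by
  have hfm n := (h n).locallyIntegrableOn_fun.aestronglyMeasurable
  have hgm n := (h n).locallyIntegrableOn_deriv.aestronglyMeasurable
  have hf₀ : IntegrableOn f₀ Ω := integrable_of_tendsto_of_dominated hfm hF hfF hf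
  have hg₀ : IntegrableOn g₀ Ω := integrable_of_tendsto_of_dominated hgm hG hgG hg
  refine ⟨hf₀.locallyIntegrableOn, hg₀.locallyIntegrableOn, fun φ hφ => ?_⟩
  obtain ⟨M, hM⟩ := hφ.exists_norm_le
  obtain ⟨M', hM'⟩ := hφ.exists_norm_fderiv_apply_le (EuclideanSpace.single j 1)
  refine tendsto_nhds_unique (tendsto_integral_mul_of_dominated hfm hF hfF hf
    (hφ.continuous_fderiv_apply _).aestronglyMeasurable hM') ?_
  refine (tendsto_integral_mul_of_dominated hgm hG hgG hg
    hφ.contDiff.continuous.aestronglyMeasurable hM).neg.congr fun n => ?_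
  exact ((h n).integral_eq φ hφ).symm

theorem hasWeakPartial_of_lipschitzWith (Ω : Set Plane) {f : Plane → ℝ} {C : ℝ≥0}
    (hf : LipschitzWith C f) (j : Fin 2) :
    HasWeakPartial Ω f j fun x => lineDeriv ℝ f x (EuclideanSpace.single j 1) := by
  refine ⟨hf.continuous.locallyIntegrable.locallyIntegrableOn Ω,
    (LocallyIntegrable.locallyIntegrableOn ?_ Ω), fun φ hφ => ?_⟩
  · refine (locallyIntegrable_const (C * ‖EuclideanSpace.single j (1 : ℝ)‖)).mono
      (measurable_lineDeriv hf.continuous).aestronglyMeasurable (.of_forall fun x => ?_)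
    exact (norm_lineDeriv_le_of_lipschitz ℝ hf).trans (Real.le_norm_self _)
  · obtain ⟨D, hD⟩ := hφ.contDiff.lipschitzWith_of_hasCompactSupport hφ.hasCompactSupport (by simp)
    have hparts := hf.integral_lineDeriv_mul_eq (μ := volume) hD hφ.hasCompactSupport
      (EuclideanSpace.single j 1)
    have hneg (x : Plane) : lineDeriv ℝ φ x (-EuclideanSpace.single j 1) =
        -fderiv ℝ φ x (EuclideanSpace.single j 1) := by
      rw [((hφ.contDiff.differentiable (by simp)) x).lineDeriv_eq_fderiv, map_neg]
    rw [setIntegral_eq_integral_of_forall_compl_eq_zero fun x hx => by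
        rw [hφ.fderiv_eq_zero_of_notMem hx, zero_apply, mul_zero],
      setIntegral_eq_integral_of_forall_compl_eq_zero fun x hx => by
        rw [hφ.eq_zero_of_notMem hx, mul_zero], hparts]
    simp only [hneg, mul_comm, mul_neg, integral_neg, neg_neg]

end WeakPartials

section Jacobian

/-- The Jacobian matrix, computed with line derivatives so that it makes sense for every map. -/
noncomputable def jacobian (u : Plane → Plane) (x : Plane) : Mat :=
  Matrix.of fun i j => lineDeriv ℝ (fun y => u y i) x (EuclideanSpace.single j (1 : ℝ))

theorem jacobian_eq_of_eqOn {U : Set Plane} (hU : IsOpen U) {u : Plane → Plane} {A : Mat}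
    {b : Plane} (h : ∀ x ∈ U, u x = affineMap A b x) {x : Plane} (hx : x ∈ U) :
    jacobian u x = A := by
  ext i j
  rw [jacobian, Matrix.of_apply, lineDeriv_eq_inner_of_eqOn hU (ξ := row A i) (b := b i)
    (fun y hy => by rw [h y hy, affineMap_apply]) hx, EuclideanSpace.inner_single_right, one_mul]
  rfl

theorem AffineOnPieces.jacobian_mem {P : Set (Set Plane)} (hP : IsPieceFamily P)
    {u v : Plane → Plane} {S : Set Mat} (hu : AffineOnPieces u P S)
    (huv : ∀ y ∈ ⋃₀ P, v y = u y) {x : Plane} (hx : x ∈ ⋃₀ P) : jacobian v x ∈ S := by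
  obtain ⟨V, hV, hx⟩ := hx
  obtain ⟨A, hA, b, hb⟩ := (hu.congr huv) V hV
  rwa [jacobian_eq_of_eqOn (hP.regular V hV).isOpen hb hx]

theorem jacobian_congr_of_isOpen {U : Set Plane} (hU : IsOpen U) {u v : Plane → Plane}
    (h : ∀ x ∈ U, u x = v x) {x : Plane} (hx : x ∈ U) : jacobian u x = jacobian v x := by
  ext i j
  have huv : (fun y => u y i) =ᶠ[𝓝 x] fun y => v y i := by
    filter_upwards [hU.mem_nhds hx] with y hy
    rw [h y hy]
  exact huv.lineDeriv_eq

theorem measurable_jacobian_apply {u : Plane → Plane} (hu : Continuous u) (i j : Fin 2) :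
    Measurable fun x => jacobian u x i j :=
  measurable_lineDeriv (f := fun y => u y i) (by fun_prop)

theorem stronglyMeasurable_jacobian {u : Plane → Plane} (hu : Continuous u) :
    StronglyMeasurable (jacobian u) := by
  have hentries : StronglyMeasurable fun x => (fun i j => jacobian u x i j : Fin 2 → Fin 2 → ℝ) :=
    (measurable_pi_lambda _ fun i => measurable_pi_lambda _ fun j =>
      measurable_jacobian_apply hu i j).stronglyMeasurable
  have hof : Continuous fun f : Fin 2 → Fin 2 → ℝ => (Matrix.of f : Mat) := continuous_id
  exact hof.comp_stronglyMeasurable hentries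

theorem abs_apply_le_norm (A : Mat) (i j : Fin 2) : |A i j| ≤ ‖A‖ :=
  (PiLp.norm_apply_le (row A i) j).trans (norm_row_le A i)

theorem lipschitzWith_affineMap (A : Mat) (b : Plane) :
    ∃ L : ℝ≥0, LipschitzWith L (affineMap A b) :=
  ⟨_, ((Matrix.toEuclideanLin A).toContinuousLinearMap.lipschitz).add (LipschitzWith.const b)⟩

end Jacobian

section Staircase

theorem exists_seq_of_forall_exists {X : Type*} {I : ℕ → X → Prop} {R : ℕ → X → X → Prop} {x₀ : X}
    (h₀ : I 0 x₀) (h : ∀ n x, I n x → ∃ y, I (n + 1) y ∧ R n x y) :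
    ∃ f : ℕ → X, f 0 = x₀ ∧ ∀ n, R n (f n) (f (n + 1)) := by
  choose! g hI hR using h
  let f : ℕ → X := fun n => Nat.rec x₀ g n
  have hf : ∀ n, I n (f n) := Nat.rec h₀ fun n => hI n _
  exact ⟨f, rfl, fun n => hR n _ (hf n)⟩

/-- A staircase: starting from an affine map on `Ω`, the `n`-th step refines the pieces of `P n`
into pieces `Q n`, on which all later maps agree and have gradient in `T n`, and pieces `P (n + 1)`,
with gradient in `S (n + 1)`, which keep the fraction `κ n` of the area. -/
structure IsStaircase (Ω : Set Plane) (A : Mat) (b : Plane) (κ : ℕ → ℝ) (L : ℕ → ℝ≥0)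
    (S T : ℕ → Set Mat) (η : ℕ → ℝ) (u : ℕ → Plane → Plane) (P Q : ℕ → Set (Set Plane)) :
    Prop where
  regular : IsRegularDomain Ω
  mem_zero : A ∈ S 0
  map_zero : u 0 = affineMap A b
  active_zero : P 0 = {Ω}
  step : ∀ n, IsRefinement (κ n) (4 * L n) (T n) (S (n + 1)) (η n) (u n) (u (n + 1)) (⋃₀ P n) (Q n)
    (P (n + 1))
  summable : Summable η

theorem exists_isStaircase {Ω : Set Plane} (hΩ : IsRegularDomain Ω) {A : Mat} (b : Plane)
    {κ : ℕ → ℝ} {L : ℕ → ℝ≥0} {S T : ℕ → Set Mat} (hA : A ∈ S 0)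
    (h : ∀ n, StepRule (κ n) (L n) (S n) (T n) (S (n + 1))) {η : ℕ → ℝ} (hη : ∀ n, 0 < η n)
    (hsum : Summable η) : ∃ u P Q, IsStaircase Ω A b κ L S T η u P Q := by
  have hinit : AffineOnPieces (affineMap A b) {Ω} (S 0) := by
    rintro V rfl
    exact ⟨A, hA, b, fun x _ => rfl⟩
  obtain ⟨f, hf₀, hf⟩ := exists_seq_of_forall_exists (X := (Plane → Plane) × Set (Set Plane))
    (I := fun n x => IsPieceFamily x.2 ∧ AffineOnPieces x.1 x.2 (S n))
    (R := fun n x y => ∃ Q, IsRefinement (κ n) (4 * L n) (T n) (S (n + 1)) (η n) x.1 y.1 (⋃₀ x.2) Q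
      y.2)
    (x₀ := (affineMap A b, {Ω})) ⟨.singleton hΩ, hinit⟩ fun n x hx => by
      obtain ⟨u', Q, P', hQ⟩ := (h n).exists_isRefinement hx.1 hx.2 (hη n)
      exact ⟨(u', P'), ⟨hQ.active, hQ.affine_active⟩, Q, hQ⟩
  choose Q hQ using hf
  exact ⟨fun n => (f n).1, fun n => (f n).2, Q, hΩ, hA, by rw [hf₀], by rw [hf₀], hQ, hsum⟩

namespace IsStaircase

variable {Ω : Set Plane} {A : Mat} {b : Plane} {κ : ℕ → ℝ} {L : ℕ → ℝ≥0}
  {S T : ℕ → Set Mat} {η : ℕ → ℝ} {u : ℕ → Plane → Plane} {P Q : ℕ → Set (Set Plane)}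

theorem isPieceFamily (h : IsStaircase Ω A b κ L S T η u P Q) (n : ℕ) : IsPieceFamily (P n) := by
  cases n with
  | zero => exact h.active_zero ▸ .singleton h.regular
  | succ n => exact (h.step n).active

theorem affineOnPieces (h : IsStaircase Ω A b κ L S T η u P Q) (n : ℕ) :
    AffineOnPieces (u n) (P n) (S n) := by
  cases n with
  | zero =>
    rw [h.active_zero, h.map_zero]
    rintro V rfl
    exact ⟨A, h.mem_zero, b, fun x _ => rfl⟩
  | succ n => exact (h.step n).affine_active

theorem antitone (h : IsStaircase Ω A b κ L S T η u P Q) : Antitone fun n => ⋃₀ P n :=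
  antitone_nat_of_succ_le fun n => (h.step n).active_subset

theorem sUnion_zero (h : IsStaircase Ω A b κ L S T η u P Q) : ⋃₀ P 0 = Ω := by
  rw [h.active_zero, sUnion_singleton]

theorem active_subset (h : IsStaircase Ω A b κ L S T η u P Q) (n : ℕ) : ⋃₀ P n ⊆ Ω :=
  h.sUnion_zero ▸ h.antitone (Nat.zero_le n)

theorem done_subset (h : IsStaircase Ω A b κ L S T η u P Q) (n : ℕ) : ⋃₀ Q n ⊆ Ω :=
  (h.step n).done_subset.trans (h.active_subset n)

theorem volume_ne_top (h : IsStaircase Ω A b κ L S T η u P Q) : volume Ω ≠ ⊤ :=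
  h.regular.isBounded.measure_lt_top.ne

theorem notMem_active (h : IsStaircase Ω A b κ L S T η u P Q) {n m : ℕ} (hnm : n < m) {x : Plane}
    (hx : x ∈ ⋃₀ Q n) : x ∉ ⋃₀ P m := fun hm =>
  disjoint_left.1 (h.step n).disjoint hx (h.antitone hnm hm)

theorem disjoint_done (h : IsStaircase Ω A b κ L S T η u P Q) :
    Pairwise fun n m => Disjoint (⋃₀ Q n) (⋃₀ Q m) := by
  have disjoint_of_lt (n m : ℕ) (hnm : n < m) : Disjoint (⋃₀ Q n) (⋃₀ Q m) :=
    disjoint_left.2 fun x hx hm => h.notMem_active hnm hx ((h.step m).done_subset hm)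
  intro n m hnm
  rcases hnm.lt_or_gt with hlt | hlt
  exacts [disjoint_of_lt n m hlt, (disjoint_of_lt m n hlt).symm]

theorem isPieceFamily_iUnion_done (h : IsStaircase Ω A b κ L S T η u P Q) :
    IsPieceFamily (⋃ n, Q n) :=
  .iUnion (fun n => (h.step n).done) h.disjoint_done

theorem volume_active (h : IsStaircase Ω A b κ L S T η u P Q) (hκ : ∀ n, 0 ≤ κ n) (n : ℕ) :
    volume (⋃₀ P n) = ENNReal.ofReal (∏ i ∈ Finset.range n, κ i) * volume Ω := by
  induction n with
  | zero => simp [h.sUnion_zero]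
  | succ n ih =>
    rw [(h.step n).volume_active, ih, Finset.prod_range_succ, mul_comm _ (κ n),
      ENNReal.ofReal_mul (hκ n), mul_assoc]

theorem volume_done (h : IsStaircase Ω A b κ L S T η u P Q) (hκ : ∀ n, 0 ≤ κ n) (n : ℕ) :
    volume (⋃₀ Q n) = ENNReal.ofReal ((∏ i ∈ Finset.range n, κ i) * (1 - κ n)) * volume Ω := by
  rw [(h.step n).volume_done (hκ n) (measure_ne_top_of_subset (h.active_subset n) h.volume_ne_top),
    h.volume_active hκ, ENNReal.ofReal_mul (Finset.prod_nonneg fun i _ => hκ i), ← mul_assoc,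
    mul_comm (ENNReal.ofReal (1 - κ n))]

theorem volume_iInter_active (h : IsStaircase Ω A b κ L S T η u P Q) (hκ : ∀ n, 0 ≤ κ n)
    (hlim : Tendsto (fun n => ∏ i ∈ Finset.range n, κ i) atTop (𝓝 0)) :
    volume (⋂ n, ⋃₀ P n) = 0 := by
  have hvol : Tendsto (fun n => volume (⋃₀ P n)) atTop (𝓝 0) := by
    simp only [h.volume_active hκ]
    simpa using ENNReal.Tendsto.mul_const (ENNReal.tendsto_ofReal hlim) (.inr h.volume_ne_top)
  exact le_antisymm (ge_of_tendsto' hvol fun n => measure_mono (iInter_subset _ n)) zero_le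

theorem ae_exists_mem_done (h : IsStaircase Ω A b κ L S T η u P Q) (hκ : ∀ n, 0 ≤ κ n)
    (hlim : Tendsto (fun n => ∏ i ∈ Finset.range n, κ i) atTop (𝓝 0)) :
    ∀ᵐ x ∂volume.restrict Ω, ∃ n, x ∈ ⋃₀ Q n := by
  have hlost : ∀ᵐ x, ∀ n, x ∉ ⋃₀ P n \ (⋃₀ Q n ∪ ⋃₀ P (n + 1)) :=
    ae_all_iff.2 fun n => measure_eq_zero_iff_ae_notMem.1 (h.step n).volume_diff
  have hforever : ∀ᵐ x, x ∉ ⋂ n, ⋃₀ P n :=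
    measure_eq_zero_iff_ae_notMem.1 (h.volume_iInter_active hκ hlim)
  rw [ae_restrict_iff' h.regular.isOpen.measurableSet]
  filter_upwards [hlost, hforever] with x hx hx' hxΩ
  by_contra! hdone
  refine hx' (mem_iInter.2 fun n => ?_)
  induction n with
  | zero => rwa [h.sUnion_zero]
  | succ n ih =>
    by_contra hn
    exact hx n ⟨ih, not_or.2 ⟨hdone n, hn⟩⟩

theorem eq_of_mem_done (h : IsStaircase Ω A b κ L S T η u P Q) {n m : ℕ} (hnm : n < m) {x : Plane}
    (hx : x ∈ ⋃₀ Q n) : u m x = u (n + 1) x := by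
  induction m, hnm using Nat.le_induction with
  | base => rfl
  | succ m hm ih => rw [(h.step m).eq_of_notMem x (h.notMem_active hm hx), ih]

theorem eq_of_notMem (h : IsStaircase Ω A b κ L S T η u P Q) {x : Plane} (hx : x ∉ Ω) (n : ℕ) :
    u n x = affineMap A b x := by
  induction n with
  | zero => rw [h.map_zero]
  | succ n ih => rw [(h.step n).eq_of_notMem x fun hn => hx (h.active_subset n hn), ih]

theorem exists_lipschitzWith (h : IsStaircase Ω A b κ L S T η u P Q) (n : ℕ) :
    ∃ C : ℝ≥0, LipschitzWith C (u n) := by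
  induction n with
  | zero => exact h.map_zero ▸ lipschitzWith_affineMap A b
  | succ n ih =>
    obtain ⟨C, hC⟩ := ih
    exact ⟨_, by simpa using hC.add (h.step n).lipschitz⟩

theorem continuous (h : IsStaircase Ω A b κ L S T η u P Q) (n : ℕ) : Continuous (u n) :=
  (h.exists_lipschitzWith n).choose_spec.continuous

theorem summable_sub (h : IsStaircase Ω A b κ L S T η u P Q) (x : Plane) :
    Summable fun n => u (n + 1) x - u n x :=
  h.summable.of_norm_bounded fun n => (h.step n).norm_sub_le x

protected theorem tendsto_limitMap (h : IsStaircase Ω A b κ L S T η u P Q) (x : Plane) :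
    Tendsto (fun n => u n x) atTop (𝓝 (limitMap u x)) :=
  tendsto_limitMap (h.summable_sub x)

protected theorem continuous_limitMap (h : IsStaircase Ω A b κ L S T η u P Q) :
    Continuous (limitMap u) :=
  continuous_limitMap h.summable (fun n => (h.step n).norm_sub_le) h.continuous

theorem limitMap_eq_of_mem_done (h : IsStaircase Ω A b κ L S T η u P Q) {n m : ℕ} (hnm : n < m)
    {x : Plane} (hx : x ∈ ⋃₀ Q n) : limitMap u x = u m x := by
  refine tendsto_nhds_unique (h.tendsto_limitMap x) (tendsto_const_nhds.congr' ?_)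
  filter_upwards [eventually_gt_atTop n] with k hk
  rw [h.eq_of_mem_done hnm hx, h.eq_of_mem_done hk hx]

theorem limitMap_eq_of_notMem (h : IsStaircase Ω A b κ L S T η u P Q) {x : Plane} (hx : x ∉ Ω) :
    limitMap u x = affineMap A b x :=
  tendsto_nhds_unique (h.tendsto_limitMap x)
    (tendsto_const_nhds.congr fun n => (h.eq_of_notMem hx n).symm)

theorem jacobian_mem_of_mem_active (h : IsStaircase Ω A b κ L S T η u P Q) {n : ℕ} {x : Plane}
    (hx : x ∈ ⋃₀ P n) : jacobian (u n) x ∈ S n :=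
  (h.affineOnPieces n).jacobian_mem (h.isPieceFamily n) (fun _ _ => rfl) hx

theorem jacobian_limitMap_mem_of_mem_done (h : IsStaircase Ω A b κ L S T η u P Q) {n : ℕ}
    {x : Plane} (hx : x ∈ ⋃₀ Q n) : jacobian (limitMap u) x ∈ T n :=
  (h.step n).affine_done.jacobian_mem (h.step n).done
    (fun _ hy => h.limitMap_eq_of_mem_done n.lt_succ_self hy) hx

theorem jacobian_limitMap_eq_of_mem_done (h : IsStaircase Ω A b κ L S T η u P Q) {n m : ℕ}
    (hnm : n < m) {x : Plane} (hx : x ∈ ⋃₀ Q n) : jacobian (limitMap u) x = jacobian (u m) x :=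
  jacobian_congr_of_isOpen (h.step n).done.isOpen_sUnion
    (fun _ hy => h.limitMap_eq_of_mem_done hnm hy) hx

theorem isPiecewiseAffine_limitMap (h : IsStaircase Ω A b κ L S T η u P Q)
    (hdone : ∀ᵐ x ∂volume.restrict Ω, ∃ n, x ∈ ⋃₀ Q n) : IsPiecewiseAffine Ω (limitMap u) := by
  have hF := h.isPieceFamily_iUnion_done
  have hnull : volume (Ω \ ⋃₀ ⋃ n, Q n) = 0 := by
    rw [ae_restrict_iff' h.regular.isOpen.measurableSet] at hdone
    refine measure_eq_zero_iff_ae_notMem.2 (hdone.mono fun x hx hx' => hx'.2 ?_)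
    rw [sUnion_iUnion]
    exact mem_iUnion.2 (hx hx'.1)
  refine ⟨⋃ n, Q n, hF.countable, hF.disjoint, fun V hV => ⟨hF.regular V hV, ?_⟩, hnull,
    fun V hV => ?_⟩
  · obtain ⟨n, hn⟩ := mem_iUnion.1 hV
    exact (subset_sUnion_of_mem hn).trans (h.done_subset n)
  · obtain ⟨n, hn⟩ := mem_iUnion.1 hV
    obtain ⟨A, -, b, hb⟩ := (h.step n).affine_done V hn
    exact ⟨A, b, fun x hx => by
      rw [h.limitMap_eq_of_mem_done n.lt_succ_self ⟨V, hn, hx⟩, hb x hx]⟩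

/-- The sum of the gradient bounds `N n` over the levels `n` reached by a point; it dominates the
gradients of all maps of a staircase at once. -/
noncomputable def majorant (P : ℕ → Set (Set Plane)) (N : ℕ → ℝ≥0) (x : Plane) : ℝ≥0∞ :=
  ∑' n, (⋃₀ P n).indicator (fun _ => (N n : ℝ≥0∞)) x

theorem le_majorant {N : ℕ → ℝ≥0} {n : ℕ} {x : Plane} (hx : x ∈ ⋃₀ P n) :
    (N n : ℝ≥0∞) ≤ majorant P N x := by
  rw [← indicator_of_mem hx fun _ => (N n : ℝ≥0∞)]
  exact ENNReal.le_tsum n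

theorem measurable_majorant (h : IsStaircase Ω A b κ L S T η u P Q) (N : ℕ → ℝ≥0) :
    Measurable (majorant P N) :=
  .tsum fun n => measurable_const.indicator (h.isPieceFamily n).measurableSet_sUnion

theorem lintegral_majorant (h : IsStaircase Ω A b κ L S T η u P Q) (N : ℕ → ℝ≥0) :
    ∫⁻ x, majorant P N x = ∑' n, N n * volume (⋃₀ P n) := by
  have hmeas n := (h.isPieceFamily n).measurableSet_sUnion
  unfold majorant
  rw [lintegral_tsum fun n => (measurable_const.indicator (hmeas n)).aemeasurable]
  exact tsum_congr fun n => by rw [lintegral_indicator (hmeas n), setLIntegral_const]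

theorem enorm_jacobian_limitMap_le (h : IsStaircase Ω A b κ L S T η u P Q) {N : ℕ → ℝ≥0}
    (hT : ∀ n, ∀ C ∈ T n, ‖C‖₊ ≤ N n) {n : ℕ} {x : Plane} (hx : x ∈ ⋃₀ Q n) :
    ‖jacobian (limitMap u) x‖ₑ ≤ N n :=
  ENNReal.coe_le_coe.2 (hT n _ (h.jacobian_limitMap_mem_of_mem_done hx))

theorem enorm_jacobian_le_majorant (h : IsStaircase Ω A b κ L S T η u P Q) {N : ℕ → ℝ≥0}
    (hS : ∀ n, ∀ C ∈ S n, ‖C‖₊ ≤ N n) (hT : ∀ n, ∀ C ∈ T n, ‖C‖₊ ≤ N n) {n : ℕ} {x : Plane}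
    (hx : x ∈ ⋃₀ Q n) (m : ℕ) : ‖jacobian (u m) x‖ₑ ≤ majorant P N x := by
  have hxP := (h.step n).done_subset hx
  rcases lt_or_ge n m with hnm | hnm
  · rw [← h.jacobian_limitMap_eq_of_mem_done hnm hx]
    exact (h.enorm_jacobian_limitMap_le hT hx).trans (le_majorant hxP)
  · have hxP' := h.antitone hnm hxP
    exact (ENNReal.coe_le_coe.2 (hS m _ (h.jacobian_mem_of_mem_active hxP'))).trans
      (le_majorant hxP')

theorem memLp_jacobian_limitMap (h : IsStaircase Ω A b κ L S T η u P Q) {N : ℕ → ℝ≥0}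
    (hT : ∀ n, ∀ C ∈ T n, ‖C‖₊ ≤ N n) (hdone : ∀ᵐ x ∂volume.restrict Ω, ∃ n, x ∈ ⋃₀ Q n)
    {q : ℝ} (hq : 0 < q) (hfin : ∑' n, (N n : ℝ≥0∞) ^ q * volume (⋃₀ P n) ≠ ⊤) :
    MemLp (jacobian (limitMap u)) (ENNReal.ofReal q) (volume.restrict Ω) := by
  refine ⟨(stronglyMeasurable_jacobian h.continuous_limitMap).aestronglyMeasurable, ?_⟩
  rw [eLpNorm_lt_top_iff_lintegral_rpow_enorm_lt_top (by simpa using hq) ENNReal.ofReal_ne_top,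
    ENNReal.toReal_ofReal hq.le]
  calc ∫⁻ x in Ω, ‖jacobian (limitMap u) x‖ₑ ^ q
      ≤ ∫⁻ x in Ω, majorant P (fun n => N n ^ q) x := by
        refine lintegral_mono_ae (hdone.mono fun x ⟨n, hn⟩ => ?_)
        refine le_trans ?_ (le_majorant ((h.step n).done_subset hn))
        rw [ENNReal.coe_rpow_of_nonneg _ hq.le]
        exact ENNReal.rpow_le_rpow (h.enorm_jacobian_limitMap_le hT hn) hq.le
    _ ≤ ∫⁻ x, majorant P (fun n => N n ^ q) x := setLIntegral_le_lintegral _ _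
    _ = ∑' n, (N n : ℝ≥0∞) ^ q * volume (⋃₀ P n) := by
        simp only [h.lintegral_majorant, ENNReal.coe_rpow_of_nonneg _ hq.le]
    _ < ⊤ := hfin.lt_top

theorem isWeakGradient_limitMap (h : IsStaircase Ω A b κ L S T η u P Q) {N : ℕ → ℝ≥0}
    (hS : ∀ n, ∀ C ∈ S n, ‖C‖₊ ≤ N n) (hT : ∀ n, ∀ C ∈ T n, ‖C‖₊ ≤ N n)
    (hdone : ∀ᵐ x ∂volume.restrict Ω, ∃ n, x ∈ ⋃₀ Q n)
    (hfin : ∑' n, (N n : ℝ≥0∞) * volume (⋃₀ P n) ≠ ⊤) :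
    IsWeakGradient Ω (limitMap u) (jacobian (limitMap u)) := by
  intro i j
  have hcont : Continuous (affineMap A b) := h.map_zero ▸ h.continuous 0
  have hmaj : ∫⁻ x in Ω, majorant P N x ≠ ⊤ :=
    ne_top_of_le_ne_top (h.lintegral_majorant N ▸ hfin) (setLIntegral_le_lintegral _ _)
  refine HasWeakPartial.of_tendsto_of_dominated (f := fun n x => u n x i)
    (g := fun n x => jacobian (u n) x i j) (F := fun x => ‖affineMap A b x‖ + ∑' n, η n)
    (G := fun x => (majorant P N x).toReal) (fun n => ?_) ?_
    (integrable_toReal_of_lintegral_ne_top (h.measurable_majorant N).aemeasurable hmaj)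
    (fun n => .of_forall fun x => ?_) (fun n => ?_)
    (.of_forall fun x => ?_) (hdone.mono fun x ⟨n, hn⟩ => ?_)
  · obtain ⟨C, hC⟩ := h.exists_lipschitzWith n
    have hCi : LipschitzWith C fun x => u n x i := .of_dist_le_mul fun x y =>
      ((dist_eq_norm _ _).trans_le (PiLp.norm_apply_le (u n x - u n y) i)).trans
        ((dist_eq_norm _ _).symm.trans_le (hC.dist_le_mul x y))
    exact hasWeakPartial_of_lipschitzWith Ω hCi j
  · exact ((hcont.norm.add continuous_const).continuousOn.integrableOn_compact
      h.regular.isBounded.isCompact_closure).mono_set subset_closure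
  · have hclose := norm_sub_zero_le h.summable (fun n => (h.step n).norm_sub_le) n x
    rw [h.map_zero] at hclose
    exact (PiLp.norm_apply_le (u n x) i).trans
      ((norm_le_norm_add_norm_sub' _ _).trans (by gcongr))
  · filter_upwards [hdone, ae_lt_top (h.measurable_majorant N) hmaj] with x ⟨k, hk⟩ hx
    refine (abs_apply_le_norm _ i j).trans ?_
    rw [← toReal_enorm]
    exact ENNReal.toReal_mono hx.ne (h.enorm_jacobian_le_majorant hS hT hk n)
  · exact ((EuclideanSpace.proj (𝕜 := ℝ) i).continuous.tendsto _).comp (h.tendsto_limitMap x)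
  · refine tendsto_const_nhds.congr' ?_
    filter_upwards [eventually_gt_atTop n] with m hm
    rw [h.jacobian_limitMap_eq_of_mem_done hm hn]

end IsStaircase

theorem exists_isStaircase_holderWith {Ω : Set Plane} (hΩ : IsRegularDomain Ω) {A : Mat} (b : Plane)
    {κ : ℕ → ℝ} {L : ℕ → ℝ≥0} {S T : ℕ → Set Mat} (hA : A ∈ S 0)
    (h : ∀ n, StepRule (κ n) (L n) (S n) (T n) (S (n + 1))) {α : ℝ≥0} (hα : α < 1) {δ : ℝ≥0}
    (hδ : 0 < δ) :
    ∃ η u P Q, IsStaircase Ω A b κ L S T η u P Q ∧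
      (∀ x, ‖limitMap u x - affineMap A b x‖ ≤ δ) ∧
      HolderWith δ α fun x => limitMap u x - affineMap A b x := by
  have hθ : HasSum (fun n : ℕ => δ / 2 / 2 ^ n) δ := by
    refine NNReal.hasSum_coe.1 ?_
    push_cast
    exact hasSum_geometric_two' (δ : ℝ)
  have hθ₀ (n : ℕ) : 0 < δ / 2 / 2 ^ n := by positivity
  choose ε hε₀ hεθ hε using fun n =>
    exists_pos_forall_holderWith (X := Plane) (E := Plane) (4 * L n) hα (hθ₀ n)
  have hsum : Summable ε := NNReal.summable_of_le hεθ hθ.summable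
  obtain ⟨u, P, Q, hu⟩ := exists_isStaircase hΩ b hA h (fun n => NNReal.coe_pos.2 (hε₀ n))
    (NNReal.summable_coe.2 hsum)
  refine ⟨_, u, P, Q, hu, fun x => ?_, ?_⟩
  · have hclose := norm_limitMap_sub_zero_le hu.summable (fun n => (hu.step n).norm_sub_le) x
    rw [hu.map_zero, ← NNReal.coe_tsum] at hclose
    refine hclose.trans (NNReal.coe_le_coe.2 ?_)
    rw [← hθ.tsum_eq]
    exact hsum.tsum_le_tsum hεθ hθ.summable
  · simp only [limitMap, hu.map_zero, add_sub_cancel_left]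
    exact holderWith_tsum hu.summable_sub hθ fun n =>
      hε n _ (hu.step n).lipschitz ((hu.step n).norm_sub_le)

end Staircase

/-! ### Splittings, rotated fluxes and Hölder norms -/

section Rotation

/-- The rotation of the plane by a right angle. -/
noncomputable def rot (z : Plane) : Plane := !₂[-z 1, z 0]

@[simp] theorem rot_apply_zero (z : Plane) : rot z 0 = -z 1 := rfl

@[simp] theorem rot_apply_one (z : Plane) : rot z 1 = z 0 := rfl

theorem rot_rot (z : Plane) : rot (rot z) = -z := by
  ext j
  fin_cases j <;> simp

theorem rot_smul (r : ℝ) (z : Plane) : rot (r • z) = r • rot z := by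
  ext j
  fin_cases j <;> simp

theorem neg_rot_eq_sub (z : Plane) :
    -rot z = z 1 • EuclideanSpace.single 0 (1 : ℝ) - z 0 • EuclideanSpace.single 1 (1 : ℝ) := by
  ext j
  fin_cases j <;> simp

theorem norm_rot (z : Plane) : ‖rot z‖ = ‖z‖ := by
  simp only [EuclideanSpace.norm_eq, Fin.sum_univ_two, rot_apply_zero, rot_apply_one, norm_neg,
    add_comm]

theorem inner_rot_self (z : Plane) : ⟪rot z, z⟫ = 0 := by
  simp only [PiLp.inner_apply, Fin.sum_univ_two, rot_apply_zero, rot_apply_one,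
    RCLike.inner_apply, conj_trivial]
  ring

theorem inner_sq_add_inner_rot_sq (z y : Plane) :
    ⟪z, y⟫ ^ 2 + ⟪rot z, y⟫ ^ 2 = ‖z‖ ^ 2 * ‖y‖ ^ 2 := by
  simp only [EuclideanSpace.norm_sq_eq, PiLp.inner_apply, Fin.sum_univ_two, rot_apply_zero,
    rot_apply_one, RCLike.inner_apply, conj_trivial, Real.norm_eq_abs, sq_abs]
  ring

end Rotation

section ThreeVectors

theorem surrounds_of_rot {z : Plane} (hz : z ≠ 0) {γ s t : ℝ} (hγ : 0 < γ) (hs : 0 < s)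
    (ht : 0 < t) : Surrounds ![-z, γ • z + s • rot z, γ • z + t • -rot z] := by
  intro y hy
  by_contra! h
  have h₀ : 0 ≤ -⟪z, y⟫ := by simpa using h 0
  have h₁ : 0 ≤ γ * ⟪z, y⟫ + s * ⟪rot z, y⟫ := by
    simpa [inner_add_left, real_inner_smul_left] using h 1
  have h₂ : 0 ≤ γ * ⟪z, y⟫ + t * -⟪rot z, y⟫ := by
    simpa [inner_add_left, real_inner_smul_left] using h 2
  have inner_eq : ⟪z, y⟫ = 0 := by
    have hsum : 0 ≤ (s + t) * γ * ⟪z, y⟫ := by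
      linarith [mul_nonneg ht.le h₁, mul_nonneg hs.le h₂]
    exact le_antisymm (by linarith) (nonneg_of_mul_nonneg_right hsum (by positivity))
  have inner_rot_eq : ⟪rot z, y⟫ = 0 := by
    rw [inner_eq, mul_zero, zero_add] at h₁ h₂
    exact le_antisymm (neg_nonneg.1 (nonneg_of_mul_nonneg_right h₂ ht))
      (nonneg_of_mul_nonneg_right h₁ hs)
  have hzy := inner_sq_add_inner_rot_sq z y
  rw [inner_eq, inner_rot_eq] at hzy
  have : 0 < ‖z‖ ^ 2 * ‖y‖ ^ 2 := by positivity
  linarith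

theorem isSplitting_of_rot {z : Plane} (hz : z ≠ 0) {β s t : ℝ} (hβ₀ : 0 < β) (hβ₁ : β < 1)
    (hs : 0 < s) (ht : 0 < t) {ξ : Fin 3 → Plane}
    (hξ : ξ = ![-z, ((1 - β) / β) • z + s • rot z, ((1 - β) / β) • z + t • -rot z])
    {L : ℝ≥0} (hL : ∀ j, ‖ξ j‖ ≤ L) : IsSplitting β L ξ 0 ((β / ‖z‖ ^ 2) • z) := by
  have hz2 : 0 < ‖z‖ ^ 2 := by positivity
  have inner_zero : ⟪-z, (β / ‖z‖ ^ 2) • z⟫ = -β := by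
    rw [inner_neg_left, inner_smul_right, real_inner_self_eq_norm_sq, div_mul_cancel₀ _ hz2.ne']
  have inner_rot (r : ℝ) :
      ⟪((1 - β) / β) • z + r • rot z, (β / ‖z‖ ^ 2) • z⟫ = 1 - β := by
    rw [inner_smul_right, inner_add_left, real_inner_smul_left, real_inner_smul_left,
      inner_rot_self, real_inner_self_eq_norm_sq]
    field_simp
    ring
  have hrot : rot z ≠ 0 := by rwa [← norm_ne_zero_iff, norm_rot, norm_ne_zero_iff]
  simp only [smul_neg, ← neg_smul] at hξ
  have ne_zero (r : ℝ) : -z ≠ ((1 - β) / β) • z + r • rot z := fun h => by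
    have := inner_rot r
    rw [← h, inner_zero] at this
    linarith
  have ne_of_pos : ((1 - β) / β) • z + s • rot z ≠ ((1 - β) / β) • z + -t • rot z := fun h => by
    linarith [smul_left_injective ℝ hrot (add_left_cancel h)]
  refine ⟨?_, ?_, hL, ?_, ?_⟩
  · rw [hξ]
    simpa only [smul_neg, neg_smul] using
      surrounds_of_rot hz (div_pos (sub_pos.2 hβ₁) hβ₀) hs ht
  · rw [hξ]
    intro j k hjk
    fin_cases j <;> fin_cases k <;> first | rfl | skip
    exacts [absurd hjk (ne_zero _), absurd hjk (ne_zero _), absurd hjk.symm (ne_zero _),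
      absurd hjk ne_of_pos, absurd hjk.symm (ne_zero _), absurd hjk.symm ne_of_pos]
  · rw [hξ]
    exact inner_zero
  · rw [hξ]
    intro j hj
    fin_cases j
    exacts [absurd rfl hj, inner_rot s, inner_rot (-t)]

theorem exists_pos_norm_add_smul_eq {E : Type*} [NormedAddCommGroup E] [NormedSpace ℝ E] {m d : E}
    (hd : d ≠ 0) {X : ℝ} (hm : ‖m‖ < X) : ∃ t : ℝ, 0 < t ∧ ‖m + t • d‖ = X := by
  have hcont : Continuous fun t : ℝ => ‖m + t • d‖ := by fun_prop
  have htop : Tendsto (fun t : ℝ => ‖m + t • d‖) atTop atTop := by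
    refine tendsto_atTop_mono (fun t => ?_) (tendsto_atTop_add_const_right _ (-‖m‖)
      (tendsto_abs_atTop_atTop.atTop_mul_const (norm_pos_iff.2 hd)))
    have := norm_sub_norm_le (t • d) (-m)
    rw [norm_neg, norm_smul, Real.norm_eq_abs, sub_neg_eq_add, add_comm (t • d)] at this
    linarith
  obtain ⟨t, ht, htX⟩ := intermediate_value_Ici hcont.continuousOn htop
    (show X ∈ Ici ‖m + (0 : ℝ) • d‖ by simpa using hm.le)
  refine ⟨t, lt_of_le_of_ne ht ?_, htX⟩
  rintro rfl
  simp only [zero_smul, add_zero] at htX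
  exact hm.ne htX

/-- The finished vector moves the row `z` to `k`; balancing it forces the mean of the other two
vectors to move `z` to `β⁻¹ • (z - (1 - β) • k)`, which must lie in the ball of radius `X`. -/
theorem exists_isSplitting {z k : Plane} {β X : ℝ} (hβ₀ : 0 < β) (hβ₁ : β < 1) (hk : k ≠ z)
    (hX : ‖z‖ + (1 - β) * ‖k‖ < β * X) {L : ℝ≥0} (hkL : ‖k‖ + ‖z‖ ≤ L) (hXL : X + ‖z‖ ≤ L) :
    ∃ (ξ : Fin 3 → Plane) (ν : Plane), IsSplitting β L ξ 0 ν ∧ z + ξ 0 = k ∧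
      ∀ j, j ≠ 0 → ‖z + ξ j‖ = X := by
  have hzk : z - k ≠ 0 := sub_ne_zero.2 hk.symm
  have hrot : rot (z - k) ≠ 0 := by rwa [← norm_ne_zero_iff, norm_rot, norm_ne_zero_iff]
  have hmean : ‖z + ((1 - β) / β) • (z - k)‖ < X := by
    have : z + ((1 - β) / β) • (z - k) = β⁻¹ • (z - (1 - β) • k) := by
      match_scalars <;> field_simp
      ring
    rw [this, norm_smul, norm_inv, Real.norm_of_nonneg hβ₀.le, inv_mul_lt_iff₀ hβ₀]
    refine lt_of_le_of_lt ((norm_sub_le _ _).trans_eq ?_) hX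
    rw [norm_smul, Real.norm_of_nonneg (sub_nonneg.2 hβ₁.le)]
  obtain ⟨s, hs, hsX⟩ := exists_pos_norm_add_smul_eq hrot hmean
  obtain ⟨t, ht, htX⟩ := exists_pos_norm_add_smul_eq (neg_ne_zero.2 hrot) hmean
  rw [add_assoc] at hsX htX
  have norm_le {ξ : Plane} (h : ‖z + ξ‖ + ‖z‖ ≤ L) : ‖ξ‖ ≤ L := by
    have := norm_sub_le (z + ξ) z
    rw [add_sub_cancel_left] at this
    exact this.trans h
  have hzero : z + -(z - k) = k := by abel
  refine ⟨_, _, isSplitting_of_rot hzk hβ₀ hβ₁ hs ht rfl fun j => norm_le ?_, hzero, fun j hj => ?_⟩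
  · fin_cases j
    exacts [(congrArg (‖·‖ + ‖z‖) hzero).trans_le hkL, (congrArg (· + ‖z‖) hsX).trans_le hXL,
      (congrArg (· + ‖z‖) htX).trans_le hXL]
  · fin_cases j
    exacts [absurd rfl hj, hsX, htX]

theorem splits_of_row {C : Mat} {i : Fin 2} {k : Plane} {β X : ℝ} {S T : Set Mat} {L : ℝ≥0}
    (hβ₀ : 0 < β) (hβ₁ : β < 1) (hk : k ≠ row C i) (hX : ‖row C i‖ + (1 - β) * ‖k‖ < β * X)
    (hT : setRow C i k ∈ T) (hS : ∀ z, ‖z‖ = X → setRow C i z ∈ S)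
    (hkL : ‖k‖ + ‖row C i‖ ≤ L) (hXL : X + ‖row C i‖ ≤ L) : Splits β L C T S := by
  obtain ⟨ξ, ν, hξ, hξ₀, hξX⟩ := exists_isSplitting hβ₀ hβ₁ hk hX hkL hXL
  exact ⟨i, ξ, ν, hξ, hξ₀.symm ▸ hT, fun j hj => hS _ (hξX j hj)⟩

end ThreeVectors

section RotatedFlux

variable {p : ℝ}

theorem rpow_sub_two_mul_self {x : ℝ} (hp : 1 < p) (hx : 0 ≤ x) :
    x ^ (p - 2) * x = x ^ (p - 1) := by
  rw [show p - 1 = p - 2 + 1 by ring, Real.rpow_add_one' hx (by linarith)]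

theorem mem_specialOrthogonalGroup_iff_row {R : Mat} :
    R ∈ Matrix.specialOrthogonalGroup (Fin 2) ℝ ↔ ‖row R 0‖ = 1 ∧ row R 1 = rot (row R 0) := by
  have hnorm : ‖row R 0‖ = 1 ↔ R 0 0 ^ 2 + R 0 1 ^ 2 = 1 := by
    rw [← sq_eq_sq₀ (norm_nonneg _) zero_le_one, EuclideanSpace.norm_sq_eq]
    simp
  rw [Matrix.mem_specialOrthogonalGroup_fin_two_iff, hnorm]
  constructor
  · rintro ⟨h₀, h₁, h⟩
    refine ⟨h, ?_⟩
    ext j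
    fin_cases j
    exacts [(neg_eq_iff_eq_neg.2 h₁).symm, h₀.symm]
  · rintro ⟨h, hrot⟩
    have h₀ : R 1 0 = -R 0 1 := congrArg (· 0) hrot
    have h₁ : R 1 1 = R 0 0 := congrArg (· 1) hrot
    exact ⟨h₁.symm, by rw [h₀, neg_neg], h⟩

theorem eq_diag_mul_iff_row {a b : ℝ} {C R : Mat} :
    C = !![a, 0; 0, b] * R ↔ row C 0 = a • row R 0 ∧ row C 1 = b • row R 1 := by
  simp [← Matrix.ext_iff, PiLp.ext_iff, Fin.forall_fin_two, Matrix.vecMul_eq_sum]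

theorem exists_norm_eq_one_and_eq_norm_smul {E : Type*} [NormedAddCommGroup E] [NormedSpace ℝ E]
    [Nontrivial E] (z : E) : ∃ e : E, ‖e‖ = 1 ∧ z = ‖z‖ • e := by
  rcases eq_or_ne z 0 with rfl | hz
  · obtain ⟨e, he⟩ := exists_norm_eq E zero_le_one
    exact ⟨e, he, by rw [norm_zero, zero_smul]⟩
  · exact ⟨‖z‖⁻¹ • z, norm_smul_inv_norm hz, (smul_inv_smul₀ (norm_ne_zero_iff.2 hz) z).symm⟩

theorem mem_K_iff (hp : 1 < p) {C : Mat} :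
    C ∈ K p ↔ row C 1 = ‖row C 0‖ ^ (p - 2) • rot (row C 0) := by
  constructor
  · rintro ⟨l, hl, R, hR, hC⟩
    obtain ⟨hR₀, hR₁⟩ := mem_specialOrthogonalGroup_iff_row.1 hR
    obtain ⟨hC₀, hC₁⟩ := eq_diag_mul_iff_row.1 hC
    rw [hC₁, hC₀, hR₁, norm_smul, hR₀, Real.norm_of_nonneg hl, mul_one, rot_smul, smul_smul,
      rpow_sub_two_mul_self hp hl]
  · intro hC
    obtain ⟨e, he, hCe⟩ := exists_norm_eq_one_and_eq_norm_smul (row C 0)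
    refine ⟨‖row C 0‖, norm_nonneg _, !![e 0, e 1; -e 1, e 0],
      mem_specialOrthogonalGroup_iff_row.2 ?_, eq_diag_mul_iff_row.2 ?_⟩
    all_goals
      have row_zero : row !![e 0, e 1; -e 1, e 0] 0 = e := by ext j; fin_cases j <;> rfl
      have row_one : row !![e 0, e 1; -e 1, e 0] 1 = rot e := by ext j; fin_cases j <;> rfl
      rw [row_zero, row_one]
    · exact ⟨he, rfl⟩
    · refine ⟨hCe, ?_⟩
      rw [← rpow_sub_two_mul_self hp (norm_nonneg _), ← smul_smul, ← rot_smul, ← hCe, hC]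

theorem norm_row_one_of_mem_K (hp : 1 < p) {C : Mat} (hC : C ∈ K p) :
    ‖row C 1‖ = ‖row C 0‖ ^ (p - 1) := by
  rw [(mem_K_iff hp).1 hC, norm_smul, norm_rot, Real.norm_of_nonneg (by positivity),
    rpow_sub_two_mul_self hp (norm_nonneg _)]

theorem flux_of_mem_K (hp : 1 < p) {C : Mat} (hC : C ∈ K p) :
    ‖row C 0‖ ^ (p - 2) • row C 0 = -rot (row C 1) := by
  rw [(mem_K_iff hp).1 hC, rot_smul, rot_rot, smul_neg, neg_neg]

theorem exists_setRow_zero_mem_K (hp : 1 < p) {l : ℝ} (hl : 0 < l) {C : Mat}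
    (hC : ‖row C 1‖ = l ^ (p - 1)) : ∃ k : Plane, ‖k‖ = l ∧ setRow C 0 k ∈ K p := by
  have hnorm : ‖-(l ^ (2 - p) • rot (row C 1))‖ = l := by
    rw [norm_neg, norm_smul, norm_rot, hC, Real.norm_of_nonneg (by positivity),
      ← Real.rpow_add hl, show 2 - p + (p - 1) = 1 by ring, Real.rpow_one]
  refine ⟨_, hnorm, (mem_K_iff hp).2 ?_⟩
  rw [row_setRow_self, row_setRow_of_ne _ (by decide), hnorm, ← neg_smul, rot_smul, rot_rot,
    smul_neg, neg_smul, neg_neg, smul_smul, ← Real.rpow_add hl]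
  simp

theorem exists_setRow_one_mem_K (hp : 1 < p) (C : Mat) :
    ∃ k : Plane, ‖k‖ = ‖row C 0‖ ^ (p - 1) ∧ setRow C 1 k ∈ K p := by
  have hK : setRow C 1 (‖row C 0‖ ^ (p - 2) • rot (row C 0)) ∈ K p := by
    rw [mem_K_iff hp, row_setRow_self, row_setRow_of_ne _ (by decide)]
  refine ⟨_, ?_, hK⟩
  simpa only [row_setRow_self, row_setRow_of_ne C (show (0 : Fin 2) ≠ 1 by decide)] using
    norm_row_one_of_mem_K hp hK

end RotatedFlux

section VeryWeakSolution

variable {Ω : Set Plane}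

theorem IsTestFunction.fderiv_apply {φ : Plane → ℝ} (hφ : IsTestFunction Ω φ) (v : Plane) :
    IsTestFunction Ω fun x => fderiv ℝ φ x v where
  contDiff := (hφ.contDiff.fderiv_right (by simp)).clm_apply contDiff_const
  hasCompactSupport := hφ.hasCompactSupport.fderiv_apply (𝕜 := ℝ) v
  tsupport_subset := (tsupport_fderiv_apply_subset ℝ v).trans hφ.tsupport_subset

theorem IsTestFunction.fderiv_fderiv_comm {φ : Plane → ℝ} (hφ : IsTestFunction Ω φ)
    (v w x : Plane) :
    fderiv ℝ (fun y => fderiv ℝ φ y v) x w = fderiv ℝ (fun y => fderiv ℝ φ y w) x v := by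
  have hdiff : DifferentiableAt ℝ (fderiv ℝ φ) x :=
    ((hφ.contDiff.fderiv_right (m := ∞) (by simp)).differentiable (by simp)) x
  have hsymm : IsSymmSndFDerivAt ℝ φ x :=
    hφ.contDiff.contDiffAt.isSymmSndFDerivAt (by simpa using ENat.LEInfty.out)
  rw [fderiv_clm_apply hdiff (differentiableAt_const _),
    fderiv_clm_apply hdiff (differentiableAt_const _)]
  simpa using hsymm w v

/-- A rotated gradient is divergence free, because second derivatives of `φ` commute. -/
theorem integral_fderiv_neg_rot_eq_zero {f : Plane → ℝ} {g : Plane → Plane}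
    (hg : IntegrableOn g Ω) (hfg : ∀ j, HasWeakPartial Ω f j fun x => g x j) {φ : Plane → ℝ}
    (hφ : IsTestFunction Ω φ) : ∫ x in Ω, fderiv ℝ φ x (-rot (g x)) = 0 := by
  let e (j : Fin 2) : Plane := EuclideanSpace.single j 1
  have hInt (j k : Fin 2) : IntegrableOn (fun x => g x j * fderiv ℝ φ x (e k)) Ω := by
    obtain ⟨M, hM⟩ := hφ.exists_norm_fderiv_apply_le (e k)
    exact ((EuclideanSpace.proj (𝕜 := ℝ) j).integrable_comp hg).mul_bdd (c := M)
      (hφ.continuous_fderiv_apply _).aestronglyMeasurable (.of_forall hM)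
  have h₁ := (hfg 1).integral_eq _ (hφ.fderiv_apply (e 0))
  have h₀ := (hfg 0).integral_eq _ (hφ.fderiv_apply (e 1))
  simp only [hφ.fderiv_fderiv_comm (e 0) (EuclideanSpace.single 1 1)] at h₁
  simp only [neg_rot_eq_sub, map_sub, map_smul, smul_eq_mul]
  rw [integral_sub (hInt 1 0) (hInt 0 1)]
  linarith

theorem integrable_row {μ : Measure Plane} {G : Plane → Mat} (hG : MemLp G 1 μ) (i : Fin 2) :
    Integrable (fun x => row (G x) i) μ := by
  have hcont : Continuous fun C : Mat => row C i :=
    (PiLp.continuous_toLp 2 _).comp (continuous_apply i)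
  refine memLp_one_iff_integrable.1 (hG.mono ?_ (.of_forall fun x => norm_row_le _ i))
  exact hcont.comp_aestronglyMeasurable hG.aestronglyMeasurable

theorem isVeryWeakPLaplaceSolution_of_mem_K {p : ℝ} (hp : 1 < p) {u : Plane → Plane}
    {G : Plane → Mat} (hu : IsWeakGradient Ω u G) (hG : MemLp G 1 (volume.restrict Ω))
    (hK : ∀ᵐ x ∂volume.restrict Ω, G x ∈ K p) :
    IsVeryWeakPLaplaceSolution p Ω fun x => u x 0 := by
  have hflux : (fun x => ‖row (G x) 0‖ ^ (p - 2) • row (G x) 0) =ᵐ[volume.restrict Ω]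
      fun x => -rot (row (G x) 1) := hK.mono fun x hx => flux_of_mem_K hp hx
  refine ⟨fun x => row (G x) 0, hu 0, ?_, fun φ hφ => ?_⟩
  · refine IntegrableOn.locallyIntegrableOn (Integrable.congr ?_ hflux.symm)
    have hG₁ (j : Fin 2) : Integrable (fun x => row (G x) 1 j) (volume.restrict Ω) :=
      (EuclideanSpace.proj (𝕜 := ℝ) j).integrable_comp (integrable_row hG 1)
    simp only [neg_rot_eq_sub]
    exact ((hG₁ 1).smul_const _).sub ((hG₁ 0).smul_const _)
  · rw [integral_congr_ae (hflux.mono fun x hx => congrArg (fderiv ℝ φ x) hx)]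
    exact integral_fderiv_neg_rot_eq_zero (integrable_row hG 1) (hu 1) hφ

end VeryWeakSolution

section HolderNorm

variable {α : ℝ≥0} {S : Set Plane} {f g : Plane → Plane}

theorem holderNormOn_le {a c : ℝ≥0} (hf : ∀ x ∈ S, ‖f x‖ ≤ a) (hH : HolderWith c α f) :
    holderNormOn α S f ≤ a + c := by
  refine add_le_add (iSup₂_le fun x hx => ?_) (HolderWith.eHolderNorm_le fun x y => hH x y)
  exact enorm_le_coe.2 (hf x hx)

theorem holderNormOn_add_le : holderNormOn α S (fun x => f x + g x) ≤
    holderNormOn α S f + holderNormOn α S g := by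
  refine (add_le_add (iSup₂_le fun x hx => ?_) eHolderNorm_add_le).trans_eq
    (add_add_add_comm _ _ _ _)
  exact (enorm_add_le _ _).trans (add_le_add (le_iSup₂ (f := fun x _ => ‖f x‖ₑ) x hx)
    (le_iSup₂ (f := fun x _ => ‖g x‖ₑ) x hx))

theorem holderNormOn_lt_top_of_lipschitzWith (hα : α ≤ 1) (hS : Bornology.IsBounded S) {L : ℝ≥0}
    (hg : LipschitzWith L g) : holderNormOn α S g < ⊤ := by
  have : BoundedSpace S := boundedSpace_subtype_iff.2 hS
  obtain ⟨M, hM⟩ := (hg.isBounded_image hS).exists_norm_le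
  refine ENNReal.add_lt_top.2 ⟨?_, eHolderNorm_lt_top.2 (MemHolder.of_le (r := 1) ?_ hα)⟩
  · exact (iSup₂_le fun x hx => enorm_le_coe.2 ((hM _ (mem_image_of_mem g hx)).trans
      (Real.le_coe_toNNReal M))).trans_lt ENNReal.coe_lt_top
  · exact ⟨L, holderWith_one.2 fun x y => hg x y⟩

theorem holderNormOn_lt_top_of_sub (hg : holderNormOn α S g < ⊤)
    (hfg : holderNormOn α S (fun x => f x - g x) < ⊤) : holderNormOn α S f < ⊤ := by
  simpa only [sub_add_cancel] using holderNormOn_add_le.trans_lt (ENNReal.add_lt_top.2 ⟨hfg, hg⟩)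

theorem holderNormOn_lt_top_of_sub_affineMap (hα : α ≤ 1) (hS : Bornology.IsBounded S) {A : Mat}
    {b : Plane} {c : ℝ≥0∞} (h : holderNormOn α S (fun x => f x - affineMap A b x) < c) :
    holderNormOn α S f < ⊤ := by
  obtain ⟨L, hL⟩ := lipschitzWith_affineMap A b
  exact holderNormOn_lt_top_of_sub (holderNormOn_lt_top_of_lipschitzWith hα hS hL)
    (h.trans_le le_top)

theorem holderNormOn_lt_ofReal {δ : ℝ} (hδ : 0 < δ) (hf : ∀ x ∈ S, ‖f x‖ ≤ (δ / 3).toNNReal)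
    (hH : HolderWith (δ / 3).toNNReal α f) : holderNormOn α S f < ENNReal.ofReal δ := by
  refine (holderNormOn_le hf hH).trans_lt ?_
  rw [← ENNReal.ofReal, ← ENNReal.ofReal_add (by positivity) (by positivity)]
  exact (ENNReal.ofReal_lt_ofReal_iff hδ).2 (by linarith)

end HolderNorm

theorem memLp_restrict_of_isBounded {X E : Type*} [PseudoMetricSpace X] [ProperSpace X]
    [MeasurableSpace X] [OpensMeasurableSpace X] [NormedAddCommGroup E]
    [SecondCountableTopologyEither X E] {μ : Measure X} [IsFiniteMeasureOnCompacts μ] {Ω : Set X}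
    (hΩ : Bornology.IsBounded Ω) {f : X → E} (hf : Continuous f) (q : ℝ≥0∞) :
    MemLp f q (μ.restrict Ω) := by
  have : IsFiniteMeasure (μ.restrict (closure Ω)) :=
    isFiniteMeasure_restrict.2 hΩ.isCompact_closure.measure_ne_top
  obtain ⟨M, hM⟩ := (hΩ.isCompact_closure.image hf).isBounded.exists_norm_le
  exact (MemLp.of_bound hf.aestronglyMeasurable M (ae_restrict_of_forall_mem
    isClosed_closure.measurableSet fun x hx => hM _ (mem_image_of_mem f hx))).mono_measure
    (Measure.restrict_mono subset_closure le_rfl)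

/-! ### Admissible parameters -/

section Parameters

/-- Admissible parameters of the staircase for exponent `p`: `s` is the ratio by which a length is
shrunk to land on `K p`, and `β₁`, `β₂` are the proportions of the area that stay active when the
first and the second row are modified. The inequalities `first_row` and `second_row` make the two
splittings possible; the last two place the exponent `q` with `β₁ * β₂ = 2 ^ (-q)` in `(1, p)`. -/
structure IsAdmissible (p s β₁ β₂ : ℝ) : Prop where
  one_lt : 1 < p
  lt_two : p < 2
  s_pos : 0 < s
  s_lt_one : s < 1
  β₁_pos : 0 < β₁
  β₁_lt_one : β₁ < 1
  β₂_pos : 0 < β₂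
  β₂_lt_one : β₂ < 1
  first_row : 1 + (1 - β₁) * s < β₁ * 2
  second_row : s ^ (p - 1) + (1 - β₂) * 2 ^ (p - 1) < β₂ * (s ^ (p - 1) * 2 ^ (p - 1))
  mul_lt : β₁ * β₂ < 2⁻¹
  lt_mul : ((2 : ℝ) ^ p)⁻¹ < β₁ * β₂

theorem exists_mul_lt_of_lt_one {a b c : ℝ} (ha : 0 < a) (hb : 0 < b) (ha₁ : a < 1) (hb₁ : b < 1)
    (hab : a * b < c) : ∃ x y, a < x ∧ x < 1 ∧ b < y ∧ y < 1 ∧ x * y < c := by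
  obtain ⟨x, hax, hx⟩ := exists_between (lt_min ha₁ ((lt_div_iff₀ hb).2 hab))
  obtain ⟨hx₁, hxb⟩ := lt_min_iff.1 hx
  have hx₀ : 0 < x := ha.trans hax
  have hbx : b < c / x := by rwa [lt_div_iff₀ hx₀, mul_comm, ← lt_div_iff₀ hb]
  obtain ⟨y, hby, hy⟩ := exists_between (lt_min hb₁ hbx)
  obtain ⟨hy₁, hyx⟩ := lt_min_iff.1 hy
  exact ⟨x, y, hax, hx₁, hby, hy₁, by rwa [mul_comm, ← lt_div_iff₀ hx₀]⟩

theorem exists_eq_rpow_mul {e σ : ℝ} (he : e < 1) (hσ₀ : 0 < σ) (hσ₁ : σ < 1) :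
    ∃ s, 0 < s ∧ s < 1 ∧ s = s ^ e * σ := by
  have he' : 0 < 1 - e := by linarith
  have hs : 0 < σ ^ (1 / (1 - e)) := by positivity
  refine ⟨_, hs, Real.rpow_lt_one hσ₀.le hσ₁ (by positivity), ?_⟩
  have hpow : (σ ^ (1 / (1 - e))) ^ (1 - e) = σ := by
    rw [← Real.rpow_mul hσ₀.le, one_div_mul_cancel he'.ne', Real.rpow_one]
  nth_rw 3 [← hpow]
  rw [← Real.rpow_add hs, add_sub_cancel, Real.rpow_one]

theorem threshold_mul_threshold_lt {R c : ℝ} (hR₁ : 1 < R) (hR₂ : R < 2) (hc₀ : 0 < c)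
    (hc₁ : c < 1) :
    (1 + c * ((R - 1) / 2)) / (2 + c * ((R - 1) / 2)) * ((c + R) / (R * (1 + c))) < 2⁻¹ := by
  have : 0 < R - 1 := by linarith
  have hsum : c * (2 - R) + R < 4 := by nlinarith
  have hprod : (R - 1) / 2 * (c * (2 - R) + R) < 2 * (R - 1) := by nlinarith
  rw [div_mul_div_comm, div_lt_iff₀ (by positivity)]
  nlinarith [mul_lt_mul_of_pos_left hprod hc₀]

theorem exists_isAdmissible {p : ℝ} (hp₁ : 1 < p) (hp₂ : p < 2) :
    ∃ s β₁ β₂, IsAdmissible p s β₁ β₂ := by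
  have hRp : (2 : ℝ) ^ p = 2 * 2 ^ (p - 1) := by
    rw [Real.rpow_sub_one two_ne_zero]
    ring
  have hR₁ : 1 < (2 : ℝ) ^ (p - 1) := Real.one_lt_rpow one_lt_two (by linarith)
  have hR₂ : (2 : ℝ) ^ (p - 1) < 2 := Real.rpow_lt_self_of_one_lt one_lt_two (by linarith)
  obtain ⟨s, hs₀, hs₁, hs⟩ := exists_eq_rpow_mul (e := p - 1) (σ := ((2 : ℝ) ^ (p - 1) - 1) / 2)
    (by linarith) (by linarith) (by linarith)
  have hc₀ : 0 < s ^ (p - 1) := by positivity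
  have hc₁ : s ^ (p - 1) < 1 := Real.rpow_lt_one hs₀.le hs₁ (by linarith)
  generalize hR : (2 : ℝ) ^ (p - 1) = R at *
  have hthr := threshold_mul_threshold_lt hR₁ hR₂ hc₀ hc₁
  rw [← hs] at hthr
  obtain ⟨β₁, β₂, h₁, hβ₁, h₂, hβ₂, hβ⟩ := exists_mul_lt_of_lt_one (by positivity) (by positivity)
    ((div_lt_one (by positivity)).2 (by linarith))
    ((div_lt_one (by positivity)).2 (by nlinarith)) hthr
  have hβ₁' : 2⁻¹ < β₁ := lt_trans (by rw [lt_div_iff₀ (by positivity)]; linarith) h₁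
  have hβ₂' : R⁻¹ < β₂ := by
    refine lt_trans ?_ h₂
    rw [lt_div_iff₀ (by positivity), inv_mul_cancel_left₀ (by positivity)]
    linarith
  rw [div_lt_iff₀ (by positivity)] at h₁ h₂
  have hR₀ : 0 < R⁻¹ := by positivity
  have hβ' : (2 * R)⁻¹ < β₁ * β₂ := by
    rw [mul_inv]
    exact mul_lt_mul'' hβ₁' hβ₂' (by norm_num) hR₀.le
  exact ⟨s, β₁, β₂, hp₁, hp₂, hs₀, hs₁, by linarith, hβ₁, by linarith, hβ₂, by linarith,
    by rw [hR]; linarith, hβ, hRp ▸ hβ'⟩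

/-- The exponent `q` with `β₁ * β₂ = 2 ^ (-q)`, where `β₁ * β₂` is the proportion of the area that
stays active while the scale of the staircase doubles. -/
noncomputable def tailExponent (β₁ β₂ : ℝ) : ℝ := -Real.logb 2 (β₁ * β₂)

namespace IsAdmissible

variable {p s β₁ β₂ : ℝ}

theorem β_mul_pos (h : IsAdmissible p s β₁ β₂) : 0 < β₁ * β₂ := mul_pos h.β₁_pos h.β₂_pos

theorem β_mul_lt_one (h : IsAdmissible p s β₁ β₂) : β₁ * β₂ < 1 := h.mul_lt.trans (by norm_num)

theorem two_rpow_neg_tailExponent (h : IsAdmissible p s β₁ β₂) :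
    (2 : ℝ) ^ (-tailExponent β₁ β₂) = β₁ * β₂ := by
  rw [tailExponent, neg_neg, Real.rpow_logb two_pos (by norm_num) h.β_mul_pos]

theorem one_lt_tailExponent (h : IsAdmissible p s β₁ β₂) : 1 < tailExponent β₁ β₂ := by
  have hlt : (2 : ℝ) ^ (-tailExponent β₁ β₂) < 2 ^ (-1 : ℝ) := by
    rw [h.two_rpow_neg_tailExponent, Real.rpow_neg_one]
    exact h.mul_lt
  exact neg_lt_neg_iff.1 ((Real.rpow_lt_rpow_left_iff one_lt_two).1 hlt)

theorem tailExponent_lt (h : IsAdmissible p s β₁ β₂) : tailExponent β₁ β₂ < p := by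
  have hlt : (2 : ℝ) ^ (-p) < 2 ^ (-tailExponent β₁ β₂) := by
    rw [h.two_rpow_neg_tailExponent, Real.rpow_neg two_pos.le]
    exact h.lt_mul
  exact neg_lt_neg_iff.1 ((Real.rpow_lt_rpow_left_iff one_lt_two).1 hlt)

end IsAdmissible

end Parameters

section RowNorms

/-- The matrices whose rows have the prescribed lengths `x` and `y`; the active matrices of the
staircase are of this kind. -/
def rowNorms (x y : ℝ) : Set Mat := {C | ‖row C 0‖ = x ∧ ‖row C 1‖ = y}

theorem norm_le_add_row (C : Mat) : ‖C‖ ≤ ‖row C 0‖ + ‖row C 1‖ := by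
  rw [← sq_le_sq₀ (norm_nonneg _) (by positivity), norm_sq_eq_row]
  nlinarith [norm_nonneg (row C 0), norm_nonneg (row C 1)]

theorem norm_le_two_mul {C : Mat} {z : ℝ} (h₀ : ‖row C 0‖ ≤ z) (h₁ : ‖row C 1‖ ≤ z) :
    ‖C‖ ≤ 2 * z := by
  linarith [norm_le_add_row C]

theorem rpow_le_of_le_of_one_le {e x y : ℝ} (he₀ : 0 ≤ e) (he₁ : e ≤ 1) (hx : 0 ≤ x) (hxy : x ≤ y)
    (hy : 1 ≤ y) : x ^ e ≤ y :=
  (Real.rpow_le_rpow hx hxy he₀).trans (Real.rpow_le_self_of_one_le hy he₁)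

variable {p s β β₁ β₂ x : ℝ} {C : Mat} {L : ℝ≥0}

theorem norm_le_of_mem_K (hp₁ : 1 < p) (hp₂ : p ≤ 2) (hC : C ∈ K p) {y : ℝ} (h : ‖row C 0‖ ≤ y)
    (hy : 1 ≤ y) : ‖C‖ ≤ 2 * y := by
  refine norm_le_two_mul h ?_
  rw [norm_row_one_of_mem_K hp₁ hC]
  exact rpow_le_of_le_of_one_le (by linarith) (by linarith) (norm_nonneg _) h hy

namespace IsAdmissible

theorem rpow_le (h : IsAdmissible p s β₁ β₂) {y : ℝ} (hx : 0 ≤ x) (hxy : x ≤ y) (hy : 1 ≤ y) :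
    x ^ (p - 1) ≤ y :=
  rpow_le_of_le_of_one_le (by linarith [h.one_lt]) (by linarith [h.lt_two]) hx hxy hy

theorem s_mul_lt (h : IsAdmissible p s β₁ β₂) (hx : 0 < x) : s * x < x :=
  mul_lt_of_lt_one_left hx h.s_lt_one

theorem splits_first_row (h : IsAdmissible p s β₁ β₂) (hx : 0 < x) (hL : 3 * x ≤ L)
    (hC : C ∈ rowNorms x ((s * x) ^ (p - 1))) :
    Splits β₁ L C {D | D ∈ K p ∧ ‖row D 0‖ = s * x} (rowNorms (2 * x) ((s * x) ^ (p - 1))) := by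
  obtain ⟨k, hk, hkK⟩ := exists_setRow_zero_mem_K h.one_lt (mul_pos h.s_pos hx) hC.2
  have hsx := h.s_mul_lt hx
  refine splits_of_row (i := 0) (k := k) (X := 2 * x) h.β₁_pos h.β₁_lt_one ?_ ?_
    ⟨hkK, by rwa [row_setRow_self]⟩ (fun z hz => ⟨by rwa [row_setRow_self], ?_⟩) ?_ ?_
  · rintro rfl
    exact hsx.ne (hk.symm.trans hC.1)
  · rw [hC.1, hk]
    nlinarith [mul_lt_mul_of_pos_right h.first_row hx]
  · rw [row_setRow_of_ne _ (by decide)]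
    exact hC.2
  · rw [hC.1, hk]
    linarith
  · rw [hC.1]
    linarith

theorem splits_second_row (h : IsAdmissible p s β₁ β₂) (hx : 1 ≤ x) (hL : 4 * x ≤ L)
    (hC : C ∈ rowNorms (2 * x) ((s * x) ^ (p - 1))) :
    Splits β₂ L C {D | D ∈ K p ∧ ‖row D 0‖ = 2 * x}
      (rowNorms (2 * x) ((s * (2 * x)) ^ (p - 1))) := by
  have hs := h.s_pos
  have hx₀ : 0 < x := by linarith
  obtain ⟨k, hk, hkK⟩ := exists_setRow_one_mem_K h.one_lt C
  rw [hC.1] at hk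
  have hsx := h.s_mul_lt hx₀
  have h₁ : (s * x) ^ (p - 1) ≤ 2 * x := h.rpow_le (by positivity) (by linarith) (by linarith)
  have h₂ : (2 * x) ^ (p - 1) ≤ 2 * x := h.rpow_le (by positivity) le_rfl (by linarith)
  have h₃ : (s * (2 * x)) ^ (p - 1) ≤ 2 * x :=
    h.rpow_le (by positivity) (h.s_mul_lt (by positivity)).le (by linarith)
  have hrow (z : Plane) : ‖row (setRow C 1 z) 0‖ = 2 * x := by
    rw [row_setRow_of_ne _ (by decide)]
    exact hC.1
  refine splits_of_row (i := 1) (k := k) (X := (s * (2 * x)) ^ (p - 1)) h.β₂_pos h.β₂_lt_one ?_ ?_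
    ⟨hkK, hrow k⟩ (fun z hz => ⟨hrow z, by rwa [row_setRow_self]⟩) ?_ ?_
  · rintro rfl
    have hlt : (s * x) ^ (p - 1) < (2 * x) ^ (p - 1) :=
      Real.rpow_lt_rpow (by positivity) (by linarith) (by linarith [h.one_lt])
    exact hlt.ne (hC.2.symm.trans hk)
  · rw [hC.2, hk, Real.mul_rpow hs.le hx₀.le, Real.mul_rpow hs.le (by positivity),
      Real.mul_rpow two_pos.le hx₀.le]
    linarith [mul_lt_mul_of_pos_right h.second_row (Real.rpow_pos_of_pos hx₀ (p - 1))]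
  · rw [hC.2, hk]
    linarith
  · rw [hC.2]
    linarith

end IsAdmissible

theorem stepRule_of_norm_row_lt {R T S : Set Mat} {y X : ℝ} (i : Fin 2) (hy : 0 ≤ y) (hyX : y < X)
    (hL : 2 * X ≤ L) (hR : ∀ C ∈ R, ‖row C i‖ = y)
    (hS : ∀ C ∈ R, ∀ z, ‖z‖ = X → setRow C i z ∈ S) : StepRule 1 L R T S := by
  have hX : 0 < X := hy.trans_lt hyX
  obtain ⟨β, hβ, hβ₁⟩ := exists_between (show (y + X) / (2 * X) < 1 by
    rw [div_lt_one (by positivity)]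
    linarith)
  have hβ₀ : 0 < β := lt_of_le_of_lt (by positivity) hβ
  rw [div_lt_iff₀ (by positivity)] at hβ
  have hk : ‖(EuclideanSpace.single 0 X : Plane)‖ = X := by
    rw [PiLp.norm_single, Real.norm_of_nonneg hX.le]
  refine .inr ⟨rfl, β, fun C hC =>
    splits_of_row hβ₀ hβ₁ ?_ ?_ (hS C hC _ hk) (hS C hC) ?_ ?_⟩
  · intro heq
    exact hyX.ne (by rw [← hR C hC, ← heq, hk])
  all_goals
    simp only [hk, hR C hC]
    linarith

end RowNorms

section Classes

/-- The gradients that are still active at stage `n` of the staircase starting from `A`. Stages `0`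
and `1` stretch the rows of `A` to the lengths required for the scale `ρ`; afterwards the stages
alternate between the two rows, and the scale `ρ * 2 ^ m` doubles every second stage. -/
def activeClass (p s ρ : ℝ) (A : Mat) : ℕ → Set Mat
  | 0 => {A}
  | 1 => {C | ‖row C 0‖ = ρ ∧ row C 1 = row A 1}
  | n + 2 => rowNorms (ρ * 2 ^ ((n + 1) / 2)) ((s * (ρ * 2 ^ (n / 2))) ^ (p - 1))

/-- The gradients in `K p` that are produced at stage `n` of the staircase and never modified
again. -/
def doneClass (p s ρ : ℝ) : ℕ → Set Mat
  | 0 => ∅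
  | 1 => ∅
  | n + 2 => {C | C ∈ K p ∧ ‖row C 0‖ = (if Even n then s else 2) * (ρ * 2 ^ (n / 2))}

/-- The proportion of the active area that remains active after stage `n` of the staircase. -/
noncomputable def activeWeight (β₁ β₂ : ℝ) : ℕ → ℝ
  | 0 => 1
  | 1 => 1
  | n + 2 => if Even n then β₁ else β₂

/-- A bound for all gradients that occur at stage `n` of the staircase. -/
noncomputable def gradBound (ρ : ℝ) (n : ℕ) : ℝ≥0 := Real.toNNReal (2 * (ρ * 2 ^ (n / 2)))

theorem stage_cases (n : ℕ) : n = 0 ∨ n = 1 ∨ (∃ m, n = 2 * m + 2) ∨ ∃ m, n = 2 * m + 3 := by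
  obtain ⟨m, rfl | rfl⟩ := Nat.even_or_odd' n <;> rcases m with _ | m
  exacts [.inl rfl, .inr (.inr (.inl ⟨m, by ring⟩)), .inr (.inl rfl),
    .inr (.inr (.inr ⟨m, by ring⟩))]

section Values

variable (p s ρ β₁ β₂ : ℝ) (A : Mat) (m : ℕ)

theorem activeClass_even :
    activeClass p s ρ A (2 * m + 2) = rowNorms (ρ * 2 ^ m) ((s * (ρ * 2 ^ m)) ^ (p - 1)) := by
  rw [activeClass, show (2 * m + 1) / 2 = m by lia, show 2 * m / 2 = m by lia]

theorem activeClass_odd : activeClass p s ρ A (2 * m + 3) =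
    rowNorms (2 * (ρ * 2 ^ m)) ((s * (ρ * 2 ^ m)) ^ (p - 1)) := by
  rw [activeClass, show (2 * m + 1 + 1) / 2 = m + 1 by lia, show (2 * m + 1) / 2 = m by lia,
    pow_succ', mul_left_comm]

theorem doneClass_even :
    doneClass p s ρ (2 * m + 2) = {C | C ∈ K p ∧ ‖row C 0‖ = s * (ρ * 2 ^ m)} := by
  rw [doneClass, if_pos (even_two_mul m), show 2 * m / 2 = m by lia]

theorem doneClass_odd :
    doneClass p s ρ (2 * m + 3) = {C | C ∈ K p ∧ ‖row C 0‖ = 2 * (ρ * 2 ^ m)} := by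
  rw [doneClass, if_neg (Nat.not_even_two_mul_add_one m), show (2 * m + 1) / 2 = m by lia]

theorem activeWeight_even : activeWeight β₁ β₂ (2 * m + 2) = β₁ := by
  rw [activeWeight, if_pos (even_two_mul m)]

theorem activeWeight_odd : activeWeight β₁ β₂ (2 * m + 3) = β₂ := by
  rw [activeWeight, if_neg (Nat.not_even_two_mul_add_one m)]

theorem gradBound_even : gradBound ρ (2 * m + 2) = Real.toNNReal (4 * (ρ * 2 ^ m)) := by
  rw [gradBound, show (2 * m + 2) / 2 = m + 1 by lia]
  ring_nf

theorem gradBound_odd : gradBound ρ (2 * m + 3) = Real.toNNReal (4 * (ρ * 2 ^ m)) := by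
  rw [gradBound, show (2 * m + 3) / 2 = m + 1 by lia]
  ring_nf

end Values

variable {p s ρ β₁ β₂ : ℝ} {A C : Mat} {n : ℕ}

theorem doneClass_subset_K : doneClass p s ρ n ⊆ K p := by
  intro C hC
  match n with
  | 0 | 1 => exact hC.elim
  | n + 2 => exact hC.1

theorem one_le_scale (hρ : 1 ≤ ρ) (m : ℕ) : 1 ≤ ρ * 2 ^ m :=
  one_le_mul_of_one_le_of_one_le hρ (one_le_pow₀ one_le_two)

namespace IsAdmissible

theorem s_mul_rpow_le (h : IsAdmissible p s β₁ β₂) {x : ℝ} (hx : 1 ≤ x) :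
    (s * x) ^ (p - 1) ≤ x := by
  have hs := h.s_pos
  exact h.rpow_le (by positivity) (h.s_mul_lt (by linarith)).le hx

theorem stepRule_activeClass (h : IsAdmissible p s β₁ β₂) (hρ : 1 ≤ ρ) (hA₀ : ‖row A 0‖ < ρ)
    (hA₁ : ‖row A 1‖ < (s * ρ) ^ (p - 1)) (n : ℕ) :
    StepRule (activeWeight β₁ β₂ n) (gradBound ρ n) (activeClass p s ρ A n) (doneClass p s ρ n)
      (activeClass p s ρ A (n + 1)) := by
  have le_gradBound (k : ℕ) : 2 * (ρ * 2 ^ (k / 2)) ≤ gradBound ρ k := Real.le_coe_toNNReal _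
  obtain rfl | rfl | ⟨m, rfl⟩ | ⟨m, rfl⟩ := stage_cases n
  · refine stepRule_of_norm_row_lt 0 (norm_nonneg _) hA₀ (by simpa using le_gradBound 0)
      (by rintro C rfl; rfl) ?_
    rintro C rfl z hz
    exact ⟨by rwa [row_setRow_self], row_setRow_of_ne _ (by decide) _⟩
  · refine stepRule_of_norm_row_lt 1 (norm_nonneg _) hA₁ ?_ (fun C hC => by rw [hC.2]) ?_
    · have hle : 2 * ρ ≤ gradBound ρ 1 := by simpa using le_gradBound 1
      linarith [h.s_mul_rpow_le hρ]
    · intro C hC z hz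
      rw [activeClass_even p s ρ A 0, pow_zero, mul_one]
      exact ⟨by rw [row_setRow_of_ne _ (by decide)]; exact hC.1, by rwa [row_setRow_self]⟩
  · have hx := one_le_scale hρ m
    rw [activeWeight_even, gradBound_even, activeClass_even, doneClass_even, activeClass_odd]
    refine .inl fun C hC => h.splits_first_row (by linarith) ?_ hC
    exact le_trans (by linarith) (Real.le_coe_toNNReal _)
  · have hnext : activeClass p s ρ A (2 * m + 3 + 1) =
        rowNorms (2 * (ρ * 2 ^ m)) ((s * (2 * (ρ * 2 ^ m))) ^ (p - 1)) := by
      rw [show 2 * m + 3 + 1 = 2 * (m + 1) + 2 by ring, activeClass_even, pow_succ', mul_left_comm]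
    rw [activeWeight_odd, gradBound_odd, activeClass_odd, doneClass_odd, hnext]
    exact .inl fun C hC => h.splits_second_row (one_le_scale hρ m) (Real.le_coe_toNNReal _) hC

theorem nnnorm_le_gradBound_of_mem_doneClass (h : IsAdmissible p s β₁ β₂) (hρ : 1 ≤ ρ)
    (hC : C ∈ doneClass p s ρ n) : ‖C‖₊ ≤ gradBound ρ n := by
  obtain rfl | rfl | ⟨m, rfl⟩ | ⟨m, rfl⟩ := stage_cases n
  · exact hC.elim
  · exact hC.elim
  · have hx := one_le_scale hρ m
    rw [doneClass_even] at hC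
    rw [gradBound_even, Real.le_toNNReal_iff_coe_le (by linarith), coe_nnnorm]
    have hC₀ : ‖row C 0‖ ≤ ρ * 2 ^ m := hC.2.trans_le (h.s_mul_lt (by linarith)).le
    linarith [norm_le_of_mem_K h.one_lt h.lt_two.le hC.1 hC₀ hx]
  · have hx := one_le_scale hρ m
    rw [doneClass_odd] at hC
    rw [gradBound_odd, Real.le_toNNReal_iff_coe_le (by linarith), coe_nnnorm]
    linarith [norm_le_of_mem_K h.one_lt h.lt_two.le hC.1 hC.2.le (by linarith)]

theorem nnnorm_le_gradBound_of_mem_activeClass (h : IsAdmissible p s β₁ β₂) (hρ : 1 ≤ ρ)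
    (hA₀ : ‖row A 0‖ < ρ) (hA₁ : ‖row A 1‖ < (s * ρ) ^ (p - 1)) (hC : C ∈ activeClass p s ρ A n) :
    ‖C‖₊ ≤ gradBound ρ n := by
  have hA₁' : ‖row A 1‖ ≤ ρ := hA₁.le.trans (h.s_mul_rpow_le hρ)
  obtain rfl | rfl | ⟨m, rfl⟩ | ⟨m, rfl⟩ := stage_cases n
  · obtain rfl := hC
    rw [gradBound, Real.le_toNNReal_iff_coe_le (by positivity), coe_nnnorm]
    simpa using norm_le_two_mul hA₀.le hA₁'
  · rw [gradBound, Real.le_toNNReal_iff_coe_le (by positivity), coe_nnnorm]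
    simpa using norm_le_two_mul hC.1.le (hC.2 ▸ hA₁')
  · have hx := one_le_scale hρ m
    rw [activeClass_even] at hC
    rw [gradBound_even, Real.le_toNNReal_iff_coe_le (by linarith), coe_nnnorm]
    linarith [norm_le_two_mul hC.1.le (hC.2.trans_le (h.s_mul_rpow_le hx))]
  · have hx := one_le_scale hρ m
    rw [activeClass_odd] at hC
    rw [gradBound_odd, Real.le_toNNReal_iff_coe_le (by linarith), coe_nnnorm]
    linarith [norm_le_two_mul hC.1.le
      (hC.2.trans_le ((h.s_mul_rpow_le hx).trans (by linarith : _ ≤ 2 * (ρ * 2 ^ m))))]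

theorem activeWeight_nonneg (h : IsAdmissible p s β₁ β₂) (n : ℕ) : 0 ≤ activeWeight β₁ β₂ n := by
  obtain rfl | rfl | ⟨m, rfl⟩ | ⟨m, rfl⟩ := stage_cases n
  · exact zero_le_one
  · exact zero_le_one
  · rw [activeWeight_even]
    exact h.β₁_pos.le
  · rw [activeWeight_odd]
    exact h.β₂_pos.le

end IsAdmissible

theorem prod_activeWeight_even (β₁ β₂ : ℝ) (m : ℕ) :
    ∏ i ∈ Finset.range (2 * m + 2), activeWeight β₁ β₂ i = (β₁ * β₂) ^ m := by
  induction m with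
  | zero => simp [Finset.prod_range_succ, activeWeight]
  | succ m ih =>
    rw [show 2 * (m + 1) + 2 = 2 * m + 3 + 1 by ring, Finset.prod_range_succ,
      Finset.prod_range_succ, ih, activeWeight_even, activeWeight_odd, pow_succ, mul_assoc]

theorem prod_activeWeight_odd (β₁ β₂ : ℝ) (m : ℕ) :
    ∏ i ∈ Finset.range (2 * m + 3), activeWeight β₁ β₂ i = (β₁ * β₂) ^ m * β₁ := by
  rw [Finset.prod_range_succ, prod_activeWeight_even, activeWeight_even]

theorem IsAdmissible.prod_activeWeight_le (h : IsAdmissible p s β₁ β₂) (n : ℕ) :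
    ∏ i ∈ Finset.range n, activeWeight β₁ β₂ i ≤ (β₁ * β₂)⁻¹ * (β₁ * β₂) ^ (n / 2) := by
  have hβ := h.β_mul_pos
  obtain rfl | rfl | ⟨m, rfl⟩ | ⟨m, rfl⟩ := stage_cases n
  · simpa using (one_le_inv₀ hβ).2 h.β_mul_lt_one.le
  · simpa [activeWeight] using (one_le_inv₀ hβ).2 h.β_mul_lt_one.le
  · rw [prod_activeWeight_even, show (2 * m + 2) / 2 = m + 1 by lia, pow_succ',
      inv_mul_cancel_left₀ hβ.ne']
  · rw [prod_activeWeight_odd, show (2 * m + 3) / 2 = m + 1 by lia, pow_succ',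
      inv_mul_cancel_left₀ hβ.ne']
    exact mul_le_of_le_one_right (by positivity) h.β₁_lt_one.le

theorem IsAdmissible.tendsto_prod_activeWeight (h : IsAdmissible p s β₁ β₂) :
    Tendsto (fun n => ∏ i ∈ Finset.range n, activeWeight β₁ β₂ i) atTop (𝓝 0) := by
  refine squeeze_zero (fun n => Finset.prod_nonneg fun i _ => h.activeWeight_nonneg i)
    h.prod_activeWeight_le ?_
  have hpow := (tendsto_pow_atTop_nhds_zero_of_lt_one h.β_mul_pos.le h.β_mul_lt_one).comp
    (Nat.tendsto_div_const_atTop two_ne_zero)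
  simpa using hpow.const_mul (β₁ * β₂)⁻¹

theorem tsum_pow_div_two_ne_top {r : ℝ≥0∞} (hr : r < 1) : ∑' n : ℕ, r ^ (n / 2) ≠ ⊤ := by
  have hgeom : (1 - r)⁻¹ ≠ ⊤ := ENNReal.inv_ne_top.2 (tsub_pos_of_lt hr).ne'
  have heven (k : ℕ) : 2 * k / 2 = k := by lia
  have hodd (k : ℕ) : (2 * k + 1) / 2 = k := by lia
  rw [← tsum_even_add_odd ENNReal.summable ENNReal.summable]
  simpa only [heven, hodd, ENNReal.tsum_geometric] using ENNReal.add_ne_top.2 ⟨hgeom, hgeom⟩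

theorem coe_gradBound_rpow (hρ : 0 ≤ ρ) {q : ℝ} (hq : 0 ≤ q) (n : ℕ) :
    (gradBound ρ n : ℝ≥0∞) ^ q = ENNReal.ofReal ((2 * ρ) ^ q * (2 ^ q) ^ (n / 2)) := by
  change ENNReal.ofReal (2 * (ρ * 2 ^ (n / 2))) ^ q = _
  rw [ENNReal.ofReal_rpow_of_nonneg (by positivity) hq, ← mul_assoc,
    Real.mul_rpow (by positivity) (by positivity), Real.rpow_pow_comm two_pos.le]

theorem IsAdmissible.tsum_gradBound_rpow_ne_top (h : IsAdmissible p s β₁ β₂) (hρ : 0 ≤ ρ) {q : ℝ}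
    (hq : 0 ≤ q) (hβ : 2 ^ q * (β₁ * β₂) < 1) :
    ∑' n, (gradBound ρ n : ℝ≥0∞) ^ q *
      ENNReal.ofReal (∏ i ∈ Finset.range n, activeWeight β₁ β₂ i) ≠ ⊤ := by
  have hβ₀ := h.β_mul_pos
  have hterm (n : ℕ) : (gradBound ρ n : ℝ≥0∞) ^ q *
      ENNReal.ofReal (∏ i ∈ Finset.range n, activeWeight β₁ β₂ i) ≤
        ENNReal.ofReal ((2 * ρ) ^ q * (β₁ * β₂)⁻¹) *
          ENNReal.ofReal (2 ^ q * (β₁ * β₂)) ^ (n / 2) := by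
    rw [coe_gradBound_rpow hρ hq, ← ENNReal.ofReal_mul (by positivity),
      ← ENNReal.ofReal_pow (by positivity), ← ENNReal.ofReal_mul (by positivity)]
    refine ENNReal.ofReal_le_ofReal ?_
    calc (2 * ρ) ^ q * (2 ^ q) ^ (n / 2) * ∏ i ∈ Finset.range n, activeWeight β₁ β₂ i
        ≤ (2 * ρ) ^ q * (2 ^ q) ^ (n / 2) * ((β₁ * β₂)⁻¹ * (β₁ * β₂) ^ (n / 2)) := by
          gcongr
          exact h.prod_activeWeight_le n
      _ = (2 * ρ) ^ q * (β₁ * β₂)⁻¹ * (2 ^ q * (β₁ * β₂)) ^ (n / 2) := by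
          rw [mul_pow]
          ring
  refine ne_top_of_le_ne_top ?_ (ENNReal.tsum_le_tsum hterm)
  rw [ENNReal.tsum_mul_left]
  exact ENNReal.mul_ne_top ENNReal.ofReal_ne_top
    (tsum_pow_div_two_ne_top (ENNReal.ofReal_lt_one.2 hβ))

end Classes

/-! ### Tail estimates -/

section PowerTail

theorem div_rpow_neg {t y : ℝ} (ht : 0 ≤ t) (hy : 0 ≤ y) (q : ℝ) :
    (t / y) ^ (-q) = y ^ q * t ^ (-q) := by
  rw [Real.div_rpow ht hy, Real.rpow_neg hy, div_inv_eq_mul, mul_comm]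

theorem le_rpow_neg_of_forall_le_pow {q r t y : ℝ} (hq : 0 ≤ q) (hr : 0 < r) (ht : 0 < t)
    (hy : y ≤ 1) (hpow : ∀ m : ℕ, r * 2 ^ m ≤ t → y ≤ (2 ^ (-q)) ^ m) :
    y ≤ (2 * r) ^ q * t ^ (-q) := by
  rw [← div_rpow_neg ht.le (by positivity)]
  rcases lt_or_ge t r with htr | hrt
  · refine hy.trans (Real.one_le_rpow_of_pos_of_le_one_of_nonpos (by positivity) ?_ (by linarith))
    exact (div_le_one (by positivity)).2 (by linarith)
  · obtain ⟨m, hm, hm'⟩ := exists_nat_pow_near ((one_le_div hr).2 hrt) one_lt_two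
    rw [le_div_iff₀' hr] at hm
    rw [div_lt_iff₀' hr, pow_succ] at hm'
    refine (hpow m hm).trans ?_
    rw [Real.rpow_pow_comm two_pos.le]
    refine Real.rpow_le_rpow_of_nonpos (by positivity) ?_ (by linarith)
    rw [div_le_iff₀ (by positivity)]
    linarith

theorem rpow_neg_le_of_forall_pow_le {a c q r t y : ℝ} (hq : 0 ≤ q) (hc : 0 ≤ c) (ha : 0 < a)
    (har : a ≤ r) (hat : a ≤ t) (hpow : ∀ m : ℕ, t < r * 2 ^ m → c * (2 ^ (-q)) ^ m ≤ y) :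
    c * 2 ^ (-q) * (a ^ q * t ^ (-q)) ≤ y := by
  have ht : 0 < t := ha.trans_le hat
  have hr : 0 < r := ha.trans_le har
  rcases lt_or_ge t r with htr | hrt
  · have hfrac : a ^ q * t ^ (-q) ≤ 1 := by
      rw [← div_rpow_neg ht.le ha.le]
      exact Real.rpow_le_one_of_one_le_of_nonpos ((one_le_div ha).2 hat) (by linarith)
    have htwo : (2 : ℝ) ^ (-q) ≤ 1 :=
      Real.rpow_le_one_of_one_le_of_nonpos one_le_two (by linarith)
    calc c * 2 ^ (-q) * (a ^ q * t ^ (-q)) ≤ c * 1 * 1 := by gcongr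
      _ ≤ y := by simpa using hpow 0 (by simpa using htr)
  · obtain ⟨m, hm, hm'⟩ := exists_nat_pow_near ((one_le_div hr).2 hrt) one_lt_two
    rw [div_lt_iff₀' hr] at hm'
    have hfrac : a ^ q * t ^ (-q) ≤ (2 ^ (-q)) ^ m :=
      calc a ^ q * t ^ (-q) ≤ r ^ q * t ^ (-q) := by gcongr
        _ = (t / r) ^ (-q) := (div_rpow_neg ht.le hr.le q).symm
        _ ≤ (2 ^ m) ^ (-q) := Real.rpow_le_rpow_of_nonpos (by positivity) hm (by linarith)
        _ = (2 ^ (-q)) ^ m := (Real.rpow_pow_comm two_pos.le _ _).symm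
    calc c * 2 ^ (-q) * (a ^ q * t ^ (-q)) ≤ c * 2 ^ (-q) * (2 ^ (-q)) ^ m := by gcongr
      _ = c * (2 ^ (-q)) ^ (m + 1) := by ring
      _ ≤ y := hpow _ hm'

theorem one_add_rpow_le_two_mul {a e q : ℝ} (ha : 0 ≤ a) (he : 0 ≤ e) (heq : e ≤ q) :
    1 + a ^ e ≤ 2 * (1 + a) ^ q := by
  have hone : 1 ≤ (1 + a) ^ q := Real.one_le_rpow (by linarith) (he.trans heq)
  have hpow : a ^ e ≤ (1 + a) ^ q :=
    (Real.rpow_le_rpow ha (by linarith) he).trans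
      (Real.rpow_le_rpow_of_exponent_le (by linarith) heq)
  linarith

end PowerTail

section InitialRadius

/-- The scale `ρ` at which the staircase from `A` starts, chosen so that
`(s * ρ) ^ (p - 1) = 1 + ‖A‖`. -/
noncomputable def initialRadius (p s : ℝ) (A : Mat) : ℝ := (1 + ‖A‖) ^ (1 / (p - 1)) / s

/-- The constant `M` of the tail estimates. -/
noncomputable def tailConstant (p s β₁ β₂ : ℝ) : ℝ :=
  1 + (4 / s) ^ tailExponent β₁ β₂ * 2 ^ (tailExponent β₁ β₂ / (p - 1) - 1) +
    2 / ((1 - β₂) * β₁ * (β₁ * β₂))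

namespace IsAdmissible

variable {p s β₁ β₂ : ℝ}

theorem s_mul_initialRadius_rpow (h : IsAdmissible p s β₁ β₂) (A : Mat) :
    (s * initialRadius p s A) ^ (p - 1) = 1 + ‖A‖ := by
  have hp : p - 1 ≠ 0 := by linarith [h.one_lt]
  rw [initialRadius, mul_div_cancel₀ _ h.s_pos.ne', ← Real.rpow_mul (by positivity),
    one_div_mul_cancel hp, Real.rpow_one]

theorem one_le_initialRadius (h : IsAdmissible p s β₁ β₂) (A : Mat) : 1 ≤ initialRadius p s A := by
  have hp : 0 < p - 1 := by linarith [h.one_lt]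
  have hpow : 1 ≤ (1 + ‖A‖) ^ (1 / (p - 1)) :=
    Real.one_le_rpow (by linarith [norm_nonneg A]) (by positivity)
  rw [initialRadius, one_le_div h.s_pos]
  exact h.s_lt_one.le.trans hpow

theorem one_add_norm_le_initialRadius (h : IsAdmissible p s β₁ β₂) (A : Mat) :
    1 + ‖A‖ ≤ initialRadius p s A :=
  h.s_mul_initialRadius_rpow A ▸ h.s_mul_rpow_le (h.one_le_initialRadius A)

theorem norm_row_zero_lt_initialRadius (h : IsAdmissible p s β₁ β₂) (A : Mat) :
    ‖row A 0‖ < initialRadius p s A := by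
  linarith [h.one_add_norm_le_initialRadius A, norm_row_le A 0]

theorem norm_row_one_lt (h : IsAdmissible p s β₁ β₂) (A : Mat) :
    ‖row A 1‖ < (s * initialRadius p s A) ^ (p - 1) := by
  linarith [h.s_mul_initialRadius_rpow A, norm_row_le A 1]

theorem four_mul_initialRadius_rpow_le (h : IsAdmissible p s β₁ β₂) (A : Mat) {q : ℝ}
    (hq : 1 ≤ q) : (4 * initialRadius p s A) ^ q ≤
      (4 / s) ^ q * 2 ^ (q / (p - 1) - 1) * (1 + ‖A‖ ^ (q / (p - 1))) := by
  have hs := h.s_pos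
  have hp : 0 < p - 1 := by linarith [h.one_lt]
  have he : 1 ≤ q / (p - 1) := (one_le_div hp).2 (by linarith [h.lt_two])
  calc (4 * initialRadius p s A) ^ q = (4 / s * (1 + ‖A‖) ^ (1 / (p - 1))) ^ q := by
        rw [initialRadius]
        ring_nf
    _ = (4 / s) ^ q * (1 + ‖A‖) ^ (q / (p - 1)) := by
        rw [Real.mul_rpow (by positivity) (by positivity), ← Real.rpow_mul (by positivity),
          one_div_mul_eq_div]
    _ ≤ (4 / s) ^ q * (2 ^ (q / (p - 1) - 1) * (1 ^ (q / (p - 1)) + ‖A‖ ^ (q / (p - 1)))) := by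
        gcongr
        exact_mod_cast NNReal.rpow_add_le_mul_rpow_add_rpow 1 ‖A‖₊ he
    _ = _ := by rw [Real.one_rpow, mul_assoc]

theorem complement_mul_pos (h : IsAdmissible p s β₁ β₂) : 0 < (1 - β₂) * β₁ :=
  mul_pos (by linarith [h.β₂_lt_one]) h.β₁_pos

theorem one_lt_tailConstant (h : IsAdmissible p s β₁ β₂) : 1 < tailConstant p s β₁ β₂ := by
  have hs := h.s_pos
  have hup : 0 < (4 / s) ^ tailExponent β₁ β₂ * 2 ^ (tailExponent β₁ β₂ / (p - 1) - 1) := by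
    positivity
  have hlow := div_pos two_pos (mul_pos h.complement_mul_pos h.β_mul_pos)
  rw [tailConstant]
  linarith

theorem four_mul_initialRadius_rpow_le_tailConstant (h : IsAdmissible p s β₁ β₂) (A : Mat) :
    (4 * initialRadius p s A) ^ tailExponent β₁ β₂ ≤
      tailConstant p s β₁ β₂ * (1 + ‖A‖ ^ (tailExponent β₁ β₂ / (p - 1))) := by
  refine (h.four_mul_initialRadius_rpow_le A h.one_lt_tailExponent.le).trans ?_
  have hlow := div_pos two_pos (mul_pos h.complement_mul_pos h.β_mul_pos)
  gcongr
  rw [tailConstant]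
  linarith

theorem inv_tailConstant_mul_le (h : IsAdmissible p s β₁ β₂) (A : Mat) :
    (tailConstant p s β₁ β₂)⁻¹ * (1 + ‖A‖ ^ ((p - 1) * tailExponent β₁ β₂)) ≤
      (1 - β₂) * β₁ * (β₁ * β₂) * (1 + ‖A‖) ^ tailExponent β₁ β₂ := by
  have hs := h.s_pos
  have hq := h.one_lt_tailExponent
  have hc := mul_pos h.complement_mul_pos h.β_mul_pos
  have hpow := one_add_rpow_le_two_mul (norm_nonneg A)
    (e := (p - 1) * tailExponent β₁ β₂) (q := tailExponent β₁ β₂)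
    (mul_nonneg (by linarith [h.one_lt]) (by linarith))
    (mul_le_of_le_one_left (by linarith) (by linarith [h.lt_two]))
  rw [inv_mul_le_iff₀ (by linarith [h.one_lt_tailConstant])]
  calc 1 + ‖A‖ ^ ((p - 1) * tailExponent β₁ β₂) ≤ 2 * (1 + ‖A‖) ^ tailExponent β₁ β₂ := hpow
    _ = 2 / ((1 - β₂) * β₁ * (β₁ * β₂)) *
        ((1 - β₂) * β₁ * (β₁ * β₂) * (1 + ‖A‖) ^ tailExponent β₁ β₂) := by
      rw [← mul_assoc, div_mul_cancel₀ _ hc.ne']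
    _ ≤ _ := by
      gcongr
      rw [tailConstant]
      exact le_add_of_nonneg_left (by positivity)

end IsAdmissible

end InitialRadius

theorem IsRegularDomain.volume_ne_zero {Ω : Set Plane} (hΩ : IsRegularDomain Ω) : volume Ω ≠ 0 :=
  (hΩ.isOpen.measure_pos _ hΩ.isConnected.nonempty).ne'

section Integrability

variable {p s β₁ β₂ ρ : ℝ} {Ω : Set Plane} {A : Mat} {b : Plane} {L : ℕ → ℝ≥0} {η : ℕ → ℝ}
  {u : ℕ → Plane → Plane} {P Q : ℕ → Set (Set Plane)}

namespace IsStaircase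

theorem ae_jacobian_limitMap_mem_K
    (hu : IsStaircase Ω A b (activeWeight β₁ β₂) L (activeClass p s ρ A) (doneClass p s ρ) η u P Q)
    (h : IsAdmissible p s β₁ β₂) :
    ∀ᵐ x ∂volume.restrict Ω, jacobian (limitMap u) x ∈ K p := by
  filter_upwards [hu.ae_exists_mem_done h.activeWeight_nonneg h.tendsto_prod_activeWeight]
    with x ⟨n, hn⟩
  exact doneClass_subset_K (hu.jacobian_limitMap_mem_of_mem_done hn)

theorem tsum_gradBound_rpow_mul_volume_ne_top {S T : ℕ → Set Mat}
    (hu : IsStaircase Ω A b (activeWeight β₁ β₂) L S T η u P Q)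
    (h : IsAdmissible p s β₁ β₂) (hρ : 0 ≤ ρ) {q : ℝ} (hq₀ : 0 ≤ q) (hq : q < tailExponent β₁ β₂) :
    ∑' n, (gradBound ρ n : ℝ≥0∞) ^ q * volume (⋃₀ P n) ≠ ⊤ := by
  have hβ : 2 ^ q * (β₁ * β₂) < 1 := by
    rw [← h.two_rpow_neg_tailExponent, ← Real.rpow_add two_pos]
    exact Real.rpow_lt_one_of_one_lt_of_neg one_lt_two (by linarith)
  simp only [hu.volume_active h.activeWeight_nonneg, ← mul_assoc, ENNReal.tsum_mul_right]
  exact ENNReal.mul_ne_top (h.tsum_gradBound_rpow_ne_top hρ hq₀ hβ) hu.volume_ne_top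

theorem memLp_jacobian_limitMap_of_lt
    (hu : IsStaircase Ω A b (activeWeight β₁ β₂) L (activeClass p s ρ A) (doneClass p s ρ) η u P Q)
    (h : IsAdmissible p s β₁ β₂) (hρ : 1 ≤ ρ) {q : ℝ} (hq₀ : 0 < q) (hq : q < tailExponent β₁ β₂) :
    MemLp (jacobian (limitMap u)) (ENNReal.ofReal q) (volume.restrict Ω) :=
  hu.memLp_jacobian_limitMap (fun _ _ => h.nnnorm_le_gradBound_of_mem_doneClass hρ)
    (hu.ae_exists_mem_done h.activeWeight_nonneg h.tendsto_prod_activeWeight) hq₀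
    (hu.tsum_gradBound_rpow_mul_volume_ne_top h (by linarith) hq₀.le hq)

theorem isWeakGradient_jacobian_limitMap
    (hu : IsStaircase Ω A b (activeWeight β₁ β₂) L (activeClass p s ρ A) (doneClass p s ρ) η u P Q)
    (h : IsAdmissible p s β₁ β₂) (hρ : 1 ≤ ρ) (hA₀ : ‖row A 0‖ < ρ)
    (hA₁ : ‖row A 1‖ < (s * ρ) ^ (p - 1)) :
    IsWeakGradient Ω (limitMap u) (jacobian (limitMap u)) := by
  have hfin := hu.tsum_gradBound_rpow_mul_volume_ne_top h (ρ := ρ) (by linarith) zero_le_one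
    h.one_lt_tailExponent
  simp only [ENNReal.rpow_one] at hfin
  exact hu.isWeakGradient_limitMap
    (fun _ _ => h.nnnorm_le_gradBound_of_mem_activeClass hρ hA₀ hA₁)
    (fun _ _ => h.nnnorm_le_gradBound_of_mem_doneClass hρ)
    (hu.ae_exists_mem_done h.activeWeight_nonneg h.tendsto_prod_activeWeight) hfin

theorem memW1_limitMap
    (hu : IsStaircase Ω A b (activeWeight β₁ β₂) L (activeClass p s ρ A) (doneClass p s ρ) η u P Q)
    (h : IsAdmissible p s β₁ β₂) (hρ : 1 ≤ ρ)
    (hgrad : IsWeakGradient Ω (limitMap u) (jacobian (limitMap u))) {q : ℝ} (hq₀ : 0 < q)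
    (hq : q < tailExponent β₁ β₂) : MemW1 (ENNReal.ofReal q) Ω (limitMap u) :=
  ⟨memLp_restrict_of_isBounded hu.regular.isBounded hu.continuous_limitMap _, _, hgrad,
    hu.memLp_jacobian_limitMap_of_lt h hρ hq₀ hq⟩

end IsStaircase

end Integrability

section Tail

variable {p s β₁ β₂ ρ : ℝ} {Ω : Set Plane} {A : Mat} {b : Plane} {L : ℕ → ℝ≥0} {η : ℕ → ℝ}
  {u : ℕ → Plane → Plane} {P Q : ℕ → Set (Set Plane)}

namespace IsStaircase

theorem volume_done_odd {S T : ℕ → Set Mat}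
    (hu : IsStaircase Ω A b (activeWeight β₁ β₂) L S T η u P Q)
    (h : IsAdmissible p s β₁ β₂) (m : ℕ) :
    volume (⋃₀ Q (2 * m + 3)) =
      ENNReal.ofReal ((1 - β₂) * β₁ * (β₁ * β₂) ^ m) * volume Ω := by
  rw [hu.volume_done h.activeWeight_nonneg, prod_activeWeight_odd, activeWeight_odd]
  ring_nf

theorem norm_row_jacobian_limitMap_of_mem_done {S : ℕ → Set Mat} {κ : ℕ → ℝ}
    (hu : IsStaircase Ω A b κ L S (doneClass p s ρ) η u P Q) {m : ℕ} {x : Plane}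
    (hx : x ∈ ⋃₀ Q (2 * m + 3)) : ‖row (jacobian (limitMap u) x) 0‖ = 2 * ρ * 2 ^ m := by
  have hT := hu.jacobian_limitMap_mem_of_mem_done hx
  rw [doneClass_odd] at hT
  rw [hT.2, mul_assoc]

theorem volume_real_lt_norm_jacobian_le
    (hu : IsStaircase Ω A b (activeWeight β₁ β₂) L (activeClass p s ρ A) (doneClass p s ρ) η u P Q)
    (h : IsAdmissible p s β₁ β₂) (hρ : 1 ≤ ρ) {m : ℕ} {t : ℝ} (ht : 2 * ρ * 2 ^ m ≤ t) :
    volume.real {x | x ∈ Ω ∧ t < ‖jacobian (limitMap u) x‖} ≤ (β₁ * β₂) ^ m * volume.real Ω := by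
  have hdone := hu.ae_exists_mem_done h.activeWeight_nonneg h.tendsto_prod_activeWeight
  rw [ae_restrict_iff' hu.regular.isOpen.measurableSet] at hdone
  have hactive : volume {x | x ∈ Ω ∧ t < ‖jacobian (limitMap u) x‖} ≤
      volume (⋃₀ P (2 * m + 2)) := by
    refine measure_mono_ae (hdone.mono fun x hx hxt => ?_)
    obtain ⟨n, hn⟩ := hx hxt.1
    refine hu.antitone ?_ ((hu.step n).done_subset hn)
    by_contra! hnm
    have hbound := h.nnnorm_le_gradBound_of_mem_doneClass hρ
      (hu.jacobian_limitMap_mem_of_mem_done hn)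
    rw [gradBound, Real.le_toNNReal_iff_coe_le (by positivity), coe_nnnorm] at hbound
    have hpow : (2 : ℝ) ^ (n / 2) ≤ 2 ^ m := pow_le_pow_right₀ one_le_two (by lia)
    have hscale : ρ * 2 ^ (n / 2) ≤ ρ * 2 ^ m := by gcongr
    linarith [hxt.2]
  rw [hu.volume_active h.activeWeight_nonneg, prod_activeWeight_even] at hactive
  have hreal := ENNReal.toReal_mono (ENNReal.mul_ne_top ENNReal.ofReal_ne_top hu.volume_ne_top)
    hactive
  rwa [ENNReal.toReal_mul, ENNReal.toReal_ofReal (pow_nonneg h.β_mul_pos.le m)] at hreal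

theorem le_volume_real_lt_norm_jacobian {S : ℕ → Set Mat}
    (hu : IsStaircase Ω A b (activeWeight β₁ β₂) L S (doneClass p s ρ) η u P Q)
    (h : IsAdmissible p s β₁ β₂) {m : ℕ} {t : ℝ} (ht : t < 2 * ρ * 2 ^ m) :
    (1 - β₂) * β₁ * (β₁ * β₂) ^ m * volume.real Ω ≤
      volume.real {x | x ∈ Ω ∧ t < ‖jacobian (limitMap u) x‖} := by
  have hc : 0 ≤ (1 - β₂) * β₁ * (β₁ * β₂) ^ m :=
    mul_nonneg h.complement_mul_pos.le (pow_nonneg h.β_mul_pos.le m)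
  have hsub : ⋃₀ Q (2 * m + 3) ⊆ {x | x ∈ Ω ∧ t < ‖jacobian (limitMap u) x‖} := fun x hx =>
    ⟨hu.done_subset _ hx, ht.trans_le
      ((hu.norm_row_jacobian_limitMap_of_mem_done hx).symm.le.trans (norm_row_le _ _))⟩
  have hreal := measureReal_mono (μ := volume) hsub
    (measure_ne_top_of_subset (fun x hx => hx.1) hu.volume_ne_top)
  rwa [Measure.real, hu.volume_done_odd h, ENNReal.toReal_mul, ENNReal.toReal_ofReal hc] at hreal

theorem tail_bounds
    (hu : IsStaircase Ω A b (activeWeight β₁ β₂) L (activeClass p s (initialRadius p s A) A)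
      (doneClass p s (initialRadius p s A)) η u P Q)
    (h : IsAdmissible p s β₁ β₂) {t : ℝ} (ht : 1 + ‖A‖ < t) :
    (tailConstant p s β₁ β₂)⁻¹ * (1 + ‖A‖ ^ ((p - 1) * tailExponent β₁ β₂)) *
        t ^ (-tailExponent β₁ β₂) ≤
      volume.real {x | x ∈ Ω ∧ t < ‖jacobian (limitMap u) x‖} / volume.real Ω ∧
    volume.real {x | x ∈ Ω ∧ t < ‖jacobian (limitMap u) x‖} / volume.real Ω ≤
      tailConstant p s β₁ β₂ * (1 + ‖A‖ ^ (tailExponent β₁ β₂ / (p - 1))) *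
        t ^ (-tailExponent β₁ β₂) := by
  have hΩ : 0 < volume.real Ω := ENNReal.toReal_pos hu.regular.volume_ne_zero hu.volume_ne_top
  have hq : 0 ≤ tailExponent β₁ β₂ := by linarith [h.one_lt_tailExponent]
  have ha := norm_nonneg A
  have ht₀ : 0 < t := by linarith
  have hρ := h.one_add_norm_le_initialRadius A
  constructor
  · have hlow := rpow_neg_le_of_forall_pow_le hq h.complement_mul_pos.le (a := 1 + ‖A‖)
      (r := 2 * initialRadius p s A) (by linarith) (by linarith) ht.le fun m hm => by
        rw [h.two_rpow_neg_tailExponent]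
        exact (le_div_iff₀ hΩ).2 (hu.le_volume_real_lt_norm_jacobian h hm)
    refine le_trans ?_ hlow
    rw [h.two_rpow_neg_tailExponent, ← mul_assoc ((1 - β₂) * β₁ * (β₁ * β₂))]
    exact mul_le_mul_of_nonneg_right (h.inv_tailConstant_mul_le A) (by positivity)
  · have hone : volume.real {x | x ∈ Ω ∧ t < ‖jacobian (limitMap u) x‖} / volume.real Ω ≤ 1 :=
      div_le_one_of_le₀ (measureReal_mono (fun x hx => hx.1) hu.volume_ne_top) hΩ.le
    refine (le_rpow_neg_of_forall_le_pow hq (r := 2 * initialRadius p s A) (by linarith) ht₀ hone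
      fun m hm => ?_).trans ?_
    · rw [h.two_rpow_neg_tailExponent]
      exact (div_le_iff₀ hΩ).2
        (hu.volume_real_lt_norm_jacobian_le h (h.one_le_initialRadius A) hm)
    · gcongr
      rw [← mul_assoc, show (2 : ℝ) * 2 = 4 by norm_num]
      exact h.four_mul_initialRadius_rpow_le_tailConstant A

theorem setLIntegral_row_rpow_done {S : ℕ → Set Mat}
    (hu : IsStaircase Ω A b (activeWeight β₁ β₂) L S (doneClass p s ρ) η u P Q)
    (h : IsAdmissible p s β₁ β₂) (hρ : 0 ≤ ρ) (m : ℕ) :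
    ∫⁻ x in ⋃₀ Q (2 * m + 3), ‖row (jacobian (limitMap u) x) 0‖ₑ ^ tailExponent β₁ β₂ =
      ENNReal.ofReal ((2 * ρ) ^ tailExponent β₁ β₂ * ((1 - β₂) * β₁)) * volume Ω := by
  have hβ := h.two_rpow_neg_tailExponent
  have hq : 0 ≤ tailExponent β₁ β₂ := by linarith [h.one_lt_tailExponent]
  generalize tailExponent β₁ β₂ = q at *
  have hcancel : (2 : ℝ) ^ q * 2 ^ (-q) = 1 := by
    rw [← Real.rpow_add two_pos, add_neg_cancel, Real.rpow_zero]
  have hconst : ∀ x ∈ ⋃₀ Q (2 * m + 3),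
      ‖row (jacobian (limitMap u) x) 0‖ₑ ^ q = ENNReal.ofReal ((2 * ρ * 2 ^ m) ^ q) := by
    intro x hx
    rw [← ofReal_norm, hu.norm_row_jacobian_limitMap_of_mem_done hx,
      ENNReal.ofReal_rpow_of_nonneg (by positivity) hq]
  rw [setLIntegral_congr_fun (hu.step _).done.isOpen_sUnion.measurableSet hconst,
    setLIntegral_const, hu.volume_done_odd h, ← mul_assoc, ← ENNReal.ofReal_mul (by positivity)]
  congr 2
  calc (2 * ρ * 2 ^ m) ^ q * ((1 - β₂) * β₁ * (β₁ * β₂) ^ m)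
      = (2 * ρ) ^ q * ((1 - β₂) * β₁) * (2 ^ q * 2 ^ (-q)) ^ m := by
        rw [← hβ, Real.mul_rpow (by positivity) (by positivity), ← Real.rpow_pow_comm two_pos.le,
          mul_pow]
        ring
    _ = (2 * ρ) ^ q * ((1 - β₂) * β₁) := by rw [hcancel, one_pow, mul_one]

theorem lintegral_row_rpow_eq_top {S : ℕ → Set Mat}
    (hu : IsStaircase Ω A b (activeWeight β₁ β₂) L S (doneClass p s ρ) η u P Q)
    (h : IsAdmissible p s β₁ β₂) (hρ : 0 < ρ) :
    ∫⁻ x in Ω, ‖row (jacobian (limitMap u) x) 0‖ₑ ^ tailExponent β₁ β₂ = ⊤ := by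
  have hsub : ⋃ m, ⋃₀ Q (2 * m + 3) ⊆ Ω := iUnion_subset fun m => hu.done_subset _
  have hmeas (m : ℕ) : MeasurableSet (⋃₀ Q (2 * m + 3)) :=
    (hu.step _).done.isOpen_sUnion.measurableSet
  have hpos : 0 < (2 * ρ) ^ tailExponent β₁ β₂ * ((1 - β₂) * β₁) :=
    mul_pos (by positivity) h.complement_mul_pos
  refine top_unique (le_trans ?_ (lintegral_mono_set hsub))
  rw [lintegral_iUnion hmeas fun i j hij => hu.disjoint_done (by lia)]
  simp only [hu.setLIntegral_row_rpow_done h hρ.le]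
  exact (ENNReal.tsum_const_eq_top_of_ne_zero
    (mul_ne_zero (ENNReal.ofReal_ne_zero_iff.2 hpos) hu.regular.volume_ne_zero)).ge

theorem lintegral_norm_rpow_eq_top {S : ℕ → Set Mat}
    (hu : IsStaircase Ω A b (activeWeight β₁ β₂) L S (doneClass p s ρ) η u P Q)
    (h : IsAdmissible p s β₁ β₂) (hρ : 0 < ρ) :
    ∫⁻ x in Ω, ‖jacobian (limitMap u) x‖ₑ ^ tailExponent β₁ β₂ = ⊤ := by
  have hq : 0 ≤ tailExponent β₁ β₂ := by linarith [h.one_lt_tailExponent]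
  refine top_unique ((hu.lintegral_row_rpow_eq_top h hρ).ge.trans (lintegral_mono fun x => ?_))
  exact ENNReal.rpow_le_rpow (enorm_le_iff_norm_le.2 (norm_row_le _ 0)) hq

end IsStaircase

theorem IsAdmissible.exists_isStaircase_holderNormOn_lt (h : IsAdmissible p s β₁ β₂)
    (hΩ : IsRegularDomain Ω) (A : Mat) (b : Plane) {α : ℝ≥0} (hα : α < 1) {δ : ℝ} (hδ : 0 < δ) :
    ∃ L η u P Q, IsStaircase Ω A b (activeWeight β₁ β₂) L (activeClass p s (initialRadius p s A) A)
      (doneClass p s (initialRadius p s A)) η u P Q ∧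
      holderNormOn α (closure Ω) (fun x => limitMap u x - affineMap A b x) < ENNReal.ofReal δ := by
  obtain ⟨η, u, P, Q, hu, hsup, hhol⟩ := exists_isStaircase_holderWith hΩ b
    (S := activeClass p s (initialRadius p s A) A) rfl
    (h.stepRule_activeClass (h.one_le_initialRadius A) (h.norm_row_zero_lt_initialRadius A)
      (h.norm_row_one_lt A)) hα (Real.toNNReal_pos.2 (div_pos hδ three_pos))
  exact ⟨_, η, u, P, Q, hu, holderNormOn_lt_ofReal hδ (fun x _ => hsup x) hhol⟩

end Tail

end PLaplace

open PLaplace in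
theorem mainTheorem12 (p : ℝ) (hp1 : 1 < p) (hp2 : p < 2) :
    ∃ qbar M : ℝ, 1 < qbar ∧ qbar < p ∧ 1 < M ∧
      ∀ (A : PLaplace.Mat) (b : PLaplace.Plane) (α : ℝ≥0) (δ : ℝ) (Ω : Set PLaplace.Plane),
        0 < α → α < 1 → 0 < δ → δ < 1 → PLaplace.IsRegularDomain Ω →
        ∃ (u : PLaplace.Plane → PLaplace.Plane) (G : PLaplace.Plane → PLaplace.Mat),
          PLaplace.IsPiecewiseAffine Ω u ∧
          PLaplace.MemW1 1 Ω u ∧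
          PLaplace.IsWeakGradient Ω u G ∧
          PLaplace.holderNormOn α (closure Ω) u < ⊤ ∧
          (∀ x ∈ frontier Ω, u x = PLaplace.affineMap A b x) ∧
          PLaplace.holderNormOn α (closure Ω) (fun x => u x - PLaplace.affineMap A b x)
            < ENNReal.ofReal δ ∧
          (∀ᵐ x ∂(volume.restrict Ω), G x ∈ PLaplace.K p) ∧
          (∀ t : ℝ, 1 + ‖A‖ < t →
            M⁻¹ * (1 + ‖A‖ ^ ((p - 1) * qbar)) * t ^ (-qbar)
                ≤ volume.real {x | x ∈ Ω ∧ t < ‖G x‖} / volume.real Ω ∧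
              volume.real {x | x ∈ Ω ∧ t < ‖G x‖} / volume.real Ω
                ≤ M * (1 + ‖A‖ ^ (qbar / (p - 1))) * t ^ (-qbar)) ∧
          (∀ q : ℝ, 1 ≤ q → q < qbar → PLaplace.MemW1 (ENNReal.ofReal q) Ω u) ∧
          ∫⁻ x in Ω, ‖G x‖ₑ ^ qbar = ⊤ ∧
          PLaplace.IsVeryWeakPLaplaceSolution p Ω (fun x => u x 0) ∧
          ∫⁻ x in Ω, ‖(WithLp.toLp 2 (G x 0) : PLaplace.Plane)‖ₑ ^ qbar = ⊤ := by
  obtain ⟨s, β₁, β₂, h⟩ := exists_isAdmissible hp1 hp2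
  refine ⟨tailExponent β₁ β₂, tailConstant p s β₁ β₂, h.one_lt_tailExponent, h.tailExponent_lt,
    h.one_lt_tailConstant, fun A b α δ Ω _ hα hδ _ hΩ => ?_⟩
  obtain ⟨L, η, u, P, Q, hu, hclose⟩ := h.exists_isStaircase_holderNormOn_lt hΩ A b hα hδ
  have hρ := h.one_le_initialRadius A
  have hpos : 0 < initialRadius p s A := zero_lt_one.trans_le hρ
  have hgrad := hu.isWeakGradient_jacobian_limitMap h hρ (h.norm_row_zero_lt_initialRadius A)
    (h.norm_row_one_lt A)
  have hL1 := hu.memLp_jacobian_limitMap_of_lt h hρ zero_lt_one h.one_lt_tailExponent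
  have hW1 := hu.memW1_limitMap h hρ hgrad zero_lt_one h.one_lt_tailExponent
  rw [ENNReal.ofReal_one] at hL1 hW1
  have hK := hu.ae_jacobian_limitMap_mem_K h
  have hdone := hu.ae_exists_mem_done h.activeWeight_nonneg h.tendsto_prod_activeWeight
  exact ⟨limitMap u, jacobian (limitMap u), hu.isPiecewiseAffine_limitMap hdone, hW1, hgrad,
    holderNormOn_lt_top_of_sub_affineMap hα.le hΩ.isBounded.closure hclose,
    fun x hx => hu.limitMap_eq_of_notMem fun hxΩ => hx.2 (by rwa [hΩ.isOpen.interior_eq]),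
    hclose, hK, fun t => hu.tail_bounds h,
    fun q hq₁ => hu.memW1_limitMap h hρ hgrad (zero_lt_one.trans_le hq₁),
    hu.lintegral_norm_rpow_eq_top h hpos, isVeryWeakPLaplaceSolution_of_mem_K hp1 hgrad hL1 hK,
    hu.lintegral_row_rpow_eq_top h hpos⟩
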